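/- **Conventions.** Let $p\colon X\to A$ be an inner fibration of simplicial sets. An edge $f$ of $X$ is *$p$-Cartesian* if for all $n\ge 2$ every lifting problem of $\Lambda^n_n\to\Delta^n$ against $p$ whose restriction to $\Delta^{\{n-1,n\}}$ is $f$ has a solution. The inner fibration $p$ is a *Cartesian fibration* if for every vertex $y$ of $X$ and every edge $g$ of $A$ with target $p(y)$ there is a $p$-Cartesian edge with target $y$ lying over $g$. A *marked simplicial set* is a simplicial set with a set of marked edges containing all degenerate edges; maps preserve marked edges. $K^\flat$ has exactly the degenerate edges marked, $K^\sharp$ has all edges marked. For a map $i\colon K\to L$ of marked simplicial sets write $I\otimes K=(\Delta^1)^\sharp\times K$, $\partial I\otimes K=K\sqcup K$, and let $\partial_1\boxtimes i\colon I\otimes K\sqcup_{\{1\}\times K}\{1\}\times L\to I\otimes L$ and $\partial I\boxtimes i\colon I\otimes K\sqcup_{\partial I\otimes K}\partial I\otimes L\to I\otimes L$ be the induced maps. A class $W$ of maps whose underlying maps are monomorphisms is a *class of right anodyne extensions* if $W=l(r(\Lambda))$ (the maps with the left lifting property against all maps that have the right lifting property against $\Lambda$) for a small set $\Lambda$ of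 such maps, $\partial_1\boxtimes i\in W$ for every $i$ with underlying monomorphism, and $\partial I\boxtimes i\in W$ for every $i\in W$. The *marked right anodyne extensions* are the smallest such class containing $(\Lambda^n_k)^\flat\to(\Delta^n)^\flat$ for $n\ge2$, $0<k<n$, and $J^\flat\to J^\sharp$, where $J$ is the nerve of the free walking isomorphism. A *marked right fibration* is a map with the right lifting property against all marked right anodyne extensions. The *Cartesian model structure* on $\mathbf{sSet}^+/A^\sharp$ has as cofibrations the maps over $A^\sharp$ whose underlying map is a monomorphism, and as weak equivalences the maps $Y\to Y'$ over $A^\sharp$ such that $[Y',W]\to[Y,W]$ is bijective for all marked right fibrations $W\to A^\sharp$; here $[Y,W]$ is the set of maps $Y\to W$ over $A^\sharp$ modulo the equivalence relation generated by homotopies $(\Delta^1)^\sharp\times Y\to W$ over $A^\sharp$. Its fibrations are the maps with the right lifting property against all maps that are both cofibrations and weak equivalences, and an object is fibrant if its map to the terminal object is a fibration. **Statement.** Let $A$ be a simplicial set. 1. Let $p\colon X\to A$ be an inner fibration of simplicial sets. Then $p$ is a Cartesian fibration if and only if the $p$-Cartesian edges include all degenerate edges of $X$, so that $X$ with exactly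 the $p$-Cartesian edges marked is a marked simplicial set $X^\natural$, and the map $X^\natural\to A^\sharp$ is a marked right fibration. 2. A marked simplicial set $(X,E_X)$ over $A^\sharp$, with underlying map $p\colon X\to A$, is a fibrant object of the Cartesian model structure on $\mathbf{sSet}^+/A^\sharp$ if and only if $p$ is a Cartesian fibration and $E_X$ is precisely the set of $p$-Cartesian edges, i.e. $(X,E_X)=X^\natural$. -/

import Mathlib

open CategoryTheory Limits MonoidalCategory CartesianMonoidalCategory Simplicial Opposite

universe v u

/-!
### Contravariant model structures from a functorial cylinder
-/

/-- An endofunctor `I` with natural maps `∂₀, ∂₁ : id ⟶ I` and `σ : I ⟶ id`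
such that `σ ∂₀ = σ ∂₁ = id`. -/
structure FunctorialCylinder (C : Type u) [Category.{v} C] where
  I : C ⥤ C
  d₀ : 𝟭 C ⟶ I
  d₁ : 𝟭 C ⟶ I
  σ : I ⟶ 𝟭 C
  d₀_σ : d₀ ≫ σ = 𝟙 (𝟭 C)
  d₁_σ : d₁ ≫ σ = 𝟙 (𝟭 C)

namespace FunctorialCylinder

section

variable {C : Type u} [Category.{v} C] (Z : FunctorialCylinder C)

/-- The map `∂₁ ⊠ i : I ⊗ K ⊔_{{1} ⊗ K} {1} ⊗ L ⟶ I ⊗ L` attached to `i : K ⟶ L`. -/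
noncomputable def boxOne [HasPushouts C] {K L : C} (i : K ⟶ L) :
    pushout (Z.d₁.app K) i ⟶ Z.I.obj L :=
  pushout.desc (Z.I.map i) (Z.d₁.app L) (Z.d₁.naturality i).symm

/-- The map `∂₀ ⊔ ∂₁ : K ⊔ K ⟶ I ⊗ K`. -/
noncomputable def boundary [HasBinaryCoproducts C] (K : C) : K ⨿ K ⟶ Z.I.obj K :=
  coprod.desc (Z.d₀.app K) (Z.d₁.app K)

lemma boundary_naturality [HasBinaryCoproducts C] {K L : C} (i : K ⟶ L) :
    Z.boundary K ≫ Z.I.map i = coprod.map i i ≫ Z.boundary L := by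
  have h₀ := Z.d₀.naturality i
  have h₁ := Z.d₁.naturality i
  dsimp at h₀ h₁
  ext <;> simp [boundary, h₀, h₁]

/-- The map `∂I ⊠ i : I ⊗ K ⊔_{∂I ⊗ K} ∂I ⊗ L ⟶ I ⊗ L` attached to `i : K ⟶ L`,
where `∂I ⊗ K = K ⊔ K`. -/
noncomputable def boxBoundary [HasPushouts C] [HasBinaryCoproducts C] {K L : C} (i : K ⟶ L) :
    pushout (Z.boundary K) (coprod.map i i) ⟶ Z.I.obj L :=
  pushout.desc (Z.I.map i) (Z.boundary L) (Z.boundary_naturality i)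

/-- `W` is a class of right `I`-anodyne extensions relative to the class `Cof`
(the left class of the given weak factorization system). -/
structure IsRightAnodyneClass [HasPushouts C] [HasBinaryCoproducts C]
    (Cof W : MorphismProperty C) : Prop where
  le_cof : W ≤ Cof
  exists_generators : ∃ G : MorphismProperty C,
    MorphismProperty.IsSmall.{v} G ∧ G ≤ Cof ∧ W = G.rlp.llp
  boxOne_mem : ∀ ⦃K L : C⦄ (i : K ⟶ L), Cof i → W (Z.boxOne i)
  boxBoundary_mem : ∀ ⦃K L : C⦄ (i : K ⟶ L), W i → W (Z.boxBoundary i)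

/-- The smallest class of right `I`-anodyne extensions which contains `S`. -/
def rightAnodyne [HasPushouts C] [HasBinaryCoproducts C]
    (Cof S : MorphismProperty C) : MorphismProperty C :=
  fun _ _ f => ∀ W : MorphismProperty C, Z.IsRightAnodyneClass Cof W → S ≤ W → W f

/-- The cylinder on `C/A` induced by a cylinder on `C`: it sends `p : X ⟶ A` to
`I ⊗ X ⟶ X ⟶ A`. -/
@[simps]
def slice (A : C) : FunctorialCylinder (Over A) where
  I :=
    { obj X := Over.mk (Z.σ.app X.left ≫ X.hom)
      map {X Y} f := Over.homMk (Z.I.map f.left) (by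
        have := Z.σ.naturality f.left
        dsimp at this
        simp [reassoc_of% this]) }
  d₀ := { app X := Over.homMk (Z.d₀.app X.left) (by
            have := congr_app Z.d₀_σ X.left
            dsimp at this ⊢
            simp [reassoc_of% this])
          naturality X Y f := by
            ext
            exact Z.d₀.naturality f.left }
  d₁ := { app X := Over.homMk (Z.d₁.app X.left) (by
            have := congr_app Z.d₁_σ X.left
            dsimp at this ⊢
            simp [reassoc_of% this])
          naturality X Y f := by
            ext
            exact Z.d₁.naturality f.left }
  σ := { app X := Over.homMk (Z.σ.app X.left) rfl
         naturality X Y f := by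
            ext
            exact Z.σ.naturality f.left }
  d₀_σ := by
    ext X
    exact congr_app Z.d₀_σ X.left
  d₁_σ := by
    ext X
    exact congr_app Z.d₁_σ X.left

/-- There is an `I`-homotopy from `f` to `g`. -/
def HomotopyRel {X Y : C} (f g : X ⟶ Y) : Prop :=
  ∃ h : Z.I.obj X ⟶ Y, Z.d₀.app X ≫ h = f ∧ Z.d₁.app X ≫ h = g

/-- The set `[X, Y]_I`: the quotient of `X ⟶ Y` by the equivalence relation generated
by `I`-homotopy. -/
def HomotopyClass (X Y : C) : Type v := Quot (Z.HomotopyRel (X := X) (Y := Y))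

/-- The map `f^* : [B, W]_I → [A, W]_I` induced by `f : A ⟶ B`. -/
def precomp {A B : C} (f : A ⟶ B) (W : C) : Z.HomotopyClass B W → Z.HomotopyClass A W :=
  Quot.map (fun g => f ≫ g) (by
    rintro g g' ⟨h, h₀, h₁⟩
    have e₀ := Z.d₀.naturality f
    have e₁ := Z.d₁.naturality f
    dsimp at e₀ e₁
    exact ⟨Z.I.map f ≫ h, by rw [← h₀, ← reassoc_of% e₀], by rw [← h₁, ← reassoc_of% e₁]⟩)

variable [HasTerminal C]

/-- Given a class `An` of right anodyne extensions: the object `W` is right `I`-fibrant. -/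
def IsRightFibrant (An : MorphismProperty C) (W : C) : Prop :=
  An.rlp (terminal.from W)

/-- The weak equivalences of the contravariant model structure: the maps `f : A ⟶ B` such that
`f^* : [B, W]_I → [A, W]_I` is bijective for all right `I`-fibrant objects `W`. -/
def weakEquivalences (An : MorphismProperty C) : MorphismProperty C :=
  fun _ _ f => ∀ W : C, IsRightFibrant An W → Function.Bijective (Z.precomp f W)

/-- The fibrations of the contravariant model structure, i.e. the maps with the right lifting
property with respect to the maps that are both cofibrations and weak equivalences. -/
def fibrations (Cof An : MorphismProperty C) : MorphismProperty C :=
  (Cof ⊓ Z.weakEquivalences An).rlp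

/-- The fibrant objects of the contravariant model structure. -/
def IsFibrantObject (Cof An : MorphismProperty C) (X : C) : Prop :=
  Z.fibrations Cof An (terminal.from X)

end

end FunctorialCylinder

/-!
### Cartesian edges and Cartesian fibrations
-/

namespace SSet

/-- The edge `Δ^{n-1,n}` of the horn `Λ^n_n`, for `n = m + 2`. -/
def hornLastEdge (m : ℕ) : (Λ[m + 2, Fin.last (m + 2)] : SSet.{u}) _⦋1⦌ :=
  horn.edge (m + 2) (Fin.last (m + 2)) (Fin.last (m + 1)).castSucc (Fin.last (m + 2))
    (Fin.le_last _) (by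
      rw [Finset.insert_comm, Finset.pair_eq_singleton]
      exact Finset.card_le_two.trans (by omega))

/-- An edge `f` of `X` is `p`-Cartesian if, for all `n ≥ 2`, every lifting problem of
`Λ^n_n ⟶ Δ^n` against `p` whose restriction to `Δ^{n-1,n}` is `f` has a solution. -/
def IsCartesianEdge {X A : SSet.{u}} (p : X ⟶ A) (f : X _⦋1⦌) : Prop :=
  ∀ (m : ℕ) (a : (Λ[m + 2, Fin.last (m + 2)] : SSet.{u}) ⟶ X) (b : Δ[m + 2] ⟶ A),
    a ≫ p = Λ[m + 2, Fin.last (m + 2)].ι ≫ b →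
    a.app _ (hornLastEdge m) = f →
    ∃ l : Δ[m + 2] ⟶ X, Λ[m + 2, Fin.last (m + 2)].ι ≫ l = a ∧ l ≫ p = b

/-- A Cartesian fibration is an inner fibration `p : X ⟶ A` such that for every vertex `y` of `X`
and every edge `g` of `A` with target `p y` there is a `p`-Cartesian edge over `g` with
target `y`. (The face `δ 0` of an edge is its target.) -/
structure IsCartesianFibration {X A : SSet.{u}} (p : X ⟶ A) : Prop where
  innerFibration : InnerFibration p
  exists_lift : ∀ (y : X _⦋0⦌) (g : A _⦋1⦌), A.δ 0 g = p.app _ y →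
    ∃ f : X _⦋1⦌, X.δ 0 f = y ∧ p.app _ f = g ∧ IsCartesianEdge p f

end SSet

/-!
### Marked simplicial sets
-/

/-- A marked simplicial set: a simplicial set with a set of marked edges which contains all
degenerate edges. -/
structure MarkedSSet where
  toSSet : SSet.{u}
  marked : Set (toSSet _⦋1⦌)
  degenerate_mem : ∀ x : toSSet _⦋0⦌, toSSet.σ 0 x ∈ marked

namespace MarkedSSet

/-- Maps of simplicial sets which preserve the marked edges. -/
@[ext]
structure Hom (X Y : MarkedSSet.{u}) where
  hom : X.toSSet ⟶ Y.toSSet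
  map_marked : ∀ e ∈ X.marked, hom.app _ e ∈ Y.marked

instance : Category.{u} MarkedSSet.{u} where
  Hom := Hom
  id X := ⟨𝟙 _, fun _ he => he⟩
  comp f g := ⟨f.hom ≫ g.hom, fun e he => g.map_marked _ (f.map_marked e he)⟩

@[ext]
lemma hom_ext {X Y : MarkedSSet.{u}} {f g : X ⟶ Y} (h : f.hom = g.hom) : f = g :=
  Hom.ext h

@[simp]
lemma id_hom (X : MarkedSSet.{u}) : (𝟙 X : X ⟶ X).hom = 𝟙 X.toSSet := rfl

@[simp]
lemma comp_hom {X Y W : MarkedSSet.{u}} (f : X ⟶ Y) (g : Y ⟶ W) :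
    (f ≫ g).hom = f.hom ≫ g.hom := rfl

/-- The forgetful functor to simplicial sets. -/
@[simps]
def forget : MarkedSSet.{u} ⥤ SSet.{u} where
  obj X := X.toSSet
  map f := f.hom

lemma map_degenerate_mem {K : SSet.{u}} (X : MarkedSSet.{u}) (f : K ⟶ X.toSSet) (x : K _⦋0⦌) :
    f.app _ (K.σ 0 x) ∈ X.marked := by
  rw [SSet.σ_naturality_apply]
  exact X.degenerate_mem _

/-- The colimit of the underlying simplicial sets, where the marked edges are the images of
the marked edges and the degenerate edges. -/
noncomputable def colimitCocone {J : Type u} [SmallCategory J] (F : J ⥤ MarkedSSet.{u}) :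
    Cocone F where
  pt :=
    { toSSet := colimit (F ⋙ forget)
      marked := { e | (∃ x, e = (colimit (F ⋙ forget)).σ 0 x) ∨
        ∃ (j : J) (e' : (F.obj j).toSSet _⦋1⦌), e' ∈ (F.obj j).marked ∧
          e = (colimit.ι (F ⋙ forget) j).app _ e' }
      degenerate_mem := fun x => Or.inl ⟨x, rfl⟩ }
  ι :=
    { app j := ⟨colimit.ι (F ⋙ forget) j, fun e he => Or.inr ⟨j, e, he, rfl⟩⟩
      naturality j j' f := by
        exact hom_ext ((colimit.w (F ⋙ forget) f).trans (Category.comp_id _).symm) }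

noncomputable def isColimitColimitCocone {J : Type u} [SmallCategory J]
    (F : J ⥤ MarkedSSet.{u}) : IsColimit (colimitCocone F) where
  desc s := ⟨colimit.desc (F ⋙ forget) (forget.mapCocone s), by
    rintro e (⟨x, rfl⟩ | ⟨j, e', he', rfl⟩)
    · exact map_degenerate_mem s.pt (colimit.desc (F ⋙ forget) (forget.mapCocone s)) x
    · have h := (s.ι.app j).map_marked e' he'
      have h' : colimit.ι (F ⋙ forget) j ≫ colimit.desc (F ⋙ forget) (forget.mapCocone s) =
        (s.ι.app j).hom := colimit.ι_desc _ _
      rw [← h'] at h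
      exact h⟩
  fac s j := hom_ext (colimit.ι_desc (forget.mapCocone s) j)
  uniq s m hm := by
    ext1
    refine colimit.hom_ext (fun j => ?_)
    exact (congrArg Hom.hom (hm j)).trans (colimit.ι_desc (forget.mapCocone s) j).symm

instance : HasColimits MarkedSSet.{u} where
  has_colimits_of_shape _ _ := ⟨fun F => ⟨⟨⟨_, isColimitColimitCocone F⟩⟩⟩⟩

/-- `K^♭`: exactly the degenerate edges are marked. -/
@[simps]
def flat (K : SSet.{u}) : MarkedSSet.{u} where
  toSSet := K
  marked := { e | ∃ x, e = K.σ 0 x }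
  degenerate_mem x := ⟨x, rfl⟩

/-- `K^♯`: all edges are marked. -/
@[simps]
def sharp (K : SSet.{u}) : MarkedSSet.{u} where
  toSSet := K
  marked := Set.univ
  degenerate_mem _ := Set.mem_univ _

/-- The map `K^♭ ⟶ X` of marked simplicial sets given by a map `K ⟶ X` of simplicial sets. -/
@[simps]
def ofFlat {K : SSet.{u}} {X : MarkedSSet.{u}} (f : K ⟶ X.toSSet) : flat K ⟶ X where
  hom := f
  map_marked := by
    rintro _ ⟨x, rfl⟩
    exact map_degenerate_mem X f x

/-- The map `X ⟶ K^♯` of marked simplicial sets given by a map `X ⟶ K` of simplicial sets. -/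
@[simps]
def toSharp {K : SSet.{u}} {X : MarkedSSet.{u}} (f : X.toSSet ⟶ K) : X ⟶ sharp K where
  hom := f
  map_marked _ _ := Set.mem_univ _

/-- The product of marked simplicial sets: an edge is marked if both components are. -/
@[simps]
def prod (X Y : MarkedSSet.{u}) : MarkedSSet.{u} where
  toSSet := X.toSSet ⊗ Y.toSSet
  marked := { e | e.1 ∈ X.marked ∧ e.2 ∈ Y.marked }
  degenerate_mem x := ⟨X.degenerate_mem x.1, Y.degenerate_mem x.2⟩

/-- The cylinder `X ↦ X × (Δ^1)^♯` on marked simplicial sets, with `∂₀` and `∂₁` the inclusions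
at the vertices `0` and `1` of `Δ^1`. -/
@[simps]
noncomputable def cylinder : FunctorialCylinder MarkedSSet.{u} where
  I :=
    { obj X := X.prod (sharp Δ[1])
      map {X Y} f := ⟨f.hom ▷ Δ[1], fun e he => ⟨f.map_marked _ he.1, Set.mem_univ _⟩⟩
      map_id X := hom_ext (id_whiskerRight _ _)
      map_comp f g := hom_ext (comp_whiskerRight _ _ _) }
  d₀ := { app X := ⟨SSet.ι₀, fun e he => ⟨he, Set.mem_univ _⟩⟩ }
  d₁ := { app X := ⟨SSet.ι₁, fun e he => ⟨he, Set.mem_univ _⟩⟩ }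
  σ := { app X := ⟨fst X.toSSet Δ[1], fun e he => he.1⟩ }
  d₀_σ := rfl
  d₁_σ := rfl

/-- The maps of marked simplicial sets whose underlying map of simplicial sets is a
monomorphism. -/
def monos : MorphismProperty MarkedSSet.{u} :=
  (MorphismProperty.monomorphisms SSet.{u}).inverseImage forget

/-- The maps `(Λ^n_k)^♭ ⟶ (Δ^n)^♭` for `n ≥ 2` and `0 < k < n`. -/
inductive flatInnerHorns : MorphismProperty MarkedSSet.{u} where
  | intro {n : ℕ} (k : Fin (n + 3)) (h0 : 0 < k) (hn : k < Fin.last (n + 2)) :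
      flatInnerHorns (ofFlat (X := flat Δ[n + 2]) Λ[n + 2, k].ι)

/-- The map `J^♭ ⟶ J^♯` for the nerve `J` of the free walking isomorphism. -/
inductive flatSharpIso : MorphismProperty MarkedSSet.{u} where
  | intro : flatSharpIso
      (ofFlat (X := sharp SSet.coherentIso.{u}) (𝟙 SSet.coherentIso.{u}))

/-- The maps `(Λ^n_k)^♭ ⟶ (Δ^n)^♭` for `n ≥ 2` and `0 < k < n`, and the map `J^♭ ⟶ J^♯`. -/
def generators : MorphismProperty MarkedSSet.{u} := flatInnerHorns ⊔ flatSharpIso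

/-- The marked right anodyne extensions: the smallest class of right anodyne extensions for the
cylinder `X × (Δ^1)^♯` which contains `generators`. -/
noncomputable def markedRightAnodyne : MorphismProperty MarkedSSet.{u} :=
  cylinder.rightAnodyne monos generators

/-- The marked right fibrations. -/
noncomputable def markedRightFibrations : MorphismProperty MarkedSSet.{u} :=
  markedRightAnodyne.rlp

/-- The fibrant objects of the Cartesian model structure on `sSet⁺/B`, i.e. of the contravariant
model structure on `sSet⁺/B` for the cylinder induced by `X × (Δ^1)^♯`, where the cofibrations
are the maps over `B` whose underlying map is a monomorphism, and the right anodyne extensions are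
the maps over `B` whose underlying map is marked right anodyne. -/
def IsCartesianFibrant {B : MarkedSSet.{u}} (Y : Over B) : Prop :=
  (cylinder.slice B).IsFibrantObject (monos.over (X := B)) (markedRightAnodyne.over (X := B)) Y

/-- `X^♮`: the simplicial set `X` with exactly the `p`-Cartesian edges marked. This is a marked
simplicial set only if all degenerate edges of `X` are `p`-Cartesian. -/
@[simps]
def natural {X A : SSet.{u}} (p : X ⟶ A)
    (h : ∀ x : X _⦋0⦌, SSet.IsCartesianEdge p (X.σ 0 x)) : MarkedSSet.{u} where
  toSSet := X
  marked := { e | SSet.IsCartesianEdge p e }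
  degenerate_mem := h

end MarkedSSet

/-!
### Extending maps along attachments of simplices
-/

namespace SSet

section

variable {T X A : SSet.{u}}

/-! Marked right fibrations are detected by a small set of maps (`rlp_markedRightAnodyne`): inner
horns, `J^♭ ⟶ J^♯`, and `∂₁ ⊠ i` for `i` either `(∂Δ^n)^♭ ⟶ (Δ^n)^♭` or `(Δ^1)^♭ ⟶ (Δ^1)^♯`. The
point is that the saturation of this set is stable under `∂I ⊠ -`. Since the cylinder has a right
adjoint, the path object, this amounts to lifting the generators against `pathBoundary q`: inner
anodyne maps are stable under pushout products, the two coordinates of `I ⊗ I` may be exchanged, and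
markings spread from the end `1` of a cylinder.

For a Cartesian fibration with its Cartesian edges marked, the conditions read as follows. `∂Δ^0`
gives the existence of Cartesian lifts. `∂Δ^n` with `n > 0` gives a prism filled by inner horns and
one outer horn with Cartesian last edge. `(Δ^1)^♭ ⟶ (Δ^1)^♯` follows from composition and
cancellation of Cartesian edges, and `J^♭ ⟶ J^♯` holds because equivalences are Cartesian. To prove
these closure properties, write `Δ^{m+2}` as `[m] ⋆ [1]`. A lifting problem for `Λ^{m+2}_{m+2}` with
last edge `e` is enlarged to `[m] ⋆ [k]` by a simplex `Θ : Δ[k] ⟶ X` containing `e` and edges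
already known to be Cartesian, and the larger problem is solved by matching faces
(`CartesianExtension.pivot`). If `p Θ` is not controlled, only base simplices constant up to the
last vertex are reached (`IsLocallyCartesianEdge`); comparing `e` with a Cartesian lift of `p e`
then makes `e` a retract of that lift, hence Cartesian.

Conversely, a marked right fibration has marked lifts of edges. Marked edges are Cartesian because a
homotopy pushing the vertex `m + 1` to `m + 2` presents the outer horn inclusion as a retract of its
own `∂₁ ⊠ -`. A Cartesian edge `e` is compared with a marked edge `f` having the same target and
image: they are joined by a homotopy parametrized by `J`, whose trace on the source is marked by
lifting against `J^♭ ⟶ J^♯`, and then the marking of `f` spreads to `e`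
(`mem_marked_of_isCartesianEdge`).

The fibrant objects are the marked right fibrations (`isCartesianFibrant_iff`). Marked right anodyne
maps are trivial cofibrations; along any trivial cofibration, a map to a marked right fibration
extends up to homotopy, and homotopy extension makes the extension strict. -/

lemma Subcomplex.exists_desc_sup (S₁ S₂ : T.Subcomplex) (u₁ : (S₁ : SSet.{u}) ⟶ X)
    (u₂ : (S₂ : SSet.{u}) ⟶ X)
    (h : ∀ (d) (x : T.obj d) (h₁ : x ∈ S₁.obj d) (h₂ : x ∈ S₂.obj d),
      u₁.app d ⟨x, h₁⟩ = u₂.app d ⟨x, h₂⟩) :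
    ∃ u : ((S₁ ⊔ S₂ : T.Subcomplex) : SSet.{u}) ⟶ X,
      Subcomplex.homOfLE le_sup_left ≫ u = u₁ ∧ Subcomplex.homOfLE le_sup_right ≫ u = u₂ := by
  have sq : Subcomplex.BicartSq (S₁ ⊓ S₂) S₁ S₂ (S₁ ⊔ S₂) := ⟨rfl, rfl⟩
  have w : Subcomplex.homOfLE sq.le₁₂ ≫ u₁ = Subcomplex.homOfLE sq.le₁₃ ≫ u₂ := by
    ext d ⟨x, hx⟩
    exact h d x hx.1 hx.2
  exact ⟨sq.isPushout.desc u₁ u₂ w, sq.isPushout.inl_desc _ _ _, sq.isPushout.inr_desc _ _ _⟩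

lemma Subcomplex.hom_ext_sup {S₁ S₂ : T.Subcomplex}
    {f g : ((S₁ ⊔ S₂ : T.Subcomplex) : SSet.{u}) ⟶ X}
    (h₁ : Subcomplex.homOfLE le_sup_left ≫ f = Subcomplex.homOfLE le_sup_left ≫ g)
    (h₂ : Subcomplex.homOfLE le_sup_right ≫ f = Subcomplex.homOfLE le_sup_right ≫ g) :
    f = g := by
  have sq : Subcomplex.BicartSq (S₁ ⊓ S₂) S₁ S₂ (S₁ ⊔ S₂) := ⟨rfl, rfl⟩
  exact sq.isPushout.hom_ext h₁ h₂

/-- A lift defined on a subcomplex `S` of `T` and a compatible lift on `L`, for a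
monomorphism `t : L ⟶ T`, glue to a lift defined on `S ⊔ range t`. -/
lemma Subcomplex.exists_lift_sup_range (p : X ⟶ A) (S : T.Subcomplex) {L : SSet.{u}} (t : L ⟶ T)
    [Mono t] (b : T ⟶ A) (u : (S : SSet.{u}) ⟶ X) (hu : u ≫ p = S.ι ≫ b)
    (l : L ⟶ X) (hl : l ≫ p = t ≫ b)
    (h : (S.preimage t).ι ≫ l = S.fromPreimage t ≫ u) :
    ∃ u' : ((S ⊔ Subcomplex.range t : T.Subcomplex) : SSet.{u}) ⟶ X,
      Subcomplex.homOfLE le_sup_left ≫ u' = u ∧ u' ≫ p = Subcomplex.ι _ ≫ b := by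
  have key : Subcomplex.toRange t ≫ inv (Subcomplex.toRange t) ≫ l = l := by simp
  obtain ⟨u', h₁, h₂⟩ := Subcomplex.exists_desc_sup S (Subcomplex.range t) u
    (inv (Subcomplex.toRange t) ≫ l) (by
      rintro d _ h₁ ⟨y, rfl⟩
      have e₁ := ConcreteCategory.congr_hom (congr_app h d) ⟨y, h₁⟩
      have e₂ := ConcreteCategory.congr_hom (congr_app key d) y
      exact e₁.symm.trans e₂.symm)
  refine ⟨u', h₁, Subcomplex.hom_ext_sup ?_ ?_⟩
  · rw [reassoc_of% h₁, hu, Subcomplex.homOfLE_ι_assoc]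
  · rw [reassoc_of% h₂, hl, IsIso.inv_comp_eq]
    rfl

/-- Every lift on `S` of a map to the base of an inner fibration extends to `S'`,
provided that the edges in `M` are sent to Cartesian edges. -/
def CartesianExtension (M : Set (T _⦋1⦌)) (S S' : T.Subcomplex) : Prop :=
  ∃ hSS' : S ≤ S', ∀ ⦃X A : SSet.{u}⦄ (p : X ⟶ A) (_ : InnerFibration p) (b : T ⟶ A)
    (u : (S : SSet.{u}) ⟶ X), u ≫ p = S.ι ≫ b →
    (∀ e (he : e ∈ S.obj _), e ∈ M → IsCartesianEdge p (u.app _ ⟨e, he⟩)) →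
    ∃ u' : (S' : SSet.{u}) ⟶ X, Subcomplex.homOfLE hSS' ≫ u' = u ∧ u' ≫ p = S'.ι ≫ b

namespace CartesianExtension

variable {M : Set (T _⦋1⦌)} {S S' S'' : T.Subcomplex}

lemma refl : CartesianExtension M S S :=
  ⟨le_rfl, fun _ _ _ _ _ u hu _ => ⟨u, rfl, hu⟩⟩

/-- The assumption `M ⊆ S` is what permits composition: an extension does not change the values on
`M`, so these edges stay Cartesian for the second step. -/
lemma trans (h : CartesianExtension M S S') (h' : CartesianExtension M S' S'')
    (hM : M ⊆ S.obj _) : CartesianExtension M S S'' := by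
  obtain ⟨hle, h⟩ := h
  obtain ⟨hle', h'⟩ := h'
  refine ⟨hle.trans hle', fun X A p hp b u hu hc => ?_⟩
  obtain ⟨u', hu', hu'p⟩ := h p hp b u hu hc
  obtain ⟨u'', hu'', hu''p⟩ := h' p hp b u' hu'p (fun e he heM => by
    have := hc e (hM heM) heM
    rw [← hu'] at this
    exact this)
  refine ⟨u'', ?_, hu''p⟩
  rw [← hu', ← hu'']
  rfl

lemma attach_inner {n : ℕ} {k : Fin (n + 3)} (h0 : 0 < k) (hn : k < Fin.last (n + 2))
    (t : Δ[n + 2] ⟶ T) [Mono t] (ht : S.preimage t = Λ[n + 2, k]) :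
    CartesianExtension M S (S ⊔ Subcomplex.range t) := by
  refine ⟨le_sup_left, fun X A p hp b u hu _ => ?_⟩
  have := hp.mem _ (innerHornInclusions.intro k h0 hn)
  rw [← ht] at this
  have sq : CommSq (S.fromPreimage t ≫ u) (S.preimage t).ι p (t ≫ b) := ⟨by
    rw [Category.assoc, hu]; rfl⟩
  exact Subcomplex.exists_lift_sup_range p S t b u hu sq.lift sq.fac_right sq.fac_left

lemma attach_outer {n : ℕ} (t : Δ[n + 2] ⟶ T) [Mono t]
    (ht : S.preimage t = Λ[n + 2, Fin.last (n + 2)])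
    (hM : t.app _ (hornLastEdge n).1 ∈ M) :
    CartesianExtension M S (S ⊔ Subcomplex.range t) := by
  refine ⟨le_sup_left, fun X A p hp b u hu hc => ?_⟩
  have hmem : t.app _ (hornLastEdge n).1 ∈ S.obj _ := by
    have : (hornLastEdge n).1 ∈ (S.preimage t).obj _ := by
      rw [ht]; exact (hornLastEdge n).2
    exact this
  obtain ⟨l, hl, hl'⟩ := hc _ hmem hM n (Subcomplex.homOfLE ht.ge ≫ S.fromPreimage t ≫ u)
    (t ≫ b) (by rw [Category.assoc, Category.assoc, hu]; rfl) rfl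
  refine Subcomplex.exists_lift_sup_range p S t b u hu l hl' ?_
  have e : Subcomplex.homOfLE ht.le ≫ Λ[n + 2, Fin.last (n + 2)].ι ≫ l =
      Subcomplex.homOfLE ht.le ≫ Subcomplex.homOfLE ht.ge ≫ S.fromPreimage t ≫ u := by rw [hl]
  exact e

end CartesianExtension

end

/-- The subcomplex of `Δ[N]` consisting of the simplices whose set of vertices belongs
to a given lower set. -/
def faceComplex {N : ℕ} (P : LowerSet (Finset (Fin (N + 1)))) : (Δ[N] : SSet.{u}).Subcomplex where
  obj _ := Set.ofPred (fun s => Finset.univ.image (stdSimplex.asOrderHom s) ∈ P)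
  map φ s hs := P.lower (by
    intro x hx
    simp only [Finset.mem_image, Finset.mem_univ, true_and] at hx ⊢
    obtain ⟨i, rfl⟩ := hx
    exact ⟨φ.unop.toOrderHom i, rfl⟩) hs

lemma faceComplex_mono {N : ℕ} {P Q : LowerSet (Finset (Fin (N + 1)))} (h : P ≤ Q) :
    faceComplex.{u} P ≤ faceComplex Q :=
  fun _ _ hs => h hs

/-- The map `Δ[m] ⟶ Δ[n]` given by a monotone map on vertices. -/
def simplexMap {m n : ℕ} (f : Fin (m + 1) →o Fin (n + 1)) : (Δ[m] : SSet.{u}) ⟶ Δ[n] :=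
  SSet.stdSimplex.map (SimplexCategory.mkHom f)

@[simp]
lemma simplexMap_app_apply {m n d : ℕ} (f : Fin (m + 1) →o Fin (n + 1))
    (s : (Δ[m] : SSet.{u}) _⦋d⦌) (i : Fin (d + 1)) :
    dsimp% ((simplexMap f).app _ s : (Δ[n] : SSet.{u}) _⦋d⦌) i = f (s i) := rfl

lemma simplexMap_comp {l m n : ℕ} (f : Fin (l + 1) →o Fin (m + 1)) (g : Fin (m + 1) →o Fin (n + 1)) :
    simplexMap.{u} f ≫ simplexMap g = simplexMap (g.comp f) := rfl

lemma simplexMap_id (n : ℕ) : simplexMap.{u} (OrderHom.id : Fin (n + 1) →o _) = 𝟙 _ :=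
  SSet.stdSimplex.map_id _

/-- The inclusion `Δ[n] ⟶ Δ[N]` of the face with a given set of vertices. -/
noncomputable def faceInclusion {N n : ℕ} (F : Finset (Fin (N + 1))) (hF : F.card = n + 1) :
    (Δ[n] : SSet.{u}) ⟶ Δ[N] :=
  simplexMap (F.orderEmbOfFin hF).toOrderHom

instance {N n : ℕ} (F : Finset (Fin (N + 1))) (hF : F.card = n + 1) :
    Mono (faceInclusion.{u} F hF) := by
  rw [NatTrans.mono_iff_mono_app]
  rintro ⟨⟨d⟩⟩
  rw [mono_iff_injective]
  intro s s' h
  refine stdSimplex.ext (n := n) (d := d) _ _ (fun i => (F.orderEmbOfFin hF).injective ?_)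
  exact DFunLike.congr_fun (F := (Δ[N] : SSet.{u}) _⦋d⦌) h i

lemma mem_range_faceInclusion_iff {N n d : ℕ} (F : Finset (Fin (N + 1))) (hF : F.card = n + 1)
    (s : (Δ[N] : SSet.{u}) _⦋d⦌) :
    s ∈ (Subcomplex.range (faceInclusion.{u} F hF)).obj _ ↔ Finset.univ.image s ⊆ F := by
  constructor
  · rintro ⟨s, rfl⟩ x hx
    simp only [Finset.mem_image, Finset.mem_univ, true_and] at hx
    obtain ⟨i, rfl⟩ := hx
    exact F.orderEmbOfFin_mem hF _
  · intro h
    have h' (i) : ∃ j, F.orderEmbOfFin hF j = s i := by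
      have : s i ∈ Set.range (F.orderEmbOfFin hF) := by
        rw [Finset.range_orderEmbOfFin]
        exact h (by simp)
      exact this
    choose f hf using h'
    refine ⟨stdSimplex.objMk ⟨f, fun i j hij => ?_⟩, ?_⟩
    · rw [← (F.orderEmbOfFin hF).le_iff_le, hf, hf]
      exact stdSimplex.monotone_apply s hij
    · exact stdSimplex.ext (n := N) (d := d) _ _ (fun i => hf i)

/-- If the faces of `Δ[N]` in `Q` but not in `P` are matched with one another by adding and
removing the vertex `c`, and `c` is never the smallest vertex, and the largest vertex only
if the last edge is in `M`, then `faceComplex Q` is obtained from `faceComplex P`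
by filling inner horns and horns `Λ[n, n]` whose last edge is in `M`. -/
lemma CartesianExtension.pivot {N : ℕ} {M : Set ((Δ[N] : SSet.{u}) _⦋1⦌)} (c : Fin (N + 1))
    (P Q : LowerSet (Finset (Fin (N + 1)))) (hPQ : P ≤ Q)
    (hM : M ⊆ (faceComplex P).obj _)
    (hins : ∀ F ∈ Q, F ∉ P → insert c F ∈ Q) (hera : ∀ F ∈ Q, F ∉ P → F.erase c ∉ P)
    (hc : ∀ F ∈ Q, F ∉ P → c ∉ F → (∃ i ∈ F, i < c) ∧ ((∃ i ∈ F, c < i) ∨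
      (2 ≤ F.card ∧ ∃ (i : Fin (N + 1)) (h : i < c), i ∈ F ∧ (∀ j ∈ F, j ≤ i) ∧
        stdSimplex.edge N i c h.le ∈ M))) :
    CartesianExtension M (faceComplex P) (faceComplex Q) := by
  classical
  -- Induction on the number of faces still missing. A missing face `F` of least cardinality is
  -- attached together with `insert c F`.
  obtain ⟨n, hn⟩ : ∃ n, (Finset.univ.filter (fun F => F ∈ Q ∧ F ∉ P)).card = n := ⟨_, rfl⟩
  induction n using Nat.strong_induction_on generalizing P with
  | _ n ih =>
  by_cases hQP : Q ≤ P
  · obtain rfl := le_antisymm hPQ hQP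
    exact .refl
  have hex : ∃ F, F ∈ Finset.univ.filter (fun F => F ∈ Q ∧ F ∉ P) := by
    by_contra! h
    exact hQP (fun F hF => by_contra fun hF' => h F (by simpa using ⟨hF, hF'⟩))
  obtain ⟨F, hF, hmin⟩ := Finset.exists_min_image _ Finset.card hex
  simp only [Finset.mem_filter, Finset.mem_univ, true_and] at hF hmin
  obtain ⟨hFQ, hFP⟩ := hF
  -- If `c ∈ F`, then `F.erase c` would be a smaller missing face.
  have hcF : c ∉ F := fun hcF => by
    have h₁ := hmin (F.erase c) ⟨Q.lower (Finset.erase_subset _ _) hFQ, hera F hFQ hFP⟩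
    have h₂ := Finset.card_erase_lt_of_mem hcF
    omega
  have hF'Q := hins F hFQ hFP
  -- Were `(insert c F).erase j` missing, erasing `c` from it would give a missing face smaller than
  -- `F`. So the only missing faces of `insert c F` are itself and `F`.
  have hproper : ∀ j ∈ F, (insert c F).erase j ∈ P := by
    intro j hj
    by_contra hj'
    have h₁ : (insert c F).erase j ∈ Q := Q.lower (Finset.erase_subset _ _) hF'Q
    have h₂ := hmin _ ⟨Q.lower (Finset.erase_subset c _) h₁, hera _ h₁ hj'⟩
    have h₃ : ((insert c F).erase j).erase c ⊆ F.erase j := by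
      intro x hx
      simp only [Finset.mem_erase, Finset.mem_insert] at hx ⊢
      tauto
    have h₄ := Finset.card_le_card h₃
    have h₅ := Finset.card_erase_lt_of_mem hj
    omega
  obtain ⟨⟨i₀, hi₀F, hi₀⟩, hor⟩ := hc F hFQ hFP hcF
  have hcard2 : 2 ≤ F.card := by
    rcases hor with ⟨i₁, hi₁F, hi₁⟩ | ⟨h, _⟩
    · exact Finset.one_lt_card.2 ⟨i₀, hi₀F, i₁, hi₁F, (hi₀.trans hi₁).ne⟩
    · exact h
  obtain ⟨m, hm⟩ : ∃ m, F.card = m + 2 := ⟨F.card - 2, by omega⟩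
  have hF' : (insert c F).card = m + 2 + 1 := by rw [Finset.card_insert_of_notMem hcF, hm]
  let e := (insert c F).orderEmbOfFin hF'
  have he (x) : x ∈ insert c F ↔ ∃ i, e i = x := by
    have := Finset.range_orderEmbOfFin (insert c F) hF'
    rw [← Finset.mem_coe, ← this]
    rfl
  obtain ⟨k, hk⟩ := (he c).1 (Finset.mem_insert_self _ _)
  let t := faceInclusion.{u} (insert c F) hF'
  -- What is already present of the simplex on `insert c F` is the horn at the position `k` of `c`.
  have hpre : (faceComplex P).preimage t = Λ[m + 2, k] := by
    ext ⟨⟨d⟩⟩ s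
    change Finset.univ.image (fun i => e ((s : (Δ[m + 2] : SSet.{u}) _⦋d⦌) i)) ∈ P ↔ _
    refine Iff.trans ?_ (mem_horn_iff_notMem_range (d := d) s k).symm
    constructor
    · intro hs
      by_contra! hs'
      refine hFP (P.lower ?_ hs)
      intro x hx
      obtain ⟨j, rfl⟩ := (he x).1 (Finset.mem_insert_of_mem hx)
      obtain ⟨i, rfl⟩ := hs' j (by rintro rfl; exact hcF (hk ▸ hx))
      exact Finset.mem_image_of_mem _ (Finset.mem_univ i)
    · rintro ⟨j, hj, hjs⟩
      have hjF : e j ∈ F := by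
        have := (he (e j)).2 ⟨j, rfl⟩
        rw [Finset.mem_insert] at this
        refine this.resolve_left (fun h => hj (e.injective (h.trans hk.symm)))
      refine P.lower ?_ (hproper (e j) hjF)
      intro x hx
      simp only [Finset.mem_image, Finset.mem_univ, true_and] at hx
      obtain ⟨i, rfl⟩ := hx
      exact Finset.mem_erase.2 ⟨fun h => hjs ⟨i, e.injective h⟩, (he _).2 ⟨_, rfl⟩⟩
  have h0 : 0 < k := by
    obtain ⟨j, hj⟩ := (he i₀).1 (Finset.mem_insert_of_mem hi₀F)
    refine lt_of_le_of_lt (Fin.zero_le j) ?_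
    rw [← e.lt_iff_lt, hj, hk]
    exact hi₀
  have hstep : CartesianExtension M (faceComplex P) (faceComplex P ⊔ Subcomplex.range t) := by
    rcases hor with ⟨i₁, hi₁F, hi₁⟩ | ⟨_, i, hic, hiF, hi, hiM⟩
    · refine .attach_inner h0 ?_ t hpre
      obtain ⟨j, hj⟩ := (he i₁).1 (Finset.mem_insert_of_mem hi₁F)
      refine lt_of_lt_of_le ?_ (Fin.le_last j)
      rw [← e.lt_iff_lt, hj, hk]
      exact hi₁
    -- Here every vertex of `F` is at most `i < c`, so `c` comes last and `i` just before it: the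
    -- last edge of the horn is `i ⟶ c`, which is in `M`.
    · obtain rfl : k = Fin.last (m + 2) := by
        by_contra hk'
        have hlt := Fin.lt_last_iff_ne_last.2 hk'
        rw [← e.lt_iff_lt, hk] at hlt
        have hmem := (he _).2 ⟨Fin.last (m + 2), rfl⟩
        rw [Finset.mem_insert] at hmem
        have := hi _ (hmem.resolve_left hlt.ne')
        exact absurd (hlt.trans_le this) hic.not_gt
      obtain ⟨j, hj⟩ := (he i).1 (Finset.mem_insert_of_mem hiF)
      have hj' : j = (Fin.last (m + 1)).castSucc := by
        apply le_antisymm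
        · have : j < Fin.last (m + 2) := by rw [← e.lt_iff_lt, hj, hk]; exact hic
          rw [Fin.le_def]; rw [Fin.lt_def] at this
          simp at this ⊢; omega
        · rw [← e.le_iff_le, hj]
          refine hi _ ?_
          have hmem := (he _).2 ⟨(Fin.last (m + 1)).castSucc, rfl⟩
          rw [Finset.mem_insert] at hmem
          refine hmem.resolve_left (fun h => ?_)
          rw [← hk] at h
          have := e.injective h
          simp [Fin.ext_iff] at this
      refine .attach_outer t hpre ?_
      convert hiM using 1
      refine stdSimplex.ext (n := N) (d := 1) _ _ (fun l => ?_)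
      fin_cases l
      · change e _ = i
        rw [← hj, hj']; rfl
      · change e _ = c
        rw [← hk]; rfl
  let P₁ : LowerSet (Finset (Fin (N + 1))) := P ⊔ LowerSet.Iic (insert c F)
  have hP₁ : faceComplex P ⊔ Subcomplex.range t = faceComplex.{u} P₁ := by
    ext ⟨⟨d⟩⟩ s
    change s ∈ (faceComplex P).obj _ ∨ s ∈ (Subcomplex.range t).obj _ ↔ _
    rw [mem_range_faceInclusion_iff]
    rfl
  rw [hP₁] at hstep
  have hmem₁ (G) : G ∈ P₁ ↔ G ∈ P ∨ G ⊆ insert c F := Iff.rfl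
  refine hstep.trans (ih _ ?_ P₁ ?_ ?_ ?_ ?_ ?_ rfl) hM
  · rw [← hn]
    refine Finset.card_lt_card ⟨?_, fun h => ?_⟩
    · intro G hG
      simp only [Finset.mem_filter, Finset.mem_univ, true_and, hmem₁] at hG ⊢
      tauto
    · have := @h F (by simpa using ⟨hFQ, hFP⟩)
      simp [hmem₁] at this
  · exact sup_le hPQ (fun G hG => Q.lower hG hF'Q)
  · exact hM.trans (faceComplex_mono le_sup_left _)
  · exact fun G hG hGP => hins G hG (fun h => hGP (Or.inl h))
  · intro G hG hGP h
    rw [hmem₁] at hGP h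
    push Not at hGP
    rcases h with h | h
    · exact hera G hG hGP.1 h
    · exact hGP.2 (by rw [← Finset.erase_subset_iff_of_mem (Finset.mem_insert_self c F)]; exact h)
  · exact fun G hG hGP => hc G hG (fun h => hGP (Or.inl h))

end SSet

/-!
### Lifting problems for horns obtained from cones
-/

namespace SSet

section

variable (m : ℕ) {k l : ℕ}

/-- The inclusion `[k] ⟶ [m] ⋆ [k]`. -/
def coneSuffix (k : ℕ) : Fin (k + 1) →o Fin (m + 1 + k + 1) where
  toFun i := ⟨m + 1 + i.val, by omega⟩
  monotone' i j h := by rw [Fin.le_def] at h ⊢; dsimp; omega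

/-- The map `[m] ⋆ [k] ⟶ [k]` which sends `[m]` to the initial vertex. -/
def coneCollapse (k : ℕ) : Fin (m + 1 + k + 1) →o Fin (k + 1) where
  toFun i := ⟨i.val - (m + 1), by omega⟩
  monotone' i j h := by rw [Fin.le_def] at h ⊢; dsimp; omega

variable {m}

@[simp]
lemma coneSuffix_val (i : Fin (k + 1)) : (coneSuffix m k i).val = m + 1 + i.val := rfl

@[simp]
lemma coneCollapse_val (i : Fin (m + 1 + k + 1)) :
    (coneCollapse m k i).val = i.val - (m + 1) := rfl

variable (m) in
/-- The map `[m] ⋆ [k] ⟶ [m] ⋆ [l]` induced by a map `[k] ⟶ [l]`. -/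
def coneMap (f : Fin (k + 1) →o Fin (l + 1)) : Fin (m + 1 + k + 1) →o Fin (m + 1 + l + 1) where
  toFun i := if h : i.val ≤ m then ⟨i.val, by omega⟩
    else coneSuffix m l (f (coneCollapse m k i))
  monotone' i j h := by
    by_cases hj : j.val ≤ m
    · have hi : i.val ≤ m := (Fin.le_def.1 h).trans hj
      simp only [hi, hj, dite_true]
      exact h
    · by_cases hi : i.val ≤ m
      · simp only [hi, hj, dite_true, dite_false, Fin.le_def, coneSuffix_val]
        omega
      · simp only [hi, hj, dite_false]
        exact (coneSuffix m l).monotone (f.monotone ((coneCollapse m k).monotone h))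

lemma coneMap_of_le (f : Fin (k + 1) →o Fin (l + 1)) {i : Fin (m + 1 + k + 1)} (hi : i.val ≤ m) :
    (coneMap m f i).val = i.val :=
  congrArg Fin.val (dif_pos hi)

lemma coneMap_of_lt (f : Fin (k + 1) →o Fin (l + 1)) {i : Fin (m + 1 + k + 1)} (hi : m < i.val) :
    coneMap m f i = coneSuffix m l (f (coneCollapse m k i)) :=
  dif_neg hi.not_ge

lemma lt_coneSuffix (i : Fin (k + 1)) : m < (coneSuffix m k i).val := by
  rw [coneSuffix_val]; omega

@[simp]
lemma coneCollapse_coneSuffix (i : Fin (k + 1)) :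
    coneCollapse m k (coneSuffix m k i) = i := by
  ext; simp

lemma coneSuffix_coneCollapse {i : Fin (m + 1 + k + 1)} (hi : m < i.val) :
    coneSuffix m k (coneCollapse m k i) = i := by
  ext; simp; omega

lemma coneCollapse_of_le {i : Fin (m + 1 + k + 1)} (hi : i.val ≤ m) :
    coneCollapse m k i = 0 := by
  ext; simp; omega

/-- The faces of `[m] ⋆ [k]` contained in `[k]`. -/
def coneSuffixFaces (m k : ℕ) : LowerSet (Finset (Fin (m + 1 + k + 1))) where
  carrier := { F | ∀ i ∈ F, m < i.val }
  lower' _ _ h hF i hi := hF i (h hi)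

/-- The faces of `[m] ⋆ [k]` whose part in `[k]` is contained in `D` and which are sent to
the horn `Λ[m + 2, m + 2]` by the map `[m] ⋆ [k] ⟶ [m] ⋆ [1]` induced by `ρ`. -/
def coneHornFaces (m : ℕ) (ρ : Fin (k + 1) →o Fin 2) (D : Finset (Fin (k + 1))) :
    LowerSet (Finset (Fin (m + 1 + k + 1))) where
  carrier := { F | (∀ i ∈ F, m < i.val → coneCollapse m k i ∈ D) ∧
    ((∃ i : Fin (m + 1 + k + 1), i.val ≤ m ∧ i ∉ F) ∨
      ∀ i ∈ F, m < i.val → ρ (coneCollapse m k i) = 1) }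
  lower' _ _ h hF := ⟨fun i hi => hF.1 i (h hi),
    hF.2.imp (fun ⟨i, hi, hi'⟩ => ⟨i, hi, fun h' => hi' (h h')⟩) (fun h' i hi => h' i (h hi))⟩

/-- The two alternatives in `coneHornFaces` name the vertex that is missed in `[m] ⋆ [1]`: a vertex
of `[m]`, or `m + 1`, which is the vertex `0` of `[1]`. -/
lemma coneMap_mem_horn {ρ : Fin (k + 1) →o Fin 2} {D : Finset (Fin (k + 1))}
    {d : SimplexCategoryᵒᵖ} (s : (Δ[m + 1 + k] : SSet.{u}).obj d)
    (hs : s ∈ (faceComplex (coneHornFaces m ρ D)).obj d) :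
    (simplexMap.{u} (coneMap m ρ)).app _ s ∈ Λ[m + 2, Fin.last (m + 2)].obj d := by
  obtain ⟨⟨d⟩⟩ := d
  refine (mem_horn_iff_notMem_range (d := d) _ _).2 ?_
  obtain ⟨_, ⟨i, hi, hiF⟩ | h⟩ := hs
  · refine ⟨⟨i.val, by omega⟩, by simp [Fin.ext_iff]; omega, ?_⟩
    rintro ⟨x, hx⟩
    apply hiF
    have hx' : coneMap m ρ ((s : (Δ[m + 1 + k] : SSet.{u}) _⦋d⦌) x) = ⟨i.val, by omega⟩ := hx
    refine Finset.mem_image.2 ⟨x, Finset.mem_univ _, ?_⟩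
    change (s : (Δ[m + 1 + k] : SSet.{u}) _⦋d⦌) x = i
    by_cases hsx : ((s : (Δ[m + 1 + k] : SSet.{u}) _⦋d⦌) x).val ≤ m
    · ext
      rw [← coneMap_of_le ρ hsx, hx']
    · rw [coneMap_of_lt ρ (not_le.1 hsx)] at hx'
      have := congrArg Fin.val hx'
      have h2 := lt_coneSuffix (m := m) (ρ (coneCollapse m k ((s : (Δ[m + 1 + k] : SSet.{u}) _⦋d⦌) x)))
      dsimp only at this
      omega
  · refine ⟨⟨m + 1, by omega⟩, by simp [Fin.ext_iff], ?_⟩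
    rintro ⟨x, hx⟩
    have hx' : coneMap m ρ ((s : (Δ[m + 1 + k] : SSet.{u}) _⦋d⦌) x) = ⟨m + 1, by omega⟩ := hx
    by_cases hsx : ((s : (Δ[m + 1 + k] : SSet.{u}) _⦋d⦌) x).val ≤ m
    · have := coneMap_of_le ρ hsx
      rw [hx'] at this
      dsimp only at this
      omega
    · have h' : ρ (coneCollapse m k ((s : (Δ[m + 1 + k] : SSet.{u}) _⦋d⦌) x)) = 1 :=
        h _ (Finset.mem_image.2 ⟨x, Finset.mem_univ _, rfl⟩) (not_le.1 hsx)
      rw [coneMap_of_lt ρ (not_le.1 hsx), h'] at hx'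
      have := congrArg Fin.val hx'
      simp at this

variable {X A : SSet.{u}}

/-- Let `Θ : Δ[k] ⟶ X` be a simplex whose restriction to `D ⊆ [k]` factors through the edge `e`
by the map `ρ : [k] ⟶ [1]`. If lifts on the union of `[k]` and the horn pulled back by `ρ` extend
to a larger subcomplex of `[m] ⋆ [k]`, then lifting problems for the horn
`Λ[m + 2, m + 2]` with last edge `e` have a solution. -/
lemma exists_lift_of_cone {p : X ⟶ A} (hp : InnerFibration p) (Θ : Δ[k] ⟶ X) (e : Δ[1] ⟶ X)
    (ρ : Fin (k + 1) →o Fin 2) (D : Finset (Fin (k + 1)))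
    (hΘ : ∀ (d : ℕ) (s : (Δ[k] : SSet.{u}) _⦋d⦌), (∀ i, s i ∈ D) →
      Θ.app _ s = e.app _ ((simplexMap ρ).app _ s))
    (j : Fin 2 →o Fin (k + 1)) (hjD : ∀ i, j i ∈ D) (hρj : ∀ i, ρ (j i) = i)
    (M : Set ((Δ[k] : SSet.{u}) _⦋1⦌)) (hM : ∀ ε ∈ M, IsCartesianEdge p (Θ.app _ ε))
    (Q : LowerSet (Finset (Fin (m + 1 + k + 1))))
    (hQ : CartesianExtension.{u} ((simplexMap (coneSuffix m k)).app _ '' M)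
      (faceComplex (coneSuffixFaces m k ⊔ coneHornFaces m ρ D)) (faceComplex Q))
    (hQj : Finset.univ.image (coneMap m j) ∈ Q)
    (B : Δ[m + 1 + k] ⟶ A) (b : Δ[m + 2] ⟶ A)
    (hB₁ : simplexMap (coneSuffix m k) ≫ B = Θ ≫ p)
    (hB₂ : (faceComplex (coneHornFaces m ρ D)).ι ≫ B =
      (faceComplex (coneHornFaces m ρ D)).ι ≫ simplexMap (coneMap m ρ) ≫ b)
    (hBj : simplexMap (coneMap m j) ≫ B = b)
    (a : (Λ[m + 2, Fin.last (m + 2)] : SSet.{u}) ⟶ X) (ha : a ≫ p = Λ[m + 2, Fin.last (m + 2)].ι ≫ b)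
    (hae : a.app _ (hornLastEdge m) = yonedaEquiv e) :
    ∃ l : Δ[m + 2] ⟶ X, Λ[m + 2, Fin.last (m + 2)].ι ≫ l = a ∧ l ≫ p = b := by
  have hae' : yonedaEquiv.symm (hornLastEdge m) ≫ a = e := by
    apply yonedaEquiv.injective
    rw [← hae, yonedaEquiv_comp, Equiv.apply_symm_apply]
  -- The initial lift is `Θ` on `[k]` and the pullback of `a` along `[m] ⋆ ρ` on the horn part. On
  -- the overlap only vertices of `D` occur, where `Θ` factors through `e`.
  let u₁ : (faceComplex (coneSuffixFaces m k) : SSet.{u}) ⟶ X :=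
    Subcomplex.ι _ ≫ simplexMap (coneCollapse m k) ≫ Θ
  let u₂ : (faceComplex (coneHornFaces m ρ D) : SSet.{u}) ⟶ X :=
    Subcomplex.lift (Subcomplex.ι _ ≫ simplexMap (coneMap m ρ)) (by
      rintro d _ ⟨⟨x, hx⟩, rfl⟩
      exact coneMap_mem_horn x hx) ≫ a
  obtain ⟨u, hu₁, hu₂⟩ := Subcomplex.exists_desc_sup _ _ u₁ u₂ (by
    rintro ⟨⟨d⟩⟩ x h₁ h₂
    have hx (i) : m < ((x : (Δ[m + 1 + k] : SSet.{u}) _⦋d⦌) i).val :=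
      h₁ _ (Finset.mem_image.2 ⟨i, Finset.mem_univ _, rfl⟩)
    refine (hΘ d _ (fun i => h₂.1 _ (Finset.mem_image.2 ⟨i, Finset.mem_univ _, rfl⟩) (hx i))).trans ?_
    rw [← hae']
    refine congrArg (a.app _) (Subtype.ext ?_)
    refine stdSimplex.ext (n := m + 2) (d := d) _ _ (fun i => ?_)
    change _ = coneMap m ρ ((x : (Δ[m + 1 + k] : SSet.{u}) _⦋d⦌) i)
    rw [coneMap_of_lt _ (hx i)]
    have key (y : Fin 2) : (![(Fin.last (m + 1)).castSucc, Fin.last (m + 2)] : Fin 2 → Fin (m + 3)) y =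
        coneSuffix m 1 y := by
      fin_cases y <;> rfl
    exact key (ρ (coneCollapse m k ((x : (Δ[m + 1 + k] : SSet.{u}) _⦋d⦌) i))))
  have hsup : faceComplex (coneSuffixFaces m k) ⊔ faceComplex (coneHornFaces m ρ D) =
      faceComplex.{u} (coneSuffixFaces m k ⊔ coneHornFaces m ρ D) := rfl
  have hup : u ≫ p = Subcomplex.ι _ ≫ B := by
    apply Subcomplex.hom_ext_sup
    · rw [reassoc_of% hu₁]
      change _ = Subcomplex.ι _ ≫ B
      dsimp only [u₁]
      rw [Category.assoc, Category.assoc, ← hB₁]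
      ext ⟨⟨d⟩⟩ ⟨x, hx⟩
      refine congrArg (B.app _) ?_
      refine stdSimplex.ext (n := m + 1 + k) (d := d) _ _ (fun i => ?_)
      exact coneSuffix_coneCollapse (hx _ (Finset.mem_image.2 ⟨i, Finset.mem_univ _, rfl⟩))
    · rw [reassoc_of% hu₂]
      change _ = Subcomplex.ι _ ≫ B
      dsimp only [u₂]
      rw [Category.assoc, ha, hB₂]
      rfl
  obtain ⟨hle, hQ⟩ := hQ
  -- The distinguished edges lie in `[k]`, where the lift is `Θ`; hence their images are Cartesian
  -- by `hM`.
  obtain ⟨u', hu', hu'p⟩ := hQ p hp B u hup (by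
    rintro _ he ⟨ε, hε, rfl⟩
    have h₁ : (simplexMap.{u} (coneSuffix m k)).app _ ε ∈ (faceComplex (coneSuffixFaces m k)).obj _ := by
      intro i hi
      obtain ⟨x, _, rfl⟩ := Finset.mem_image.1 hi
      exact lt_coneSuffix _
    have e₁ := ConcreteCategory.congr_hom (congr_app hu₁ _) ⟨_, h₁⟩
    have e₂ : (simplexMap.{u} (coneCollapse m k)).app _ ((simplexMap.{u} (coneSuffix m k)).app _ ε) = ε :=
      stdSimplex.ext (n := k) (d := 1) _ _ (fun i => coneCollapse_coneSuffix _)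
    have e₃ : u.app _ ⟨_, he⟩ = Θ.app _ ε := by
      refine Eq.trans e₁ ?_
      change Θ.app _ ((simplexMap.{u} (coneCollapse m k)).app _ ((simplexMap.{u} (coneSuffix m k)).app _ ε)) = _
      rw [e₂]
    exact e₃ ▸ hM ε hε)
  have hrange : Subcomplex.range (simplexMap.{u} (coneMap m j)) ≤ faceComplex Q := by
    rintro ⟨⟨d⟩⟩ _ ⟨x, rfl⟩
    refine Q.lower ?_ hQj
    intro y hy
    obtain ⟨i, _, rfl⟩ := Finset.mem_image.1 hy
    exact Finset.mem_image.2 ⟨_, Finset.mem_univ _, rfl⟩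
  -- The filler is the restriction of `u'` along `[m] ⋆ j`. Since `ρ` is a retraction of `j`, it
  -- agrees with `a` on the horn.
  refine ⟨Subcomplex.lift _ hrange ≫ u', ?_, ?_⟩
  · ext ⟨⟨d⟩⟩ ⟨x, hx⟩
    -- A missed vertex `v ≤ m` gives the first alternative of `coneHornFaces`. Otherwise `v = m +
    -- 1`, and everything beyond `[m]` goes to the last vertex.
    have hx₂ : (simplexMap.{u} (coneMap m j)).app _ x ∈ (faceComplex (coneHornFaces m ρ D)).obj _ := by
      obtain ⟨v, hv, hvx⟩ := (mem_horn_iff_notMem_range (d := d) _ _).1 hx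
      refine ⟨?_, ?_⟩
      · rintro i hi hmi
        obtain ⟨y, _, rfl⟩ := Finset.mem_image.1 hi
        change m < (coneMap m j ((x : (Δ[m + 2] : SSet.{u}) _⦋d⦌) y)).val at hmi
        change coneCollapse m k (coneMap m j ((x : (Δ[m + 2] : SSet.{u}) _⦋d⦌) y)) ∈ D
        by_cases hxy : ((x : (Δ[m + 2] : SSet.{u}) _⦋d⦌) y).val ≤ m
        · rw [coneMap_of_le (l := k) j hxy] at hmi
          omega
        · rw [coneMap_of_lt (l := k) j (not_le.1 hxy), coneCollapse_coneSuffix]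
          exact hjD _
      · by_cases hvm : v.val ≤ m
        · refine Or.inl ⟨⟨v.val, by omega⟩, hvm, fun hi => hvx ?_⟩
          obtain ⟨y, _, hy⟩ := Finset.mem_image.1 hi
          change coneMap m j ((x : (Δ[m + 2] : SSet.{u}) _⦋d⦌) y) = _ at hy
          refine ⟨y, ?_⟩
          by_cases hxy : ((x : (Δ[m + 2] : SSet.{u}) _⦋d⦌) y).val ≤ m
          · ext
            have := congrArg Fin.val hy
            rwa [coneMap_of_le (l := k) j hxy] at this
          · rw [coneMap_of_lt (l := k) j (not_le.1 hxy)] at hy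
            have h2 := lt_coneSuffix (m := m) (j (coneCollapse m 1 ((x : (Δ[m + 2] : SSet.{u}) _⦋d⦌) y)))
            rw [hy] at h2
            dsimp only at h2
            omega
        · refine Or.inr fun i hi hmi => ?_
          obtain ⟨y, _, rfl⟩ := Finset.mem_image.1 hi
          change m < (coneMap m j ((x : (Δ[m + 2] : SSet.{u}) _⦋d⦌) y)).val at hmi
          change ρ (coneCollapse m k (coneMap m j ((x : (Δ[m + 2] : SSet.{u}) _⦋d⦌) y))) = 1
          by_cases hxy : ((x : (Δ[m + 2] : SSet.{u}) _⦋d⦌) y).val ≤ m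
          · rw [coneMap_of_le (l := k) j hxy] at hmi
            omega
          · rw [coneMap_of_lt (l := k) j (not_le.1 hxy), coneCollapse_coneSuffix, hρj]
            have hv' : v.val = m + 1 := by
              have h1 : v.val ≠ m + 2 := fun h => hv (Fin.ext h)
              omega
            have h3 : ((x : (Δ[m + 2] : SSet.{u}) _⦋d⦌) y).val ≠ m + 1 :=
              fun h => hvx ⟨y, Fin.ext (h.trans hv'.symm)⟩
            have h4 := coneCollapse_val (m := m) (k := 1) ((x : (Δ[m + 2] : SSet.{u}) _⦋d⦌) y)
            have h5 := ((x : (Δ[m + 2] : SSet.{u}) _⦋d⦌) y).isLt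
            refine Fin.ext (h4.trans ?_)
            rw [Fin.val_one]
            omega
    have e₁ := ConcreteCategory.congr_hom (congr_app hu' _) ⟨_, Or.inr hx₂⟩
    have e₂ := ConcreteCategory.congr_hom (congr_app hu₂ _) ⟨_, hx₂⟩
    refine (e₁.trans e₂).trans (congrArg (a.app _) (Subtype.ext ?_))
    refine stdSimplex.ext (n := m + 2) (d := d) _ _ (fun i => ?_)
    change coneMap m ρ (coneMap m j ((x : (Δ[m + 2] : SSet.{u}) _⦋d⦌) i)) =
      (x : (Δ[m + 2] : SSet.{u}) _⦋d⦌) i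
    by_cases hxi : ((x : (Δ[m + 2] : SSet.{u}) _⦋d⦌) i).val ≤ m
    · have h1 := coneMap_of_le (l := k) j hxi
      ext
      rw [coneMap_of_le (l := 1) ρ (h1.trans_le hxi), h1]
    · rw [coneMap_of_lt (l := k) j (not_le.1 hxi), coneMap_of_lt (l := 1) ρ (lt_coneSuffix _),
        coneCollapse_coneSuffix, hρj]
      exact coneSuffix_coneCollapse (k := 1) (not_le.1 hxi)
  · rw [Category.assoc, hu'p, Subcomplex.lift_ι_assoc, hBj]

end

end SSet

/-! ### Filling sequences in `[m] ⋆ [2]` and `[m] ⋆ [3]`. -/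

namespace SSet

section

variable {m k : ℕ}

/-- The faces of `[m] ⋆ [k]` which do not contain `[m]` or contain no element of `C ⊆ [k]`. -/
def coneFaces (m : ℕ) (C : Finset (Fin (k + 1))) : LowerSet (Finset (Fin (m + 1 + k + 1))) where
  carrier := { F | (∃ i : Fin (m + 1 + k + 1), i.val ≤ m ∧ i ∉ F) ∨ ∀ c ∈ C, coneSuffix m k c ∉ F }
  lower' _ _ h hF := hF.imp (fun ⟨i, hi, hi'⟩ => ⟨i, hi, fun h' => hi' (h h')⟩)
    (fun h' c hc hcF => h' c hc (h hcF))

lemma mem_coneFaces_iff (C : Finset (Fin (k + 1))) (F : Finset (Fin (m + 1 + k + 1))) :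
    F ∈ coneFaces m C ↔ (∃ i : Fin (m + 1 + k + 1), i.val ≤ m ∧ i ∉ F) ∨
      ∀ c ∈ C, coneSuffix m k c ∉ F := Iff.rfl

lemma mem_coneSuffixFaces_iff (F : Finset (Fin (m + 1 + k + 1))) :
    F ∈ coneSuffixFaces m k ↔ ∀ i ∈ F, m < i.val := Iff.rfl

/-- In terms of absent vertices of `[k]`, membership becomes, for a given `k`, a Boolean combination
of finitely many propositions. The pivot hypotheses can then be checked by cases. -/
lemma mem_coneHornFaces_iff (ρ : Fin (k + 1) →o Fin 2) (D : Finset (Fin (k + 1)))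
    (F : Finset (Fin (m + 1 + k + 1))) :
    F ∈ coneHornFaces m ρ D ↔ (∀ c, c ∉ D → coneSuffix m k c ∉ F) ∧
      ((∃ i : Fin (m + 1 + k + 1), i.val ≤ m ∧ i ∉ F) ∨
        ∀ c, ρ c = 0 → coneSuffix m k c ∉ F) := by
  refine and_congr ⟨fun h c hc hcF => hc ?_, fun h i hi hmi => ?_⟩
    (or_congr Iff.rfl ⟨fun h c hc hcF => ?_, fun h i hi hmi => ?_⟩)
  · simpa using h _ hcF (lt_coneSuffix c)
  · by_contra hi'
    exact h _ hi' (by rwa [coneSuffix_coneCollapse hmi])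
  · have := h _ hcF (lt_coneSuffix c)
    rw [coneCollapse_coneSuffix, hc] at this
    exact absurd this (by decide)
  · by_contra hi'
    refine h (coneCollapse m k i) ?_ (by rwa [coneSuffix_coneCollapse hmi])
    generalize ρ (coneCollapse m k i) = y at hi'
    fin_cases y
    · rfl
    · exact absurd rfl hi'

lemma coneSuffix_injective : Function.Injective (coneSuffix m k) := fun i j h => by
  rw [← coneCollapse_coneSuffix (m := m) i, h, coneCollapse_coneSuffix]

lemma coneSuffix_mem_insert_iff (c a : Fin (k + 1)) (F : Finset (Fin (m + 1 + k + 1))) :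
    coneSuffix m k a ∈ insert (coneSuffix m k c) F ↔ a = c ∨ coneSuffix m k a ∈ F := by
  rw [Finset.mem_insert, coneSuffix_injective.eq_iff]

lemma coneSuffix_mem_erase_iff (c a : Fin (k + 1)) (F : Finset (Fin (m + 1 + k + 1))) :
    coneSuffix m k a ∈ F.erase (coneSuffix m k c) ↔ a ≠ c ∧ coneSuffix m k a ∈ F := by
  rw [Finset.mem_erase, ne_eq, coneSuffix_injective.eq_iff]

lemma exists_notMem_insert_coneSuffix_iff (c : Fin (k + 1)) (F : Finset (Fin (m + 1 + k + 1))) :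
    (∃ i : Fin (m + 1 + k + 1), i.val ≤ m ∧ i ∉ insert (coneSuffix m k c) F) ↔
      ∃ i : Fin (m + 1 + k + 1), i.val ≤ m ∧ i ∉ F := by
  refine exists_congr fun i => and_congr_right fun hi => not_congr ?_
  rw [Finset.mem_insert]
  exact or_iff_right (fun h => by have := lt_coneSuffix (m := m) c; rw [← h] at this; omega)

lemma exists_notMem_erase_coneSuffix_iff (c : Fin (k + 1)) (F : Finset (Fin (m + 1 + k + 1))) :
    (∃ i : Fin (m + 1 + k + 1), i.val ≤ m ∧ i ∉ F.erase (coneSuffix m k c)) ↔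
      ∃ i : Fin (m + 1 + k + 1), i.val ≤ m ∧ i ∉ F := by
  refine exists_congr fun i => and_congr_right fun hi => not_congr ?_
  rw [Finset.mem_erase]
  exact and_iff_right (fun h => by have := lt_coneSuffix (m := m) c; rw [← h] at this; omega)

lemma forall_mem_erase_coneSuffix_iff (c : Fin (k + 1)) (F : Finset (Fin (m + 1 + k + 1))) :
    (∀ i ∈ F.erase (coneSuffix m k c), m < i.val) ↔ ∀ i ∈ F, m < i.val := by
  refine ⟨fun h i hi => ?_, fun h i hi => h i (Finset.mem_of_mem_erase hi)⟩
  by_cases hic : i = coneSuffix m k c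
  · exact hic ▸ lt_coneSuffix c
  · exact h i (Finset.mem_erase.2 ⟨hic, hi⟩)

/-- This is the one dependence between the propositions describing a face, and the case checks below
need it. -/
lemma exists_notMem_of_forall_lt {F : Finset (Fin (m + 1 + k + 1))} (hF : ∀ i ∈ F, m < i.val) :
    ∃ i : Fin (m + 1 + k + 1), i.val ≤ m ∧ i ∉ F :=
  ⟨0, Nat.zero_le _, fun h => absurd (hF 0 h) (by simp)⟩

/-- The pivot lemma for a pivot in the second part of `[m] ⋆ [k]`. -/
lemma CartesianExtension.pivot_cone {M : Set ((Δ[k] : SSet.{u}) _⦋1⦌)} (c : Fin (k + 1))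
    (P Q : LowerSet (Finset (Fin (m + 1 + k + 1)))) (hPQ : P ≤ Q) (hP : coneSuffixFaces m k ≤ P)
    (hins : ∀ F ∈ Q, F ∉ P → insert (coneSuffix m k c) F ∈ Q)
    (hera : ∀ F ∈ Q, F ∉ P → F.erase (coneSuffix m k c) ∉ P)
    (hc : ∀ F ∈ Q, F ∉ P → coneSuffix m k c ∉ F → (∃ a, c < a ∧ coneSuffix m k a ∈ F) ∨
      ∃ (a : Fin (k + 1)) (h : a < c), coneSuffix m k a ∈ F ∧ (∀ b, coneSuffix m k b ∈ F → b ≤ a) ∧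
        stdSimplex.edge k a c h.le ∈ M) :
    CartesianExtension.{u} ((simplexMap (coneSuffix m k)).app _ '' M)
      (faceComplex P) (faceComplex Q) := by
  refine .pivot (coneSuffix m k c) P Q hPQ ?_ hins hera (fun F hFQ hFP hcF => ?_)
  -- A face outside `P` is not contained in `[k]`, so it has a vertex in `[m]`, below the pivot; no
  -- pivot is ever the smallest vertex.
  · rintro _ ⟨ε, _, rfl⟩
    refine hP ?_
    intro i hi
    obtain ⟨x, _, rfl⟩ := Finset.mem_image.1 hi
    exact lt_coneSuffix _
  · obtain ⟨i, hiF, hi⟩ : ∃ i ∈ F, i.val ≤ m := by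
      by_contra! h
      exact hFP (hP h)
    refine ⟨⟨i, hiF, Fin.lt_def.2 (lt_of_le_of_lt hi (lt_coneSuffix c))⟩, ?_⟩
    obtain ⟨a, hca, haF⟩ | ⟨a, hac, haF, ha, haM⟩ := hc F hFQ hFP hcF
    · refine Or.inl ⟨_, haF, ?_⟩
      rw [Fin.lt_def] at hca ⊢
      simpa using hca
    · refine Or.inr ⟨?_, coneSuffix m k a, ?_, haF, ?_, ⟨_, haM, ?_⟩⟩
      · refine Finset.one_lt_card.2 ⟨i, hiF, _, haF, ?_⟩
        rintro rfl
        have := lt_coneSuffix (m := m) a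
        omega
      · rw [Fin.lt_def] at hac ⊢
        simpa using hac
      · intro j hj
        by_cases hjm : j.val ≤ m
        · exact hjm.trans (lt_coneSuffix a).le
        · rw [← coneSuffix_coneCollapse (not_le.1 hjm)] at hj ⊢
          exact (coneSuffix m k).monotone (ha _ hj)
      · refine stdSimplex.ext (n := m + 1 + k) (d := 1) _ _ (fun l => ?_)
        fin_cases l <;> rfl

/-- The map `[3] ⟶ [1]` which sends `0`, `1`, `2` to `0`. -/
def threeToOne : Fin 4 →o Fin 2 := ⟨![0, 0, 0, 1], by decide⟩

/-- The map `[2] ⟶ [1]` which sends `0`, `1` to `0`. -/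
def twoToOne : Fin 3 →o Fin 2 := ⟨![0, 0, 1], by decide⟩

/-- The map `[2] ⟶ [1]` which sends `1`, `2` to `1`. -/
def twoToOne' : Fin 3 →o Fin 2 := ⟨![0, 1, 1], by decide⟩

-- Three rounds of pivoting. At `0`: the new faces contain `1`, so the horns are inner. At `3`: the
-- new faces contain `[m]` and `1` but not `0`, `2`; the horn is outer with last edge `1 ⟶ 3`. At
-- `1`: the new faces contain `2`, so the horns are inner. Faces containing both `[m]` and `0` are
-- never needed, as the goal is the face `[m] ⋆ {2, 3}`.
set_option linter.unusedSimpArgs false in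
lemma cartesianExtension_threeToOne (m : ℕ) :
    CartesianExtension.{u} ((simplexMap (coneSuffix m 3)).app _ '' {stdSimplex.edge 3 1 3 (by decide)})
      (faceComplex (coneSuffixFaces m 3 ⊔ coneHornFaces m threeToOne {0, 2, 3}))
      (faceComplex (coneFaces (k := 3) m {0})) := by
  have h₀ : ∀ F : Finset (Fin (m + 1 + 3 + 1)),
      F ∈ coneSuffixFaces m 3 ⊔ coneHornFaces m threeToOne {0, 2, 3} ↔ (∀ i ∈ F, m < i.val) ∨
      (coneSuffix m 3 1 ∉ F ∧ ((∃ i : Fin (m + 1 + 3 + 1), i.val ≤ m ∧ i ∉ F) ∨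
        (coneSuffix m 3 0 ∉ F ∧ coneSuffix m 3 1 ∉ F ∧ coneSuffix m 3 2 ∉ F))) := by
    intro F
    rw [LowerSet.mem_sup_iff, mem_coneHornFaces_iff]
    refine or_congr Iff.rfl ?_
    simp [Fin.forall_fin_succ, threeToOne]
  have hA (F : Finset (Fin (m + 1 + 3 + 1))) := mem_coneFaces_iff (k := 3) {0, 1, 2} F
  have hB (F : Finset (Fin (m + 1 + 3 + 1))) := mem_coneFaces_iff (k := 3) {0, 2} F
  have hC (F : Finset (Fin (m + 1 + 3 + 1))) := mem_coneFaces_iff (k := 3) {0} F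
  have hE (F : Finset (Fin (m + 1 + 3 + 1))) := @exists_notMem_of_forall_lt m 3 F
  simp only [Finset.mem_insert, Finset.mem_singleton, forall_eq_or_imp, forall_eq] at hA hB hC
  have hM : (simplexMap.{u} (coneSuffix m 3)).app _ '' {stdSimplex.edge 3 1 3 (by decide)} ⊆
      (faceComplex (coneSuffixFaces m 3 ⊔ coneHornFaces m threeToOne {0, 2, 3})).obj _ := by
    rintro _ ⟨ε, _, rfl⟩
    refine Or.inl fun i hi => ?_
    obtain ⟨x, _, rfl⟩ := Finset.mem_image.1 hi
    exact lt_coneSuffix _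
  refine CartesianExtension.trans (.trans
      (.pivot_cone 0 _ (coneFaces (k := 3) m {0, 1, 2}) ?_ ?_ ?_ ?_ ?_)
      (.pivot_cone 3 _ (coneFaces (k := 3) m {0, 2}) ?_ ?_ ?_ ?_ ?_) hM)
    (.pivot_cone 1 _ _ ?_ ?_ ?_ ?_ ?_) hM
  all_goals
    intro F
    simp only [SetLike.mem_coe, h₀, hA, hB, hC, mem_coneSuffixFaces_iff (m := m) (k := 3),
      coneSuffix_mem_insert_iff (m := m) (k := 3), coneSuffix_mem_erase_iff (m := m) (k := 3),
      exists_notMem_insert_coneSuffix_iff (m := m) (k := 3),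
      exists_notMem_erase_coneSuffix_iff (m := m) (k := 3),
      forall_mem_erase_coneSuffix_iff (m := m) (k := 3), LowerSet.mem_top]
    have := hE F
    -- Membership of the vertices of `[3]`, and the abstract propositions `S` and `E` linked by `S →
    -- E`, are all that is left: each goal is a finite propositional check.
    revert this
    generalize (∀ i ∈ F, m < i.val) = S
    generalize (∃ i : Fin (m + 1 + 3 + 1), i.val ≤ m ∧ i ∉ F) = E
    simp [Fin.exists_fin_succ, Fin.forall_fin_succ, -not_or, -not_and]
    try grind

-- Three rounds. At `2`: the new faces contain `1`, and an outer horn has last edge `1 ⟶ 2`. At `1`,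
-- without the vertex `2`: outer with last edge `0 ⟶ 1`. At `1`, for faces containing `[m]`, `0` and
-- `2`: inner.
set_option linter.unusedSimpArgs false in
lemma cartesianExtension_twoToOne (m : ℕ) :
    CartesianExtension.{u} ((simplexMap (coneSuffix m 2)).app _ '' {stdSimplex.edge 2 0 1 (by decide), stdSimplex.edge 2 1 2 (by decide)})
      (faceComplex (coneSuffixFaces m 2 ⊔ coneHornFaces m twoToOne {0, 2}))
      (faceComplex (⊤)) := by
  have h₀ : ∀ F : Finset (Fin (m + 1 + 2 + 1)),
      F ∈ coneSuffixFaces m 2 ⊔ coneHornFaces m twoToOne {0, 2} ↔ (∀ i ∈ F, m < i.val) ∨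
      (coneSuffix m 2 1 ∉ F ∧ ((∃ i : Fin (m + 1 + 2 + 1), i.val ≤ m ∧ i ∉ F) ∨
        (coneSuffix m 2 0 ∉ F ∧ coneSuffix m 2 1 ∉ F))) := by
    intro F
    rw [LowerSet.mem_sup_iff, mem_coneHornFaces_iff]
    refine or_congr Iff.rfl ?_
    simp [Fin.forall_fin_succ, twoToOne]
  have hA (F : Finset (Fin (m + 1 + 2 + 1))) := mem_coneFaces_iff (k := 2) {0} F
  have hB (F : Finset (Fin (m + 1 + 2 + 1))) := mem_coneFaces_iff (k := 2) {2} F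
  have hE (F : Finset (Fin (m + 1 + 2 + 1))) := @exists_notMem_of_forall_lt m 2 F
  simp only [Finset.mem_insert, Finset.mem_singleton, forall_eq_or_imp, forall_eq] at hA hB
  have hM : (simplexMap.{u} (coneSuffix m 2)).app _ '' {stdSimplex.edge 2 0 1 (by decide), stdSimplex.edge 2 1 2 (by decide)} ⊆
      (faceComplex (coneSuffixFaces m 2 ⊔ coneHornFaces m twoToOne {0, 2})).obj _ := by
    rintro _ ⟨ε, _, rfl⟩
    refine Or.inl fun i hi => ?_
    obtain ⟨x, _, rfl⟩ := Finset.mem_image.1 hi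
    exact lt_coneSuffix _
  refine CartesianExtension.trans (.trans
      (.pivot_cone 2 _ (coneFaces (k := 2) m {0}) ?_ ?_ ?_ ?_ ?_)
      (.pivot_cone 1 _ (coneFaces (k := 2) m {0} ⊔ coneFaces (k := 2) m {2}) ?_ ?_ ?_ ?_ ?_) hM)
    (.pivot_cone 1 _ _ ?_ ?_ ?_ ?_ ?_) hM
  all_goals
    intro F
    simp only [SetLike.mem_coe, h₀, hA, hB, mem_coneSuffixFaces_iff (m := m) (k := 2),
      coneSuffix_mem_insert_iff (m := m) (k := 2), coneSuffix_mem_erase_iff (m := m) (k := 2),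
      exists_notMem_insert_coneSuffix_iff (m := m) (k := 2),
      exists_notMem_erase_coneSuffix_iff (m := m) (k := 2),
      forall_mem_erase_coneSuffix_iff (m := m) (k := 2), LowerSet.mem_top, LowerSet.mem_sup_iff]
    have := hE F
    revert this
    generalize (∀ i ∈ F, m < i.val) = S
    generalize (∃ i : Fin (m + 1 + 2 + 1), i.val ≤ m ∧ i ∉ F) = E
    simp [Fin.exists_fin_succ, Fin.forall_fin_succ, -not_or, -not_and]
    try grind

-- Three rounds. At `1`: the new faces contain `2`, so the horns are inner. At `2`, without the
-- vertex `1`: outer with last edge `0 ⟶ 2`. At `2`, for faces containing `[m]`, `0` and `1`: outer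
-- with last edge `1 ⟶ 2`.
set_option linter.unusedSimpArgs false in
lemma cartesianExtension_twoToOne' (m : ℕ) :
    CartesianExtension.{u} ((simplexMap (coneSuffix m 2)).app _ '' {stdSimplex.edge 2 0 2 (by decide), stdSimplex.edge 2 1 2 (by decide)})
      (faceComplex (coneSuffixFaces m 2 ⊔ coneHornFaces m twoToOne' {0, 1}))
      (faceComplex (⊤)) := by
  have h₀ : ∀ F : Finset (Fin (m + 1 + 2 + 1)),
      F ∈ coneSuffixFaces m 2 ⊔ coneHornFaces m twoToOne' {0, 1} ↔ (∀ i ∈ F, m < i.val) ∨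
      (coneSuffix m 2 2 ∉ F ∧ ((∃ i : Fin (m + 1 + 2 + 1), i.val ≤ m ∧ i ∉ F) ∨
        (coneSuffix m 2 0 ∉ F))) := by
    intro F
    rw [LowerSet.mem_sup_iff, mem_coneHornFaces_iff]
    refine or_congr Iff.rfl ?_
    simp [Fin.forall_fin_succ, twoToOne']
  have hA (F : Finset (Fin (m + 1 + 2 + 1))) := mem_coneFaces_iff (k := 2) {0} F
  have hB (F : Finset (Fin (m + 1 + 2 + 1))) := mem_coneFaces_iff (k := 2) {1} F
  have hE (F : Finset (Fin (m + 1 + 2 + 1))) := @exists_notMem_of_forall_lt m 2 F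
  simp only [Finset.mem_insert, Finset.mem_singleton, forall_eq_or_imp, forall_eq] at hA hB
  have hM : (simplexMap.{u} (coneSuffix m 2)).app _ '' {stdSimplex.edge 2 0 2 (by decide), stdSimplex.edge 2 1 2 (by decide)} ⊆
      (faceComplex (coneSuffixFaces m 2 ⊔ coneHornFaces m twoToOne' {0, 1})).obj _ := by
    rintro _ ⟨ε, _, rfl⟩
    refine Or.inl fun i hi => ?_
    obtain ⟨x, _, rfl⟩ := Finset.mem_image.1 hi
    exact lt_coneSuffix _
  refine CartesianExtension.trans (.trans
      (.pivot_cone 1 _ (coneFaces (k := 2) m {0}) ?_ ?_ ?_ ?_ ?_)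
      (.pivot_cone 2 _ (coneFaces (k := 2) m {0} ⊔ coneFaces (k := 2) m {1}) ?_ ?_ ?_ ?_ ?_) hM)
    (.pivot_cone 2 _ _ ?_ ?_ ?_ ?_ ?_) hM
  all_goals
    intro F
    simp only [SetLike.mem_coe, h₀, hA, hB, mem_coneSuffixFaces_iff (m := m) (k := 2),
      coneSuffix_mem_insert_iff (m := m) (k := 2), coneSuffix_mem_erase_iff (m := m) (k := 2),
      exists_notMem_insert_coneSuffix_iff (m := m) (k := 2),
      exists_notMem_erase_coneSuffix_iff (m := m) (k := 2),
      forall_mem_erase_coneSuffix_iff (m := m) (k := 2), LowerSet.mem_top, LowerSet.mem_sup_iff]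
    have := hE F
    revert this
    generalize (∀ i ∈ F, m < i.val) = S
    generalize (∃ i : Fin (m + 1 + 2 + 1), i.val ≤ m ∧ i ∉ F) = E
    simp [Fin.exists_fin_succ, Fin.forall_fin_succ, -not_or, -not_and]
    try grind

end

end SSet

/-!
### Cartesian edges of a Cartesian fibration
-/

namespace SSet

section

variable {X A : SSet.{u}} {p : X ⟶ A} {m k : ℕ}

/-- The lifting problems for `Λ[m + 2, m + 2]` with last edge `e` over the simplex `b` have
a solution. -/
def HasOuterLift (p : X ⟶ A) (e : X _⦋1⦌) (b : Δ[m + 2] ⟶ A) : Prop :=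
  ∀ a : (Λ[m + 2, Fin.last (m + 2)] : SSet.{u}) ⟶ X, a ≫ p = Λ[m + 2, Fin.last (m + 2)].ι ≫ b →
    a.app _ (hornLastEdge m) = e →
    ∃ l : Δ[m + 2] ⟶ X, Λ[m + 2, Fin.last (m + 2)].ι ≫ l = a ∧ l ≫ p = b

lemma isCartesianEdge_iff_hasOuterLift {e : X _⦋1⦌} :
    IsCartesianEdge p e ↔ ∀ (m : ℕ) (b : Δ[m + 2] ⟶ A), HasOuterLift p e b :=
  ⟨fun h m b a ha hae => h m a b ha hae, fun h m a b ha hae => h m b a ha hae⟩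

/-- An edge `e` is locally Cartesian if it satisfies the lifting property of a Cartesian edge
over the degenerate simplices of the base which are constant up to the edge `p e`. -/
def IsLocallyCartesianEdge (p : X ⟶ A) (e : Δ[1] ⟶ X) : Prop :=
  ∀ m : ℕ, HasOuterLift p (yonedaEquiv e) (simplexMap (coneCollapse m 1) ≫ e ≫ p)

lemma coneMap_comp_coneSuffix (ρ : Fin (k + 1) →o Fin 2) :
    (coneMap m ρ).comp (coneSuffix m k) = (coneSuffix m 1).comp ρ := by
  ext i : 2
  change coneMap m ρ (coneSuffix m k i) = coneSuffix m 1 (ρ i)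
  rw [coneMap_of_lt _ (lt_coneSuffix i), coneCollapse_coneSuffix]

lemma coneMap_coneMap {ρ : Fin (k + 1) →o Fin 2} {j : Fin 2 →o Fin (k + 1)}
    (hρj : ∀ i, ρ (j i) = i) : (coneMap m ρ).comp (coneMap m j) = OrderHom.id := by
  ext i : 2
  change coneMap m ρ (coneMap m j i) = i
  by_cases hi : i.val ≤ m
  · have h1 := coneMap_of_le j hi
    ext
    rw [coneMap_of_le ρ (h1.trans_le hi), h1]
  · rw [coneMap_of_lt j (not_le.1 hi), coneMap_of_lt ρ (lt_coneSuffix _),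
      coneCollapse_coneSuffix, hρj]
    exact coneSuffix_coneCollapse (not_le.1 hi)

lemma coneCollapse_coneMap {l : ℕ} (f : Fin (k + 1) →o Fin (l + 1)) (hf : f 0 = 0)
    (i : Fin (m + 1 + k + 1)) : coneCollapse m l (coneMap m f i) = f (coneCollapse m k i) := by
  by_cases hi : i.val ≤ m
  · rw [coneCollapse_of_le ((coneMap_of_le f hi).trans_le hi), coneCollapse_of_le hi, hf]
  · rw [coneMap_of_lt f (not_le.1 hi), coneCollapse_coneSuffix]

lemma simplexMap_coneSuffix_of_horn {a : (Λ[m + 2, Fin.last (m + 2)] : SSet.{u}) ⟶ X}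
    {b : Δ[m + 2] ⟶ A} (ha : a ≫ p = Λ[m + 2, Fin.last (m + 2)].ι ≫ b) {e : Δ[1] ⟶ X}
    (hae : a.app _ (hornLastEdge m) = yonedaEquiv e) :
    simplexMap (coneSuffix m 1) ≫ b = e ≫ p := by
  have hae' : yonedaEquiv.symm (hornLastEdge m) ≫ a = e := by
    apply yonedaEquiv.injective
    rw [← hae, yonedaEquiv_comp, Equiv.apply_symm_apply]
  rw [← hae', Category.assoc, ha]
  rw [← Category.assoc]
  congr 1
  apply yonedaEquiv.injective
  refine stdSimplex.ext (n := m + 2) (d := 1) _ _ (fun i => ?_)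
  have key (y : Fin 2) : coneSuffix m 1 y =
      (![(Fin.last (m + 1)).castSucc, Fin.last (m + 2)] : Fin 2 → Fin (m + 3)) y := by
    fin_cases y <;> rfl
  exact key _

/-- A simplex `Θ` over the edge `p e` which satisfies the conditions of
`exists_lift_of_cone` gives lifts over all simplices. -/
lemma isCartesianEdge_of_cone (hp : InnerFibration p) (Θ : Δ[k] ⟶ X) (e : Δ[1] ⟶ X)
    (ρ : Fin (k + 1) →o Fin 2) (D : Finset (Fin (k + 1)))
    (hΘ : ∀ (d : ℕ) (s : (Δ[k] : SSet.{u}) _⦋d⦌), (∀ i, s i ∈ D) →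
      Θ.app _ s = e.app _ ((simplexMap ρ).app _ s))
    (hΘp : Θ ≫ p = simplexMap ρ ≫ e ≫ p)
    (j : Fin 2 →o Fin (k + 1)) (hjD : ∀ i, j i ∈ D) (hρj : ∀ i, ρ (j i) = i)
    (M : Set ((Δ[k] : SSet.{u}) _⦋1⦌)) (hM : ∀ ε ∈ M, IsCartesianEdge p (Θ.app _ ε))
    (Q : ∀ m : ℕ, LowerSet (Finset (Fin (m + 1 + k + 1))))
    (hQ : ∀ m, CartesianExtension.{u} ((simplexMap (coneSuffix m k)).app _ '' M)
      (faceComplex (coneSuffixFaces m k ⊔ coneHornFaces m ρ D)) (faceComplex (Q m)))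
    (hQj : ∀ m, Finset.univ.image (coneMap m j) ∈ Q m) :
    IsCartesianEdge p (yonedaEquiv e) := by
  intro m a b ha hae
  -- As `p Θ` is pulled back from `p e` along `ρ`, any `b` can be extended to `[m] ⋆ [k]` by pulling
  -- it back along `[m] ⋆ ρ`.
  refine exists_lift_of_cone hp Θ e ρ D hΘ j hjD hρj M hM (Q m) (hQ m) (hQj m)
    (simplexMap (coneMap m ρ) ≫ b) b ?_ rfl ?_ a ha hae
  · rw [← Category.assoc, simplexMap_comp, coneMap_comp_coneSuffix, ← simplexMap_comp,
      Category.assoc, hΘp, ← simplexMap_coneSuffix_of_horn ha hae]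
  · rw [← Category.assoc, simplexMap_comp, coneMap_coneMap hρj]
    exact (congrArg (· ≫ b) (simplexMap_id (m + 2))).trans (Category.id_comp b)

/-- A simplex `Θ` which satisfies the conditions of `exists_lift_of_cone` gives lifts over
degenerate simplices. -/
lemma isLocallyCartesianEdge_of_cone (hp : InnerFibration p) (Θ : Δ[k] ⟶ X) (e : Δ[1] ⟶ X)
    (ρ : Fin (k + 1) →o Fin 2) (hρ : ρ 0 = 0) (D : Finset (Fin (k + 1))) (hD : 0 ∈ D)
    (hΘ : ∀ (d : ℕ) (s : (Δ[k] : SSet.{u}) _⦋d⦌), (∀ i, s i ∈ D) →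
      Θ.app _ s = e.app _ ((simplexMap ρ).app _ s))
    (j : Fin 2 →o Fin (k + 1)) (hjD : ∀ i, j i ∈ D) (hρj : ∀ i, ρ (j i) = i)
    (M : Set ((Δ[k] : SSet.{u}) _⦋1⦌)) (hM : ∀ ε ∈ M, IsCartesianEdge p (Θ.app _ ε))
    (Q : ∀ m : ℕ, LowerSet (Finset (Fin (m + 1 + k + 1))))
    (hQ : ∀ m, CartesianExtension.{u} ((simplexMap (coneSuffix m k)).app _ '' M)
      (faceComplex (coneSuffixFaces m k ⊔ coneHornFaces m ρ D)) (faceComplex (Q m)))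
    (hQj : ∀ m, Finset.univ.image (coneMap m j) ∈ Q m) :
    IsLocallyCartesianEdge p e := by
  intro m a ha hae
  -- Nothing is assumed on `p Θ`, so the base simplex is `p Θ` with `[m]` collapsed to the vertex
  -- `0`. It is compatible with `e` because `0 ∈ D` and `ρ 0 = 0`.
  refine exists_lift_of_cone hp Θ e ρ D hΘ j hjD hρj M hM (Q m) (hQ m) (hQj m)
    (simplexMap (coneCollapse m k) ≫ Θ ≫ p) _ ?_ ?_ ?_ a ha hae
  · rw [← Category.assoc, simplexMap_comp]
    have : (coneCollapse m k).comp (coneSuffix m k) = OrderHom.id := by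
      ext i : 2
      exact coneCollapse_coneSuffix i
    rw [this, simplexMap_id, Category.id_comp]
  · ext ⟨⟨d⟩⟩ ⟨x, hx⟩
    refine congrArg (p.app _) ((hΘ d _ (fun i => ?_)).trans (congrArg (e.app _) ?_))
    · change coneCollapse m k ((x : (Δ[m + 1 + k] : SSet.{u}) _⦋d⦌) i) ∈ D
      by_cases hi : ((x : (Δ[m + 1 + k] : SSet.{u}) _⦋d⦌) i).val ≤ m
      · rwa [coneCollapse_of_le hi]
      · exact hx.1 _ (Finset.mem_image.2 ⟨i, Finset.mem_univ _, rfl⟩) (not_le.1 hi)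
    · exact stdSimplex.ext (n := 1) (d := d) _ _ (fun i => (coneCollapse_coneMap ρ hρ _).symm)
  · ext ⟨⟨d⟩⟩ x
    have hj (i : Fin (m + 1 + 1 + 1)) : coneCollapse m k (coneMap m j i) =
        if i.val ≤ m then 0 else j (coneCollapse m 1 i) := by
      split_ifs with hi
      · exact coneCollapse_of_le ((coneMap_of_le j hi).trans_le hi)
      · rw [coneMap_of_lt j (not_le.1 hi), coneCollapse_coneSuffix]
    refine congrArg (p.app _) ((hΘ d _ (fun i => ?_)).trans (congrArg (e.app _) ?_))
    · change coneCollapse m k (coneMap m j ((x : (Δ[m + 2] : SSet.{u}) _⦋d⦌) i)) ∈ D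
      rw [hj]
      split_ifs
      · exact hD
      · exact hjD _
    · refine stdSimplex.ext (n := 1) (d := d) _ _ (fun i => ?_)
      change ρ (coneCollapse m k (coneMap m j ((x : (Δ[m + 2] : SSet.{u}) _⦋d⦌) i))) =
        coneCollapse m 1 ((x : (Δ[m + 2] : SSet.{u}) _⦋d⦌) i)
      rw [hj]
      split_ifs with hi
      · rw [hρ]
        exact (coneCollapse_of_le (k := 1) hi).symm
      · exact hρj _

/-- To compare a simplex with a degeneracy of an edge on the faces contained in `D`, it suffices to
compare them on a single face which contains `D`. -/
lemma app_eq_of_simplexMap_comp {l : ℕ} {Θ : Δ[k] ⟶ X} {e : Δ[1] ⟶ X} {ρ : Fin (k + 1) →o Fin 2}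
    {D : Finset (Fin (k + 1))} (f : Fin (l + 1) →o Fin (k + 1)) (r : Fin (k + 1) →o Fin (l + 1))
    (hfr : ∀ i ∈ D, f (r i) = i) (h : simplexMap f ≫ Θ = simplexMap (ρ.comp f) ≫ e) (d : ℕ)
    (s : (Δ[k] : SSet.{u}) _⦋d⦌) (hs : ∀ i, s i ∈ D) :
    Θ.app _ s = e.app _ ((simplexMap ρ).app _ s) := by
  have hs' : (simplexMap f).app _ ((simplexMap r).app _ s) = s :=
    stdSimplex.ext (n := k) (d := d) _ _ (fun i => hfr _ (hs i))
  rw [← hs']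
  exact ConcreteCategory.congr_hom (congr_app h _) ((simplexMap r).app _ s)

lemma image_coneMap_mem_coneFaces (j : Fin 2 →o Fin (k + 1)) (c : Fin (k + 1)) (hc : ∀ i, j i ≠ c) :
    Finset.univ.image (coneMap m j) ∈ coneFaces m {c} := by
  refine Or.inr fun c' hc' h => ?_
  obtain rfl := Finset.mem_singleton.1 hc'
  obtain ⟨i, _, hi⟩ := Finset.mem_image.1 h
  by_cases him : i.val ≤ m
  · have h1 := coneMap_of_le j him
    have h2 := lt_coneSuffix (m := m) c'
    rw [← hi] at h2
    omega
  · rw [coneMap_of_lt j (not_le.1 him)] at hi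
    exact hc _ (coneSuffix_injective hi)

lemma app_edge_threeToOne {Θ : Δ[3] ⟶ X} {e : Δ[1] ⟶ X}
    (hΘ : stdSimplex.δ 1 ≫ Θ = simplexMap twoToOne ≫ e) (d : ℕ)
    (s : (Δ[3] : SSet.{u}) _⦋d⦌) (hs : ∀ i, s i ∈ ({0, 2, 3} : Finset (Fin 4))) :
    Θ.app _ s = e.app _ ((simplexMap threeToOne).app _ s) := by
  refine app_eq_of_simplexMap_comp (D := {0, 2, 3}) (l := 2) (Fin.succAboveOrderEmb 1).toOrderHom
    ⟨![0, 0, 1, 2], by decide⟩ (by decide) ?_ d s hs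
  have : threeToOne.comp (Fin.succAboveOrderEmb (1 : Fin 4)).toOrderHom = twoToOne := by
    ext i : 2
    fin_cases i <;> rfl
  rw [this]
  exact hΘ

/-- `Θ` exhibits `e` as a retract of its edge `1 ⟶ 3`, with the target fixed: the face on `0, 2, 3`
is a degeneracy of `e`, so `0 ⟶ 1 ⟶ 2` composes to an identity. -/
lemma isCartesianEdge_of_tetrahedron (hp : InnerFibration p) (Θ : Δ[3] ⟶ X) (e : Δ[1] ⟶ X)
    (hΘ : stdSimplex.δ 1 ≫ Θ = simplexMap twoToOne ≫ e)
    (hΘp : Θ ≫ p = simplexMap threeToOne ≫ e ≫ p)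
    (hM : IsCartesianEdge p (Θ.app _ (stdSimplex.edge 3 1 3 (by decide)))) :
    IsCartesianEdge p (yonedaEquiv e) :=
  isCartesianEdge_of_cone hp Θ e threeToOne {0, 2, 3} (app_edge_threeToOne hΘ) hΘp
    ⟨![2, 3], by decide⟩ (by decide) (by decide) {stdSimplex.edge 3 1 3 (by decide)}
    (by rintro _ rfl; exact hM) _ cartesianExtension_threeToOne
    (fun _ => image_coneMap_mem_coneFaces _ _ (by decide))

lemma isLocallyCartesianEdge_of_tetrahedron (hp : InnerFibration p) (Θ : Δ[3] ⟶ X) (e : Δ[1] ⟶ X)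
    (hΘ : stdSimplex.δ 1 ≫ Θ = simplexMap twoToOne ≫ e)
    (hM : IsCartesianEdge p (Θ.app _ (stdSimplex.edge 3 1 3 (by decide)))) :
    IsLocallyCartesianEdge p e :=
  isLocallyCartesianEdge_of_cone hp Θ e threeToOne rfl {0, 2, 3} (by decide)
    (app_edge_threeToOne hΘ)
    ⟨![2, 3], by decide⟩ (by decide) (by decide) {stdSimplex.edge 3 1 3 (by decide)}
    (by rintro _ rfl; exact hM) _ cartesianExtension_threeToOne
    (fun _ => image_coneMap_mem_coneFaces _ _ (by decide))

/-- The base triangle `p t` is arbitrary, so this method reaches only the local property; a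
Cartesian fibration is needed to remove the restriction. -/
lemma isLocallyCartesianEdge_comp (hp : InnerFibration p) (t : Δ[2] ⟶ X)
    (h₀₁ : IsCartesianEdge p (t.app _ (stdSimplex.edge 2 0 1 (by decide))))
    (h₁₂ : IsCartesianEdge p (t.app _ (stdSimplex.edge 2 1 2 (by decide)))) :
    IsLocallyCartesianEdge p (stdSimplex.δ 1 ≫ t) := by
  refine isLocallyCartesianEdge_of_cone hp t _ twoToOne rfl {0, 2} (by decide)
    (app_eq_of_simplexMap_comp (l := 1) (Fin.succAboveOrderEmb 1).toOrderHom
      ⟨![0, 0, 1], by decide⟩ (by decide) ?_)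
    ⟨![0, 2], by decide⟩ (by decide) (by decide) _ ?_ _ cartesianExtension_twoToOne
    (fun _ => trivial)
  · have : twoToOne.comp (Fin.succAboveOrderEmb (1 : Fin 3)).toOrderHom = OrderHom.id := by
      ext i : 2
      fin_cases i <;> rfl
    rw [this, simplexMap_id, Category.id_comp]
    rfl
  · rintro _ (rfl | rfl)
    exacts [h₀₁, h₁₂]

lemma isLocallyCartesianEdge_cancel (hp : InnerFibration p) (t : Δ[2] ⟶ X)
    (h₀₂ : IsCartesianEdge p (t.app _ (stdSimplex.edge 2 0 2 (by decide))))
    (h₁₂ : IsCartesianEdge p (t.app _ (stdSimplex.edge 2 1 2 (by decide)))) :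
    IsLocallyCartesianEdge p (stdSimplex.δ 2 ≫ t) := by
  refine isLocallyCartesianEdge_of_cone hp t _ twoToOne' rfl {0, 1} (by decide)
    (app_eq_of_simplexMap_comp (l := 1) (Fin.succAboveOrderEmb 2).toOrderHom
      ⟨![0, 1, 1], by decide⟩ (by decide) ?_)
    ⟨![0, 1], by decide⟩ (by decide) (by decide) _ ?_ _ cartesianExtension_twoToOne'
    (fun _ => trivial)
  · have : twoToOne'.comp (Fin.succAboveOrderEmb (2 : Fin 3)).toOrderHom = OrderHom.id := by
      ext i : 2
      fin_cases i <;> rfl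
    rw [this, simplexMap_id, Category.id_comp]
    rfl
  · rintro _ (rfl | rfl)
    exacts [h₀₂, h₁₂]

/-- Filling the outer horn given by a compatible family of faces. -/
lemma HasOuterLift.exists_filler {e : X _⦋1⦌} {b : Δ[m + 2] ⟶ A} (h : HasOuterLift p e b)
    (f : ∀ (j : Fin (m + 3)) (_ : j ≠ Fin.last (m + 2)), Δ[m + 1] ⟶ X) (hf : horn.IsCompatible f)
    (hfb : ∀ j hj, f j hj ≫ p = stdSimplex.δ j ≫ b)
    (hfe : (f 0 (Fin.last_pos.ne)).app _
      (stdSimplex.edge (m + 1) (Fin.last m).castSucc (Fin.last _) (Fin.le_last _)) = e) :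
    ∃ l : Δ[m + 2] ⟶ X, (∀ j hj, stdSimplex.δ j ≫ l = f j hj) ∧ l ≫ p = b := by
  obtain ⟨a, ha⟩ := hf.exists_desc
  obtain ⟨l, hl, hlp⟩ := h a (horn.hom_ext' (fun j hj => by
    rw [reassoc_of% ha, hfb, horn.ι_ι_assoc])) (by
      rw [← hfe, ← ha]
      refine congrArg (a.app _) (Subtype.ext ?_)
      refine stdSimplex.ext (n := m + 2) (d := 1) _ _ (fun l => ?_)
      fin_cases l <;> rfl)
  exact ⟨l, fun j hj => by rw [← ha, ← hl, horn.ι_ι_assoc], hlp⟩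

lemma exists_triangle {e f : Δ[1] ⟶ X} {b : Δ[2] ⟶ A} (h : HasOuterLift (m := 0) p (yonedaEquiv e) b)
    (hef : stdSimplex.δ 0 ≫ f = stdSimplex.δ 0 ≫ e) (he : e ≫ p = stdSimplex.δ 0 ≫ b)
    (hf : f ≫ p = stdSimplex.δ 1 ≫ b) :
    ∃ t : Δ[2] ⟶ X, stdSimplex.δ 0 ≫ t = e ∧ stdSimplex.δ 1 ≫ t = f ∧ t ≫ p = b := by
  obtain ⟨t, ht, htp⟩ := h.exists_filler (fun j _ => ![e, f, f] j) (by
      intro j k hj hk hjk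
      fin_cases j <;> fin_cases k <;> simp at hj hk hjk
      exact hef.symm) (by
      intro j hj
      fin_cases j
      · exact he
      · exact hf
      · exact absurd rfl hj) (by
      change e.app _ _ = e.app _ (stdSimplex.objEquiv.symm (𝟙 _))
      refine congrArg (e.app _) ?_
      refine stdSimplex.ext (n := 1) (d := 1) _ _ (fun l => ?_)
      fin_cases l <;> rfl)
  exact ⟨t, ht 0 (by decide), ht 1 (by decide), htp⟩

lemma exists_tetrahedron {e : Δ[1] ⟶ X} {t₀ t₁ t₂ : Δ[2] ⟶ X} {b : Δ[3] ⟶ A}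
    (h : HasOuterLift (m := 1) p (yonedaEquiv e) b) (he : stdSimplex.δ 0 ≫ t₀ = e)
    (h₀₁ : stdSimplex.δ 0 ≫ t₀ = stdSimplex.δ 0 ≫ t₁)
    (h₀₂ : stdSimplex.δ 1 ≫ t₀ = stdSimplex.δ 0 ≫ t₂)
    (h₁₂ : stdSimplex.δ 1 ≫ t₁ = stdSimplex.δ 1 ≫ t₂)
    (h₀ : t₀ ≫ p = stdSimplex.δ 0 ≫ b) (h₁ : t₁ ≫ p = stdSimplex.δ 1 ≫ b)
    (h₂ : t₂ ≫ p = stdSimplex.δ 2 ≫ b) :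
    ∃ t : Δ[3] ⟶ X, stdSimplex.δ 0 ≫ t = t₀ ∧ stdSimplex.δ 1 ≫ t = t₁ ∧ t ≫ p = b := by
  obtain ⟨t, ht, htp⟩ := h.exists_filler (fun j _ => ![t₀, t₁, t₂, t₂] j) (by
      intro j k hj hk hjk
      fin_cases j <;> fin_cases k <;> simp at hj hk hjk
      exacts [h₀₁, h₀₂, h₁₂]) (by
      intro j hj
      fin_cases j
      · exact h₀
      · exact h₁
      · exact h₂
      · exact absurd rfl hj) (by
      rw [← he]
      change t₀.app _ _ = t₀.app _ ((stdSimplex.δ 0).app _ (stdSimplex.objEquiv.symm (𝟙 _)))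
      refine congrArg (t₀.app _) ?_
      refine stdSimplex.ext (n := 2) (d := 1) _ _ (fun l => ?_)
      fin_cases l <;> rfl)
  exact ⟨t, ht 0 (by decide), ht 1 (by decide), htp⟩

lemma simplexMap_congr {n : ℕ} {f g : Fin (m + 1) →o Fin (n + 1)} (h : ∀ i, f i = g i) :
    simplexMap.{u} f = simplexMap g := by
  obtain rfl : f = g := OrderHom.ext _ _ (funext h)
  rfl

lemma yonedaEquiv_simplexMap_comp {n : ℕ} (f : Fin 2 →o Fin (n + 1)) (t : Δ[n] ⟶ X) :
    yonedaEquiv (simplexMap f ≫ t) =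
      t.app _ (stdSimplex.edge n (f 0) (f 1) (f.monotone (by decide))) := by
  refine congrArg (t.app _) (stdSimplex.ext (n := n) (d := 1) _ _ (fun i => ?_))
  fin_cases i <;> rfl

lemma δ_eq_simplexMap {n : ℕ} (i : Fin (n + 2)) :
    (stdSimplex.δ i : (Δ[n] : SSet.{u}) ⟶ Δ[n + 1]) =
      simplexMap (Fin.succAboveOrderEmb i).toOrderHom := rfl

lemma yonedaEquiv_δ_comp_triangle (t : Δ[2] ⟶ X) :
    yonedaEquiv (stdSimplex.δ 0 ≫ t) = t.app _ (stdSimplex.edge 2 1 2 (by decide)) ∧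
    yonedaEquiv (stdSimplex.δ 1 ≫ t) = t.app _ (stdSimplex.edge 2 0 2 (by decide)) ∧
    yonedaEquiv (stdSimplex.δ 2 ≫ t) = t.app _ (stdSimplex.edge 2 0 1 (by decide)) :=
  ⟨yonedaEquiv_simplexMap_comp (Fin.succAboveOrderEmb 0).toOrderHom t,
    yonedaEquiv_simplexMap_comp (Fin.succAboveOrderEmb 1).toOrderHom t,
    yonedaEquiv_simplexMap_comp (Fin.succAboveOrderEmb 2).toOrderHom t⟩

lemma IsCartesianFibration.exists_hom_lift (hp : IsCartesianFibration p) (y : Δ[0] ⟶ X)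
    (g : Δ[1] ⟶ A) (hg : stdSimplex.δ 0 ≫ g = y ≫ p) :
    ∃ f : Δ[1] ⟶ X, stdSimplex.δ 0 ≫ f = y ∧ f ≫ p = g ∧ IsCartesianEdge p (yonedaEquiv f) := by
  obtain ⟨f, hf, hfp, hfc⟩ := hp.exists_lift (yonedaEquiv y) (yonedaEquiv g) (by
    rw [← yonedaEquiv_comp, ← hg, stdSimplex.yonedaEquiv_δ_comp])
  refine ⟨yonedaEquiv.symm f, ?_, ?_, by rwa [Equiv.apply_symm_apply]⟩
  · apply yonedaEquiv.injective
    rw [← hf, stdSimplex.yonedaEquiv_δ_comp, Equiv.apply_symm_apply]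
  · apply yonedaEquiv.injective
    rw [yonedaEquiv_comp, Equiv.apply_symm_apply, hfp]

/-- The degenerate edges of a Cartesian fibration are Cartesian. -/
lemma IsCartesianFibration.isCartesianEdge_degenerate (hp : IsCartesianFibration p) (x : X _⦋0⦌) :
    IsCartesianEdge p (X.σ 0 x) := by
  obtain ⟨x, rfl⟩ := yonedaEquiv.surjective x
  let c (n : ℕ) : Fin (n + 1) →o Fin 1 := ⟨fun _ => 0, fun _ _ _ => le_rfl⟩
  rw [← stdSimplex.yonedaEquiv_σ_comp]
  have hσ : (stdSimplex.σ 0 : (Δ[1] : SSet.{u}) ⟶ Δ[0]) = simplexMap (c 1) :=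
    yonedaEquiv.injective (stdSimplex.ext (n := 0) (d := 1) _ _ (fun i =>
      Subsingleton.elim (α := Fin 1) _ _))
  rw [hσ]
  have hδ : stdSimplex.δ 0 ≫ simplexMap (c 1) = 𝟙 (Δ[0] : SSet.{u}) :=
    yonedaEquiv.injective (stdSimplex.ext (n := 0) (d := 0) _ _ (fun i =>
      Subsingleton.elim (α := Fin 1) _ _))
  -- A Cartesian edge `f` over the identity of `p x` with target `x`. The triangle `t` factors the
  -- identity of `x` through `f`, and its degeneracy on `0, 1, 2, 2` makes that identity a retract
  -- of `f`.
  obtain ⟨f, hf, hfp, hfc⟩ := hp.exists_hom_lift x (simplexMap (c 1) ≫ x ≫ p)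
    (by rw [reassoc_of% hδ])
  obtain ⟨t, ht₀, ht₁, htp⟩ := exists_triangle (p := p) (e := f) (f := simplexMap (c 1) ≫ x)
    (b := simplexMap (c 2) ≫ x ≫ p) (isCartesianEdge_iff_hasOuterLift.1 hfc 0 _)
    (by rw [reassoc_of% hδ, hf]) hfp rfl
  refine isCartesianEdge_of_tetrahedron hp.innerFibration
    (simplexMap ⟨![0, 1, 2, 2], by decide⟩ ≫ t) _ ?_ ?_ ?_
  · have : stdSimplex.δ 1 ≫ simplexMap.{u} (⟨![0, 1, 2, 2], by decide⟩ : Fin 4 →o Fin 3) =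
        simplexMap twoToOne' ≫ stdSimplex.δ 1 := by
      rw [δ_eq_simplexMap, δ_eq_simplexMap, simplexMap_comp, simplexMap_comp]
      exact simplexMap_congr (by decide)
    rw [reassoc_of% this, ht₁]
    rfl
  · rw [Category.assoc, htp]
    rfl
  · rw [← ht₀, (yonedaEquiv_δ_comp_triangle t).1] at hfc
    convert hfc using 1
    refine congrArg (t.app _) (stdSimplex.ext (n := 2) (d := 1) _ _ (fun i => ?_))
    fin_cases i <;> rfl

/-- In a Cartesian fibration, the locally Cartesian edges are Cartesian. -/
lemma IsCartesianFibration.isCartesianEdge_of_isLocallyCartesianEdge (hp : IsCartesianFibration p)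
    {e : Δ[1] ⟶ X} (he : IsLocallyCartesianEdge p e) : IsCartesianEdge p (yonedaEquiv e) := by
  -- Let `f` be a Cartesian edge with the target and image of `e`. Then `t` factors `f` through `e`,
  -- by the local property of `e`, and `t'` factors `e` through `f`.
  obtain ⟨f, hf, hfp, hfc⟩ := hp.exists_hom_lift (stdSimplex.δ 0 ≫ e) (e ≫ p) (by simp)
  have hδ₀ : stdSimplex.δ 0 ≫ simplexMap (coneCollapse 0 1) = 𝟙 (Δ[1] : SSet.{u}) := by
    rw [δ_eq_simplexMap, simplexMap_comp, ← simplexMap_id]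
    exact simplexMap_congr (by decide)
  have hδ₁ : stdSimplex.δ 1 ≫ simplexMap (coneCollapse 0 1) = 𝟙 (Δ[1] : SSet.{u}) := by
    rw [δ_eq_simplexMap, simplexMap_comp, ← simplexMap_id]
    exact simplexMap_congr (by decide)
  have hδ (i : Fin 4) (hi : i ≠ 3) : stdSimplex.δ i ≫ simplexMap (coneCollapse 1 1) =
      (simplexMap.{u} (coneCollapse 0 1)) := by
    rw [δ_eq_simplexMap, simplexMap_comp]
    exact simplexMap_congr (by revert i; decide)
  obtain ⟨t, ht₀, ht₁, htp⟩ := exists_triangle (f := f) (he 0) hf (by rw [reassoc_of% hδ₀])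
    (by rw [reassoc_of% hδ₁, hfp])
  obtain ⟨t', ht'₀, ht'₁, ht'p⟩ := exists_triangle (p := p) (e := f) (f := e)
    (b := simplexMap (coneCollapse 0 1) ≫ e ≫ p) (isCartesianEdge_iff_hasOuterLift.1 hfc 0 _)
    hf.symm (by rw [reassoc_of% hδ₀, hfp]) (by rw [reassoc_of% hδ₁])
  -- The faces `t`, a degeneracy of `e`, and `t'` form an outer horn with last edge `e`. Its filler
  -- lies over a degeneracy of `p e` and makes `e` a retract of `f`.
  obtain ⟨Θ, hΘ₀, hΘ₁, hΘp⟩ := exists_tetrahedron (t₁ := simplexMap (coneCollapse 0 1) ≫ e)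
    (he 1) ht₀ (by rw [ht₀, reassoc_of% hδ₀]) (ht₁.trans ht'₀.symm)
    (by rw [ht'₁, reassoc_of% hδ₁])
    (htp.trans (by rw [← hδ 0 (by decide), Category.assoc]))
    (by rw [← hδ 1 (by decide), Category.assoc, Category.assoc])
    (ht'p.trans (by rw [← hδ 2 (by decide), Category.assoc]))
  refine isCartesianEdge_of_tetrahedron hp.innerFibration Θ e ?_ ?_ ?_
  · rw [hΘ₁]
    exact congrArg (· ≫ e) (simplexMap_congr (by decide))
  · rw [hΘp]
    exact congrArg (· ≫ e ≫ p) (simplexMap_congr (by decide))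
  · rw [← ht₁, ← hΘ₀, (yonedaEquiv_δ_comp_triangle _).2.1] at hfc
    convert hfc using 1
    refine congrArg (Θ.app _) (stdSimplex.ext (n := 3) (d := 1) _ _ (fun i => ?_))
    fin_cases i <;> rfl

lemma IsCartesianFibration.isCartesianEdge_comp (hp : IsCartesianFibration p) (t : Δ[2] ⟶ X)
    (h₀₁ : IsCartesianEdge p (t.app _ (stdSimplex.edge 2 0 1 (by decide))))
    (h₁₂ : IsCartesianEdge p (t.app _ (stdSimplex.edge 2 1 2 (by decide)))) :
    IsCartesianEdge p (t.app _ (stdSimplex.edge 2 0 2 (by decide))) := by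
  rw [← (yonedaEquiv_δ_comp_triangle _).2.1]
  exact hp.isCartesianEdge_of_isLocallyCartesianEdge
    (isLocallyCartesianEdge_comp hp.innerFibration t h₀₁ h₁₂)

lemma IsCartesianFibration.isCartesianEdge_cancel (hp : IsCartesianFibration p) (t : Δ[2] ⟶ X)
    (h₀₂ : IsCartesianEdge p (t.app _ (stdSimplex.edge 2 0 2 (by decide))))
    (h₁₂ : IsCartesianEdge p (t.app _ (stdSimplex.edge 2 1 2 (by decide)))) :
    IsCartesianEdge p (t.app _ (stdSimplex.edge 2 0 1 (by decide))) := by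
  rw [← (yonedaEquiv_δ_comp_triangle _).2.2]
  exact hp.isCartesianEdge_of_isLocallyCartesianEdge
    (isLocallyCartesianEdge_cancel hp.innerFibration t h₀₂ h₁₂)

/-- The edges of a Cartesian fibration which are equivalences are Cartesian. -/
lemma IsCartesianFibration.isCartesianEdge_of_coherentIso (hp : IsCartesianFibration p)
    (v : coherentIso.{u} ⟶ X) (ε : coherentIso.{u} _⦋1⦌) : IsCartesianEdge p (v.app _ ε) := by
  let ab := Codiscrete.equivFun ε
  -- On vertices `a, b, a, b`, the face on `0, 2, 3` is a degeneracy of `ε` and the edge `1 ⟶ 3` is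
  -- the identity of `b`, which is Cartesian.
  let θ : coherentIso.{u} _⦋3⦌ := Codiscrete.equivFun.symm ![ab 0, ab 1, ab 0, ab 1]
  have h := hp.isCartesianEdge_of_isLocallyCartesianEdge
    (isLocallyCartesianEdge_of_tetrahedron hp.innerFibration
      (yonedaEquiv.symm θ ≫ v) (yonedaEquiv.symm ε ≫ v) ?_ ?_)
  · rwa [yonedaEquiv_comp, Equiv.apply_symm_apply] at h
  · rw [← Category.assoc, ← Category.assoc]
    congr 1
    apply yonedaEquiv.injective
    apply Codiscrete.equivFun.injective
    ext i
    fin_cases i <;> rfl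
  · convert hp.isCartesianEdge_degenerate
      (v.app _ (Codiscrete.equivFun.symm ![ab 1] : coherentIso.{u} _⦋0⦌)) using 1
    rw [← SSet.σ_naturality_apply]
    refine congrArg (v.app _) ?_
    apply Codiscrete.equivFun.injective
    ext i
    fin_cases i <;> rfl

end

end SSet

/-!
### Lifting along the inclusion of the boundary and one end of a prism
-/

namespace SSet

section

variable {n : ℕ}

/-- A pair of maps `g : [d] ⟶ [n]` and `h : [d] ⟶ [1]` such that `g ≤ j` where `h = 0` and
`j ≤ g` where `h = 1`. -/
def PrismSplit {d : ℕ} (g : Fin (d + 1) → Fin (n + 1)) (h : Fin (d + 1) → Fin 2) (j : ℕ) : Prop :=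
  ∀ a, (h a = 0 → (g a).val ≤ j) ∧ (h a = 1 → j ≤ (g a).val)

/-- The filtration of the prism `Δ[n] × Δ[1]`. -/
def prismFiltration (n i : ℕ) : (Δ[n] ⊗ Δ[1] : SSet.{u}).Subcomplex where
  obj d := Set.ofPred (fun s => (∃ k, ∀ a, stdSimplex.asOrderHom s.1 a ≠ k) ∨
    (∀ a, stdSimplex.asOrderHom s.2 a = 1) ∨
    ∃ j, j < i ∧ PrismSplit (stdSimplex.asOrderHom s.1) (stdSimplex.asOrderHom s.2) j)
  map φ s hs := by
    rcases hs with ⟨k, hk⟩ | h | ⟨j, hj, h⟩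
    · exact Or.inl ⟨k, fun a => hk (φ.unop.toOrderHom a)⟩
    · exact Or.inr (Or.inl fun a => h (φ.unop.toOrderHom a))
    · exact Or.inr (Or.inr ⟨j, hj, fun a => h (φ.unop.toOrderHom a)⟩)

lemma mem_prismFiltration_iff {d i : ℕ} (g : (Δ[n] : SSet.{u}) _⦋d⦌) (h : (Δ[1] : SSet.{u}) _⦋d⦌) :
    ((g, h) : (Δ[n] ⊗ Δ[1] : SSet.{u}) _⦋d⦌) ∈ (prismFiltration n i).obj _ ↔
      (∃ k, ∀ a, g a ≠ k) ∨ (∀ a, h a = 1) ∨ ∃ j, j < i ∧ PrismSplit g h j := Iff.rfl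

/-- The map `[n + 1] ⟶ [1]` which sends the elements `≤ i` to `0`. -/
def prismHeight (n i : ℕ) : Fin (n + 2) →o Fin 2 where
  toFun v := if v.val ≤ i then 0 else 1
  monotone' v w h := by
    rw [Fin.le_def] at h
    dsimp only
    split_ifs
    · exact le_rfl
    · exact Fin.zero_le _
    · omega
    · exact le_rfl

/-- The map `[n + 1] ⟶ [n]` which takes the value `i` twice. -/
def prismProj (n i : ℕ) (hi : i ≤ n) : Fin (n + 2) →o Fin (n + 1) where
  toFun v := if h : v.val ≤ i then ⟨v.val, by omega⟩ else ⟨v.val - 1, by omega⟩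
  monotone' v w h := by
    rw [Fin.le_def] at h
    dsimp only
    split_ifs <;> simp only [Fin.mk_le_mk] <;> omega

lemma prismProj_val (i : ℕ) (hi : i ≤ n) (v : Fin (n + 2)) :
    (prismProj n i hi v).val = if v.val ≤ i then v.val else v.val - 1 := by
  change (dite _ _ _ : Fin (n + 1)).val = _
  split_ifs <;> rfl

lemma prismHeight_eq_zero_iff (i : ℕ) (v : Fin (n + 2)) : prismHeight n i v = 0 ↔ v.val ≤ i := by
  change (if v.val ≤ i then (0 : Fin 2) else 1) = 0 ↔ _
  split_ifs with h <;> simp [h]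

lemma prismHeight_eq_one_iff (i : ℕ) (v : Fin (n + 2)) : prismHeight n i v = 1 ↔ i < v.val := by
  change (if v.val ≤ i then (0 : Fin 2) else 1) = 1 ↔ _
  split_ifs with h <;> simp [h]
  omega

/-- The nondegenerate `n + 1`-simplices of the prism. -/
def prismSimplex (n i : ℕ) (hi : i ≤ n) : (Δ[n + 1] : SSet.{u}) ⟶ Δ[n] ⊗ Δ[1] :=
  lift (simplexMap (prismProj n i hi)) (simplexMap (prismHeight n i))

instance (i : ℕ) (hi : i ≤ n) : Mono (prismSimplex.{u} n i hi) := by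
  rw [NatTrans.mono_iff_mono_app]
  rintro ⟨⟨d⟩⟩
  rw [mono_iff_injective]
  intro s s' h
  refine stdSimplex.ext (n := n + 1) (d := d) _ _ (fun a => ?_)
  have h₁ := DFunLike.congr_fun (F := (Δ[n] : SSet.{u}) _⦋d⦌) (congrArg Prod.fst h) a
  have h₂ := DFunLike.congr_fun (F := (Δ[1] : SSet.{u}) _⦋d⦌) (congrArg Prod.snd h) a
  change prismProj n i hi ((s : (Δ[n + 1] : SSet.{u}) _⦋d⦌) a) =
    prismProj n i hi ((s' : (Δ[n + 1] : SSet.{u}) _⦋d⦌) a) at h₁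
  change prismHeight n i ((s : (Δ[n + 1] : SSet.{u}) _⦋d⦌) a) =
    prismHeight n i ((s' : (Δ[n + 1] : SSet.{u}) _⦋d⦌) a) at h₂
  generalize (s : (Δ[n + 1] : SSet.{u}) _⦋d⦌) a = v at *
  generalize (s' : (Δ[n + 1] : SSet.{u}) _⦋d⦌) a = w at *
  have h₁ := congrArg Fin.val h₁
  rw [prismProj_val, prismProj_val] at h₁
  have h₃ : v.val ≤ i ↔ w.val ≤ i := by
    rw [← prismHeight_eq_zero_iff, ← prismHeight_eq_zero_iff, h₂]
  ext
  split_ifs at h₁ <;> omega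

/-- The simplex has vertices `(0,0), …, (i,0), (i,1), …, (n,1)`. Omitting its vertex `i` gives a
face of the preceding simplex, or the end `1` when `i = 0`. Omitting a vertex other than `i` and `i
+ 1` gives a face over the boundary. Only the face opposite `i + 1` is new. -/
lemma preimage_prismSimplex (i : ℕ) (hi : i ≤ n) :
    (prismFiltration.{u} n i).preimage (prismSimplex n i hi) =
      Λ[n + 1, (⟨i + 1, by omega⟩ : Fin (n + 2))] := by
  ext ⟨⟨d⟩⟩ s
  refine Iff.trans ?_ (mem_horn_iff_notMem_range (d := d) s _).symm
  change ((∃ k, ∀ a, prismProj n i hi ((s : (Δ[n + 1] : SSet.{u}) _⦋d⦌) a) ≠ k) ∨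
    (∀ a, prismHeight n i ((s : (Δ[n + 1] : SSet.{u}) _⦋d⦌) a) = 1) ∨
    ∃ j, j < i ∧ ∀ a, (prismHeight n i ((s : (Δ[n + 1] : SSet.{u}) _⦋d⦌) a) = 0 →
      (prismProj n i hi ((s : (Δ[n + 1] : SSet.{u}) _⦋d⦌) a)).val ≤ j) ∧
      (prismHeight n i ((s : (Δ[n + 1] : SSet.{u}) _⦋d⦌) a) = 1 →
        j ≤ (prismProj n i hi ((s : (Δ[n + 1] : SSet.{u}) _⦋d⦌) a)).val)) ↔ _
  simp only [prismHeight_eq_one_iff, prismHeight_eq_zero_iff]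
  simp only [prismProj_val, ne_eq, Fin.ext_iff, Set.mem_range, not_exists]
  generalize (s : (Δ[n + 1] : SSet.{u}) _⦋d⦌) = s
  constructor
  · rintro (⟨k, hk⟩ | h | ⟨j, hj, h⟩)
    · by_cases hki : k.val ≤ i
      · refine ⟨⟨k.val, by omega⟩, by dsimp only; omega, fun a ha => hk a ?_⟩
        dsimp only at ha
        rw [ha, if_pos hki]
      · refine ⟨⟨k.val + 1, by omega⟩, by dsimp only; omega, fun a ha => hk a ?_⟩
        dsimp only at ha
        rw [ha, if_neg (by omega)]
        omega
    · exact ⟨⟨i, by omega⟩, by simp, fun a ha => absurd (h a) (by dsimp only at ha; omega)⟩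
    · refine ⟨⟨i, by omega⟩, by simp, fun a ha => ?_⟩
      dsimp only at ha
      have := (h a).1 (by omega)
      rw [if_pos (by omega)] at this
      omega
  · rintro ⟨k, hk, hks⟩
    rcases lt_trichotomy k.val i with hki | hki | hki
    · refine Or.inl ⟨⟨k.val, by omega⟩, fun a ha => hks a ?_⟩
      dsimp only at ha
      split_ifs at ha <;> omega
    · rcases Nat.eq_zero_or_pos i with rfl | hi0
      · refine Or.inr (Or.inl fun a => ?_)
        have := hks a
        omega
      · refine Or.inr (Or.inr ⟨i - 1, by omega, fun a => ?_⟩)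
        have := hks a
        constructor <;> intro h
        · rw [if_pos h]; omega
        · rw [if_neg (by omega)]; omega
    · refine Or.inl ⟨⟨k.val - 1, by omega⟩, fun a ha => hks a ?_⟩
      dsimp only at ha hk
      split_ifs at ha <;> omega

lemma prismFiltration_sup_range (i : ℕ) (hi : i ≤ n) :
    prismFiltration.{u} n i ⊔ Subcomplex.range (prismSimplex n i hi) = prismFiltration n (i + 1) := by
  apply le_antisymm
  · refine sup_le ?_ ?_
    · rintro ⟨⟨d⟩⟩ s hs
      exact hs.imp id (Or.imp id (fun ⟨j, hj, h⟩ => ⟨j, hj.trans (Nat.lt_succ_self i), h⟩))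
    · rintro ⟨⟨d⟩⟩ _ ⟨s, rfl⟩
      refine Or.inr (Or.inr ⟨i, Nat.lt_succ_self i, fun a => ?_⟩)
      change (prismHeight n i ((s : (Δ[n + 1] : SSet.{u}) _⦋d⦌) a) = 0 →
        (prismProj n i hi ((s : (Δ[n + 1] : SSet.{u}) _⦋d⦌) a)).val ≤ i) ∧
        (prismHeight n i ((s : (Δ[n + 1] : SSet.{u}) _⦋d⦌) a) = 1 →
        i ≤ (prismProj n i hi ((s : (Δ[n + 1] : SSet.{u}) _⦋d⦌) a)).val)
      rw [prismHeight_eq_one_iff, prismHeight_eq_zero_iff, prismProj_val]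
      constructor <;> intro h
      · rwa [if_pos h]
      · rw [if_neg (by omega)]; omega
  · rintro ⟨⟨d⟩⟩ ⟨g, h⟩ (hs | hs | ⟨j, hj, hs⟩)
    · exact Or.inl (Or.inl hs)
    · exact Or.inl (Or.inr (Or.inl hs))
    · obtain hj | rfl := Nat.lt_succ_iff_lt_or_eq.1 hj
      · exact Or.inl (Or.inr (Or.inr ⟨j, hj, hs⟩))
      · right
        replace hs : PrismSplit (g : (Δ[n] : SSet.{u}) _⦋d⦌) (h : (Δ[1] : SSet.{u}) _⦋d⦌) j := hs
        have hg : Monotone ⇑(g : (Δ[n] : SSet.{u}) _⦋d⦌) := stdSimplex.monotone_apply _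
        have hh : Monotone ⇑(h : (Δ[1] : SSet.{u}) _⦋d⦌) := stdSimplex.monotone_apply _
        have h01 (x : Fin 2) : x = 0 ∨ x = 1 := by fin_cases x <;> simp
        -- The point `(g, h)` of the prism is the vertex `g` of the simplex at height `0` and `g +
        -- 1` at height `1`.
        refine ⟨stdSimplex.objMk ⟨fun a => if (h : (Δ[1] : SSet.{u}) _⦋d⦌) a = 0 then
          ((g : (Δ[n] : SSet.{u}) _⦋d⦌) a).castSucc else ((g : (Δ[n] : SSet.{u}) _⦋d⦌) a).succ, ?_⟩, ?_⟩
        · intro a b hab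
          have h₁ := Fin.le_def.1 (hg hab)
          have h₂ := hh hab
          dsimp only
          split_ifs with h₃ h₄ h₄
          · exact h₁
          · rw [Fin.le_def]; simp; omega
          · rw [h₄, Fin.le_zero_iff] at h₂
            exact absurd h₂ h₃
          · rw [Fin.le_def]; simpa using h₁
        · refine Prod.ext (stdSimplex.ext (n := n) (d := d) _ _ fun a => ?_)
            (stdSimplex.ext (n := 1) (d := d) _ _ fun a => ?_)
          · change prismProj n j hi (ite _ _ _) = (g : (Δ[n] : SSet.{u}) _⦋d⦌) a
            ext
            rw [prismProj_val]
            have := hs a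
            rcases h01 ((h : (Δ[1] : SSet.{u}) _⦋d⦌) a) with h₀ | h₀
            · rw [if_pos h₀, Fin.val_castSucc, if_pos (this.1 h₀)]
            · have h₁ : ¬ (h : (Δ[1] : SSet.{u}) _⦋d⦌) a = 0 := by rw [h₀]; decide
              have := this.2 h₀
              rw [if_neg h₁, Fin.val_succ, if_neg (by omega)]
              omega
          · change prismHeight n j (ite _ _ _) = (h : (Δ[1] : SSet.{u}) _⦋d⦌) a
            have := hs a
            rcases h01 ((h : (Δ[1] : SSet.{u}) _⦋d⦌) a) with h₀ | h₀
            · rw [if_pos h₀, h₀, prismHeight_eq_zero_iff]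
              exact this.1 h₀
            · rw [if_neg (by rw [h₀]; decide), h₀, prismHeight_eq_one_iff, Fin.val_succ]
              have := this.2 h₀; omega

lemma prismFiltration_eq_top : prismFiltration.{u} n (n + 1) = ⊤ := by
  refine top_le_iff.1 ?_
  rintro ⟨⟨d⟩⟩ ⟨g, h⟩ -
  refine Or.inr ?_
  change (∀ a, (h : (Δ[1] : SSet.{u}) _⦋d⦌) a = 1) ∨ ∃ j, j < n + 1 ∧
    PrismSplit (g : (Δ[n] : SSet.{u}) _⦋d⦌) (h : (Δ[1] : SSet.{u}) _⦋d⦌) j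
  have hg : Monotone ⇑(g : (Δ[n] : SSet.{u}) _⦋d⦌) := stdSimplex.monotone_apply _
  have hh : Monotone ⇑(h : (Δ[1] : SSet.{u}) _⦋d⦌) := stdSimplex.monotone_apply _
  have h01 (x : Fin 2) : x = 0 ∨ x = 1 := by fin_cases x <;> simp
  by_cases hex : ∃ a, (h : (Δ[1] : SSet.{u}) _⦋d⦌) a = 0
  · right
    obtain ⟨a, ha, hmax⟩ := Finset.exists_max_image
      (Finset.univ.filter fun a => (h : (Δ[1] : SSet.{u}) _⦋d⦌) a = 0) id
      (by obtain ⟨a, ha⟩ := hex; exact ⟨a, by simpa using ha⟩)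
    simp only [Finset.mem_filter, Finset.mem_univ, true_and, id] at ha hmax
    -- The split value is the projection of the last vertex at height `0`.
    refine ⟨_, ((g : (Δ[n] : SSet.{u}) _⦋d⦌) a).isLt, fun b => ⟨fun hb => hg (hmax b hb), fun hb => ?_⟩⟩
    rcases le_total a b with hab | hab
    · exact hg hab
    · have := hh hab
      rw [hb, ha] at this
      exact absurd this (by decide)
  · left
    push Not at hex
    exact fun a => (h01 _).resolve_left (hex a)

/-- The edge `(n, 0) ⟶ (n, 1)` of the prism. -/
def prismLastEdge (n : ℕ) : (Δ[n] ⊗ Δ[1] : SSet.{u}) _⦋1⦌ :=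
  (stdSimplex.const n (Fin.last n) _, stdSimplex.edge 1 0 1 (by decide))

/-- The simplices are attached for `i = 0, …, n + 1`, along `Λ[n + 2, i + 1]`. Only `i = n + 1`
gives an outer horn, and its last edge is vertical over the last vertex. The base has positive
dimension, so this edge lies over the boundary and belongs to the initial stage. -/
lemma cartesianExtension_prism (n : ℕ) :
    CartesianExtension.{u} {prismLastEdge (n + 1)} (prismFiltration (n + 1) 0) ⊤ := by
  have hM : ({prismLastEdge.{u} (n + 1)} : Set _) ⊆ (prismFiltration (n + 1) 0).obj _ := by
    rintro _ rfl
    refine Or.inl ⟨0, fun a => ?_⟩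
    change Fin.last (n + 1) ≠ 0
    simp [Fin.ext_iff]
  have key (i : ℕ) (hi : i ≤ n + 1 + 1) : CartesianExtension.{u} {prismLastEdge (n + 1)}
      (prismFiltration (n + 1) 0) (prismFiltration (n + 1) i) := by
    induction i with
    | zero => exact .refl
    | succ i ih =>
      refine (ih (by omega)).trans ?_ hM
      have hpre := preimage_prismSimplex.{u} (n := n + 1) i (by omega)
      rw [← prismFiltration_sup_range i (by omega)]
      by_cases hin : i = n + 1
      · subst hin
        refine .attach_outer _ hpre ?_
        refine Set.mem_singleton_iff.2 (Prod.ext ?_ ?_)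
        · refine stdSimplex.ext (n := n + 1) (d := 1) _ _ fun a => ?_
          fin_cases a
          · change prismProj (n + 1) (n + 1) le_rfl (Fin.last (n + 1)).castSucc = Fin.last (n + 1)
            ext
            rw [prismProj_val]
            simp
          · change prismProj (n + 1) (n + 1) le_rfl (Fin.last (n + 2)) = Fin.last (n + 1)
            ext
            rw [prismProj_val]
            simp
        · refine stdSimplex.ext (n := 1) (d := 1) _ _ fun a => ?_
          fin_cases a
          · exact (prismHeight_eq_zero_iff _ _).2 le_rfl
          · exact (prismHeight_eq_one_iff _ _).2 (Nat.lt_succ_self _)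
      · exact .attach_inner (by simp [Fin.lt_def]) (by simp [Fin.lt_def]; omega) _ hpre
  rw [← prismFiltration_eq_top]
  exact key _ le_rfl

end

end SSet

/-!
### Lifting properties for pushout products with a cylinder
-/

namespace FunctorialCylinder

variable {C : Type u} [Category.{v} C] (Z : FunctorialCylinder C)

/-- The lifting property with respect to `∂₁ ⊠ i`, stated without pushouts. -/
def LiftsOne {X Y K L : C} (q : X ⟶ Y) (i : K ⟶ L) : Prop :=
  ∀ (a : Z.I.obj K ⟶ X) (w : L ⟶ X) (b : Z.I.obj L ⟶ Y), Z.d₁.app K ≫ a = i ≫ w →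
    a ≫ q = Z.I.map i ≫ b → w ≫ q = Z.d₁.app L ≫ b →
    ∃ l : Z.I.obj L ⟶ X, Z.I.map i ≫ l = a ∧ Z.d₁.app L ≫ l = w ∧ l ≫ q = b

/-- The lifting property with respect to `∂I ⊠ i`, stated without pushouts. -/
def LiftsBoundary {X Y K L : C} (q : X ⟶ Y) (i : K ⟶ L) : Prop :=
  ∀ (a : Z.I.obj K ⟶ X) (w₀ w₁ : L ⟶ X) (b : Z.I.obj L ⟶ Y), Z.d₀.app K ≫ a = i ≫ w₀ →
    Z.d₁.app K ≫ a = i ≫ w₁ → a ≫ q = Z.I.map i ≫ b → w₀ ≫ q = Z.d₀.app L ≫ b →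
    w₁ ≫ q = Z.d₁.app L ≫ b →
    ∃ l : Z.I.obj L ⟶ X, Z.I.map i ≫ l = a ∧ Z.d₀.app L ≫ l = w₀ ∧ Z.d₁.app L ≫ l = w₁ ∧ l ≫ q = b

lemma hasLiftingProperty_boxOne_iff [HasPushouts C] {X Y K L : C} (q : X ⟶ Y) (i : K ⟶ L) :
    HasLiftingProperty (Z.boxOne i) q ↔ Z.LiftsOne q i := by
  have e₁ : pushout.inl _ _ ≫ Z.boxOne i = Z.I.map i := pushout.inl_desc _ _ _
  have e₂ : pushout.inr _ _ ≫ Z.boxOne i = Z.d₁.app L := pushout.inr_desc _ _ _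
  constructor
  · intro h a w b h₁ h₂ h₃
    have sq : CommSq (pushout.desc a w h₁) (Z.boxOne i) q b := ⟨by
      apply pushout.hom_ext
      · rw [pushout.inl_desc_assoc, h₂, reassoc_of% e₁]
      · rw [pushout.inr_desc_assoc, h₃, reassoc_of% e₂]⟩
    refine ⟨sq.lift, ?_, ?_, sq.fac_right⟩
    · rw [← e₁, Category.assoc, sq.fac_left, pushout.inl_desc]
    · rw [← e₂, Category.assoc, sq.fac_left, pushout.inr_desc]
  · intro h
    refine ⟨fun {f b} sq => ?_⟩
    obtain ⟨l, hl₁, hl₂, hl₃⟩ := h (pushout.inl _ _ ≫ f) (pushout.inr _ _ ≫ f) b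
      (by rw [← Category.assoc, ← Category.assoc, pushout.condition])
      (by rw [Category.assoc, sq.w, reassoc_of% e₁]) (by rw [Category.assoc, sq.w, reassoc_of% e₂])
    refine ⟨⟨⟨l, ?_, hl₃⟩⟩⟩
    apply pushout.hom_ext
    · rw [reassoc_of% e₁, hl₁]
    · rw [reassoc_of% e₂, hl₂]

lemma hasLiftingProperty_boxBoundary_iff [HasPushouts C] [HasBinaryCoproducts C] {X Y K L : C}
    (q : X ⟶ Y) (i : K ⟶ L) :
    HasLiftingProperty (Z.boxBoundary i) q ↔ Z.LiftsBoundary q i := by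
  have e₁ : pushout.inl _ _ ≫ Z.boxBoundary i = Z.I.map i := pushout.inl_desc _ _ _
  have e₂ : pushout.inr _ _ ≫ Z.boxBoundary i = Z.boundary L := pushout.inr_desc _ _ _
  have e₃ (K : C) : coprod.inl ≫ Z.boundary K = Z.d₀.app K := coprod.inl_desc _ _
  have e₄ (K : C) : coprod.inr ≫ Z.boundary K = Z.d₁.app K := coprod.inr_desc _ _
  constructor
  · intro h a w₀ w₁ b h₀ h₁ h₂ h₃ h₄
    have sq : CommSq (pushout.desc a (coprod.desc w₀ w₁) (by
        apply coprod.hom_ext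
        · rw [reassoc_of% (e₃ K), coprod.inl_map_assoc, coprod.inl_desc]
          exact h₀
        · rw [reassoc_of% (e₄ K), coprod.inr_map_assoc, coprod.inr_desc]
          exact h₁)) (Z.boxBoundary i) q b := ⟨by
      apply pushout.hom_ext
      · rw [pushout.inl_desc_assoc, h₂, reassoc_of% e₁]
      · rw [pushout.inr_desc_assoc, reassoc_of% e₂]
        apply coprod.hom_ext
        · rw [reassoc_of% (e₃ L), coprod.inl_desc_assoc]
          exact h₃
        · rw [reassoc_of% (e₄ L), coprod.inr_desc_assoc]
          exact h₄⟩
    refine ⟨sq.lift, ?_, ?_, ?_, sq.fac_right⟩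
    · rw [← e₁, Category.assoc, sq.fac_left, pushout.inl_desc]
    · rw [← e₃, ← e₂, Category.assoc, Category.assoc, sq.fac_left, pushout.inr_desc, coprod.inl_desc]
    · rw [← e₄, ← e₂, Category.assoc, Category.assoc, sq.fac_left, pushout.inr_desc, coprod.inr_desc]
  · intro h
    refine ⟨fun {f b} sq => ?_⟩
    obtain ⟨l, hl₁, hl₂, hl₃, hl₄⟩ := h (pushout.inl _ _ ≫ f) (coprod.inl ≫ pushout.inr _ _ ≫ f)
      (coprod.inr ≫ pushout.inr _ _ ≫ f) b
      (by rw [← e₃, Category.assoc, pushout.condition_assoc, coprod.inl_map_assoc])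
      (by rw [← e₄, Category.assoc, pushout.condition_assoc, coprod.inr_map_assoc])
      (by rw [Category.assoc, sq.w, reassoc_of% e₁])
      (by rw [Category.assoc, Category.assoc, sq.w, reassoc_of% e₂, ← e₃, Category.assoc])
      (by rw [Category.assoc, Category.assoc, sq.w, reassoc_of% e₂, ← e₄, Category.assoc])
    refine ⟨⟨⟨l, ?_, hl₄⟩⟩⟩
    apply pushout.hom_ext
    · rw [reassoc_of% e₁, hl₁]
    · rw [reassoc_of% e₂]
      apply coprod.hom_ext
      · rw [reassoc_of% (e₃ L)]
        exact hl₂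
      · rw [reassoc_of% (e₄ L)]
        exact hl₃

end FunctorialCylinder

/-! ### Monomorphisms of simplicial sets and of marked simplicial sets. -/

namespace SSet

open MorphismProperty modelCategoryQuillen

attribute [local instance] Cardinal.fact_isRegular_aleph0 Cardinal.orderBotAleph0OrdToType

/-- Small object argument: the boundary inclusions have finitely presentable domains and the same
right lifting class as the monomorphisms, and monomorphisms are stable under all cell operations and
retracts. It later bounds the saturation of `anodyneGenerators`. -/
lemma llp_rlp_monomorphisms :
    (monomorphisms SSet.{u}).rlp.llp = monomorphisms SSet.{u} := by
  have : MorphismProperty.IsSmall.{u} I.{u} := isSmall_ofHoms ..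
  have : IsCardinalForSmallObjectArgument I.{u} Cardinal.aleph0.{u} :=
    { preservesColimit := fun {A B X Y} i hi f hf => by
        have : IsFinitelyPresentable.{u} A := by
          obtain ⟨n⟩ := hi
          infer_instance
        infer_instance }
  have : HasSmallObjectArgument.{u} I.{u} := ⟨.aleph0, inferInstance, inferInstance, inferInstance⟩
  refine le_antisymm ?_ (le_llp_rlp _)
  rw [rlp_monomorphisms, llp_rlp_of_hasSmallObjectArgument]
  trans (transfiniteCompositions.{u} (coproducts.{u} (monomorphisms SSet.{u})).pushouts).retracts
  · apply retracts_monotone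
    apply transfiniteCompositions_monotone
    apply pushouts_monotone
    apply coproducts_monotone
    exact I_le_monomorphisms
  · rw [retracts_le_iff, transfiniteCompositions_le_iff, pushouts_le_iff]
    have : IsStableUnderCoproducts.{u} (monomorphisms SSet.{u}) := inferInstance
    rw [coproducts_le_iff]

end SSet

namespace MarkedSSet

/-- The functor `K ↦ K^♯`. -/
@[simps]
def sharpFunctor : SSet.{u} ⥤ MarkedSSet.{u} where
  obj := sharp
  map f := ⟨f, fun _ _ => Set.mem_univ _⟩

/-- The functor `K ↦ K^♯` is right adjoint to the forgetful functor. -/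
def forgetAdjunction : forget.{u} ⊣ sharpFunctor :=
  Adjunction.mkOfHomEquiv
    { homEquiv X K :=
        { toFun f := toSharp f
          invFun f := f.hom } }

instance : PreservesColimits forget.{u} := forgetAdjunction.leftAdjoint_preservesColimits

lemma eq_or_eq_of_isPushout {K L M P : MarkedSSet.{u}} {f : K ⟶ L} {g : K ⟶ M} {l : L ⟶ P}
    {r : M ⟶ P} (h : IsPushout f g l r) {d : SimplexCategoryᵒᵖ} (x : P.toSSet.obj d) :
    (∃ y, l.hom.app d y = x) ∨ ∃ y, r.hom.app d y = x :=
  Types.eq_or_eq_of_isPushout ((h.map forget).map ((evaluation _ _).obj d)) x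

lemma eq_or_eq_of_coprod {K L : MarkedSSet.{u}} {d : SimplexCategoryᵒᵖ}
    (x : (K ⨿ L).toSSet.obj d) :
    (∃ y, (coprod.inl : K ⟶ K ⨿ L).hom.app d y = x) ∨
      ∃ y, (coprod.inr : L ⟶ K ⨿ L).hom.app d y = x := by
  have h : IsPushout (initial.to K) (initial.to L) coprod.inl coprod.inr :=
    .of_is_coproduct' (coprodIsCoprod K L) initialIsInitial
  exact eq_or_eq_of_isPushout h x

lemma monos_iff {K L : MarkedSSet.{u}} (i : K ⟶ L) :
    monos i ↔ ∀ d, Function.Injective (i.hom.app d) := by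
  change Mono i.hom ↔ _
  rw [NatTrans.mono_iff_mono_app]
  simp only [mono_iff_injective]

/-- For maps out of a pushout or coproduct: once each part is handled, only coincidences between the
two parts need an argument. -/
lemma injective_of_jointly_surjective {α β γ δ : Type*} {l : α → γ} {r : β → γ} {f : γ → δ}
    (h : ∀ x, (∃ y, l y = x) ∨ ∃ y, r y = x) (hl : ∀ x y, f (l x) = f (l y) → l x = l y)
    (hr : ∀ x y, f (r x) = f (r y) → r x = r y) (hlr : ∀ x y, f (l x) = f (r y) → l x = r y) :
    Function.Injective f := by
  intro x y hxy
  obtain ⟨x, rfl⟩ | ⟨x, rfl⟩ := h x <;> obtain ⟨y, rfl⟩ | ⟨y, rfl⟩ := h y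
  · exact hl _ _ hxy
  · exact hlr _ _ hxy
  · exact (hlr _ _ hxy.symm).symm
  · exact hr _ _ hxy

lemma app_app_of_comp_eq {K L M : MarkedSSet.{u}} {f : K ⟶ L} {g : L ⟶ M} {h : K ⟶ M}
    (e : f ≫ g = h) {d : SimplexCategoryᵒᵖ} (x : K.toSSet.obj d) :
    g.hom.app d (f.hom.app d x) = h.hom.app d x :=
  ConcreteCategory.congr_hom (congr_app (congrArg Hom.hom e) d) x

lemma monos_boxOne {K L : MarkedSSet.{u}} {i : K ⟶ L} (hi : monos i) : monos (cylinder.boxOne i) := by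
  rw [monos_iff] at hi ⊢
  intro d
  have e₁ (x : (K.prod (sharp Δ[1])).toSSet.obj d) := app_app_of_comp_eq (pushout.inl_desc
    (cylinder.I.map i) (cylinder.d₁.app L) (cylinder.d₁.naturality i).symm) x
  have e₂ (x : L.toSSet.obj d) := app_app_of_comp_eq (pushout.inr_desc
    (cylinder.I.map i) (cylinder.d₁.app L) (cylinder.d₁.naturality i).symm) x
  refine injective_of_jointly_surjective (eq_or_eq_of_isPushout (IsPushout.of_hasPushout _ _))
    (fun x y h => ?_) (fun x y h => ?_) (fun x y h => ?_)
  · have h' := (e₁ x).symm.trans (h.trans (e₁ y))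
    obtain ⟨x, ε⟩ := x
    obtain ⟨y, ε'⟩ := y
    obtain rfl : ε = ε' := congrArg Prod.snd h'
    obtain rfl : x = y := hi d (congrArg Prod.fst h')
    rfl
  · have h' := (e₂ x).symm.trans (h.trans (e₂ y))
    exact congrArg _ (congrArg Prod.fst h')
  · have h' := (e₁ x).symm.trans (h.trans (e₂ y))
    obtain ⟨x, ε⟩ := x
    obtain rfl : ε = _ := congrArg Prod.snd h'
    obtain rfl : i.hom.app d x = y := congrArg Prod.fst h'
    exact ConcreteCategory.congr_hom (congr_app (congrArg Hom.hom
      (pushout.condition (f := cylinder.d₁.app K) (g := i))) d) x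

lemma monos_boundary (K : MarkedSSet.{u}) : monos (cylinder.boundary K) := by
  rw [monos_iff]
  intro d
  have e₁ (x : K.toSSet.obj d) := app_app_of_comp_eq
    (coprod.inl_desc (cylinder.d₀.app K) (cylinder.d₁.app K)) x
  have e₂ (x : K.toSSet.obj d) := app_app_of_comp_eq
    (coprod.inr_desc (cylinder.d₀.app K) (cylinder.d₁.app K)) x
  refine injective_of_jointly_surjective eq_or_eq_of_coprod
    (fun x y h => ?_) (fun x y h => ?_) (fun x y h => ?_)
  · have h' := (e₁ x).symm.trans (h.trans (e₁ y))
    exact congrArg _ (congrArg Prod.fst h')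
  · have h' := (e₂ x).symm.trans (h.trans (e₂ y))
    exact congrArg _ (congrArg Prod.fst h')
  · have h' := (e₁ x).symm.trans (h.trans (e₂ y))
    obtain ⟨⟨d⟩⟩ := d
    have h₂ := DFunLike.congr_fun (F := (Δ[1] : SSet.{u}) _⦋d⦌) (congrArg Prod.snd h') 0
    exact absurd h₂ (by change ¬ (0 : Fin 2) = 1; decide)

lemma monos_boxBoundary {K L : MarkedSSet.{u}} {i : K ⟶ L} (hi : monos i) :
    monos (cylinder.boxBoundary i) := by
  have hL := monos_boundary L
  rw [monos_iff] at hi hL ⊢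
  intro d
  have e₁ (x : (K.prod (sharp Δ[1])).toSSet.obj d) := app_app_of_comp_eq (pushout.inl_desc
    (cylinder.I.map i) (cylinder.boundary L) (cylinder.boundary_naturality i)) x
  have e₂ (x : (L ⨿ L).toSSet.obj d) := app_app_of_comp_eq (pushout.inr_desc
    (cylinder.I.map i) (cylinder.boundary L) (cylinder.boundary_naturality i)) x
  refine injective_of_jointly_surjective (eq_or_eq_of_isPushout (IsPushout.of_hasPushout _ _))
    (fun x y h => ?_) (fun x y h => ?_) (fun x y h => ?_)
  · have h' := (e₁ x).symm.trans (h.trans (e₁ y))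
    obtain ⟨x, ε⟩ := x
    obtain ⟨y, ε'⟩ := y
    obtain rfl : ε = ε' := congrArg Prod.snd h'
    obtain rfl : x = y := hi d (congrArg Prod.fst h')
    rfl
  · have h' := (e₂ x).symm.trans (h.trans (e₂ y))
    exact congrArg _ (hL d h')
  · have h' := (e₁ x).symm.trans (h.trans (e₂ y))
    have w (z) := ConcreteCategory.congr_hom (congr_app (congrArg Hom.hom
      (pushout.condition (f := cylinder.boundary K) (g := coprod.map i i))) d) z
    obtain ⟨x, ε⟩ := x
    obtain ⟨y, rfl⟩ | ⟨y, rfl⟩ := eq_or_eq_of_coprod y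
    · have h₃ := h'.trans (app_app_of_comp_eq
        (coprod.inl_desc (cylinder.d₀.app L) (cylinder.d₁.app L)) y)
      obtain rfl : ε = _ := congrArg Prod.snd h₃
      obtain rfl : i.hom.app d x = y := congrArg Prod.fst h₃
      have h₄ := app_app_of_comp_eq (coprod.inl_map i i) x
      have h₅ := app_app_of_comp_eq (coprod.inl_desc (cylinder.d₀.app K) (cylinder.d₁.app K)) x
      exact (congrArg _ h₅.symm).trans ((w _).trans (congrArg _ h₄))
    · have h₃ := h'.trans (app_app_of_comp_eq
        (coprod.inr_desc (cylinder.d₀.app L) (cylinder.d₁.app L)) y)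
      obtain rfl : ε = _ := congrArg Prod.snd h₃
      obtain rfl : i.hom.app d x = y := congrArg Prod.fst h₃
      have h₄ := app_app_of_comp_eq (coprod.inr_map i i) x
      have h₅ := app_app_of_comp_eq (coprod.inr_desc (cylinder.d₀.app K) (cylinder.d₁.app K)) x
      exact (congrArg _ h₅.symm).trans ((w _).trans (congrArg _ h₄))

end MarkedSSet

/-!
### The path object of a marked simplicial set
-/

namespace MarkedSSet

/-- The functor `K ↦ K^♭`. -/
@[simps]
def flatFunctor : SSet.{u} ⥤ MarkedSSet.{u} where
  obj := flat
  map f := ofFlat f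

/-- The simplicial set underlying the path object: its `n`-simplices are the maps
`I ⊗ (Δ^n)^♭ ⟶ X`. -/
noncomputable abbrev pathSSet (X : MarkedSSet.{u}) : SSet.{u} :=
  (SSet.stdSimplex ⋙ flatFunctor ⋙ cylinder.I).op ⋙ yoneda.obj X

/-- Every edge of `Δ[1]` is degenerate or the fundamental one, so a single marked edge is the same
as a map out of `(Δ^1)^♯`. -/
lemma app_mem_marked_of_yonedaEquiv_mem {X : MarkedSSet.{u}} {f : Δ[1] ⟶ X.toSSet}
    (hf : SSet.yonedaEquiv f ∈ X.marked) (e : (Δ[1] : SSet.{u}) _⦋1⦌) : f.app _ e ∈ X.marked := by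
  by_cases h : e 0 = e 1
  · have : e = (Δ[1] : SSet.{u}).σ 0 (SSet.stdSimplex.const 1 (e 0) _) := by
      refine SSet.stdSimplex.ext (n := 1) (d := 1) _ _ (fun i => ?_)
      fin_cases i
      · rfl
      · exact h.symm
    rw [this]
    exact map_degenerate_mem X f _
  · have h₁ := SSet.stdSimplex.monotone_apply e (Fin.zero_le 1)
    have : e = SSet.yonedaEquiv (𝟙 _) := by
      refine SSet.stdSimplex.ext (n := 1) (d := 1) _ _ (fun i => ?_)
      change e i = i
      have h₂ : (e 0).val < (e 1).val := lt_of_le_of_ne h₁ (fun h' => h (Fin.ext h'))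
      fin_cases i
      · change e 0 = 0
        ext
        have := (e 1).isLt
        simp only [Fin.val_zero]
        omega
      · change e 1 = 1
        ext
        have := (e 1).isLt
        simp only [Fin.val_one]
        omega
    rw [this]
    exact hf

/-- The path object of `X`: an edge is marked if all the edges of the corresponding square
are marked. -/
noncomputable def path (X : MarkedSSet.{u}) : MarkedSSet.{u} where
  toSSet := X.pathSSet
  marked := Set.ofPred (fun f : (cylinder.I.obj (flat Δ[1]) ⟶ X) =>
    ∀ e : (Δ[1] ⊗ Δ[1] : SSet.{u}) _⦋1⦌, f.hom.app _ e ∈ X.marked)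
  degenerate_mem f e := by
    refine f.map_marked _ ⟨?_, Set.mem_univ _⟩
    change ∃ x, _ = _
    refine ⟨SSet.stdSimplex.const 0 0 _, ?_⟩
    refine SSet.stdSimplex.ext (n := 0) (d := 1) _ _ (fun i => Subsingleton.elim (α := Fin 1) _ _)

variable {K L X Y : MarkedSSet.{u}}

lemma mem_path_marked_iff (f : cylinder.I.obj (flat Δ[1]) ⟶ X) :
    f ∈ (path X).marked ↔ ∀ e : (Δ[1] ⊗ Δ[1] : SSet.{u}) _⦋1⦌, f.hom.app _ e ∈ X.marked := Iff.rfl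

/-- The map `K ⟶ path X` corresponding to `I ⊗ K ⟶ X`. -/
noncomputable def curry (h : cylinder.I.obj K ⟶ X) : K ⟶ path X where
  hom :=
    { app d := ↾ fun x => cylinder.I.map (ofFlat (SSet.yonedaEquiv.symm x)) ≫ h
      naturality d d' φ := by
        ext x
        change cylinder.I.map (ofFlat (SSet.yonedaEquiv.symm (K.toSSet.map φ x))) ≫ h =
          cylinder.I.map (ofFlat (SSet.stdSimplex.map φ.unop)) ≫
            cylinder.I.map (ofFlat (SSet.yonedaEquiv.symm x)) ≫ h
        rw [← Category.assoc, ← Functor.map_comp]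
        congr 2
        exact hom_ext (SSet.yonedaEquiv_symm_naturality_left φ.unop x).symm }
  map_marked x hx := by
    -- A marked edge of `K` is a map from `(Δ^1)^♯`, and every edge of `I ⊗ (Δ^1)^♯` is marked; this
    -- explains the marking of `path X`.
    refine (mem_path_marked_iff _).2 fun e => ?_
    refine h.map_marked _ ⟨?_, Set.mem_univ _⟩
    exact app_mem_marked_of_yonedaEquiv_mem (X := K) (by rwa [Equiv.apply_symm_apply]) e.1

/-- The map `I ⊗ K ⟶ X` corresponding to `K ⟶ path X`. -/
noncomputable def uncurry (g : K ⟶ path X) : cylinder.I.obj K ⟶ X where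
  hom :=
    { app d := ↾ fun x =>
        (show cylinder.I.obj (flat (SSet.stdSimplex.obj d.unop)) ⟶ X from g.hom.app d x.1).hom.app d
          (SSet.yonedaEquiv (𝟙 _), x.2)
      naturality d d' φ := by
        ext x
        have h₁ := ConcreteCategory.congr_hom (g.hom.naturality φ) x.1
        let f : cylinder.I.obj (flat (SSet.stdSimplex.obj d.unop)) ⟶ X := g.hom.app d x.1
        let f' : cylinder.I.obj (flat (SSet.stdSimplex.obj d'.unop)) ⟶ X :=
          g.hom.app d' (K.toSSet.map φ x.1)
        have h₁ : f' = cylinder.I.map (ofFlat (SSet.stdSimplex.map φ.unop)) ≫ f := h₁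
        change f'.hom.app d' (SSet.yonedaEquiv (𝟙 _), (Δ[1] : SSet.{u}).map φ x.2) =
          X.toSSet.map φ (f.hom.app d (SSet.yonedaEquiv (𝟙 _), x.2))
        rw [h₁]
        have h₂ := ConcreteCategory.congr_hom (f.hom.naturality φ)
          ((SSet.yonedaEquiv (𝟙 _), x.2) : (SSet.stdSimplex.obj d.unop ⊗ Δ[1] : SSet.{u}).obj d)
        refine Eq.trans ?_ h₂
        refine congrArg (f.hom.app d') (Prod.ext ?_ rfl)
        change (SSet.stdSimplex.map φ.unop).app d' (SSet.yonedaEquiv (𝟙 _)) =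
          (SSet.stdSimplex.obj d.unop).map φ (SSet.yonedaEquiv (𝟙 _))
        rfl }
  map_marked x hx := (mem_path_marked_iff _).1 (g.map_marked x.1 hx.1) _

lemma uncurry_curry (h : cylinder.I.obj K ⟶ X) : uncurry (curry h) = h := by
  apply hom_ext
  ext d x
  change h.hom.app d ((SSet.yonedaEquiv.symm x.1).app d (SSet.yonedaEquiv (𝟙 _)), x.2) = h.hom.app d x
  refine congrArg (h.hom.app d) (Prod.ext ?_ rfl)
  change SSet.yonedaEquiv (SSet.yonedaEquiv.symm x.1) = x.1
  rw [Equiv.apply_symm_apply]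

lemma curry_uncurry (g : K ⟶ path X) : curry (uncurry g) = g := by
  apply hom_ext
  ext d x
  apply hom_ext (X := cylinder.I.obj (flat (SSet.stdSimplex.obj d.unop))) (Y := X)
  let f : cylinder.I.obj (flat (SSet.stdSimplex.obj d.unop)) ⟶ X := g.hom.app d x
  ext d' ⟨y, ε⟩
  have h₁ := ConcreteCategory.congr_hom (g.hom.naturality (SSet.stdSimplex.objEquiv y).op) x
  change (show cylinder.I.obj (flat (SSet.stdSimplex.obj d'.unop)) ⟶ X from
    g.hom.app d' ((SSet.yonedaEquiv.symm x).app d' y)).hom.app d' (SSet.yonedaEquiv (𝟙 _), ε) =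
    f.hom.app d' (y, ε)
  have h₂ : (g.hom.app d' ((SSet.yonedaEquiv.symm x).app d' y) :
      cylinder.I.obj (flat (SSet.stdSimplex.obj d'.unop)) ⟶ X) =
      cylinder.I.map (ofFlat (SSet.stdSimplex.map (SSet.stdSimplex.objEquiv y))) ≫ f := h₁
  refine (congrArg (fun k : cylinder.I.obj (flat (SSet.stdSimplex.obj d'.unop)) ⟶ X =>
    k.hom.app d' (SSet.yonedaEquiv (𝟙 _), ε)) h₂).trans ?_
  refine congrArg (f.hom.app d') (Prod.ext ?_ rfl)
  change SSet.yonedaEquiv (SSet.stdSimplex.map (SSet.stdSimplex.objEquiv y)) = y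
  rw [SSet.yonedaEquiv_map]
  exact Equiv.symm_apply_apply _ y

/-- The bijection between maps `I ⊗ K ⟶ X` and maps `K ⟶ path X`. -/
noncomputable def curryEquiv : (cylinder.I.obj K ⟶ X) ≃ (K ⟶ path X) where
  toFun := curry
  invFun := uncurry
  left_inv := uncurry_curry
  right_inv := curry_uncurry

lemma curry_map_comp (i : K ⟶ L) (h : cylinder.I.obj L ⟶ X) :
    curry (cylinder.I.map i ≫ h) = i ≫ curry h := by
  apply hom_ext
  ext d x
  change cylinder.I.map (ofFlat (SSet.yonedaEquiv.symm x)) ≫ cylinder.I.map i ≫ h =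
    cylinder.I.map (ofFlat (SSet.yonedaEquiv.symm (i.hom.app d x))) ≫ h
  rw [← Category.assoc, ← Functor.map_comp]
  congr 2
  exact hom_ext (SSet.yonedaEquiv_symm_comp _ _)

/-- The map on path objects induced by a map. -/
noncomputable def pathMap (q : X ⟶ Y) : path X ⟶ path Y :=
  curry (uncurry (𝟙 _) ≫ q)

lemma uncurry_comp (i : K ⟶ L) (g : L ⟶ path X) :
    uncurry (i ≫ g) = cylinder.I.map i ≫ uncurry g := by
  apply curryEquiv.injective
  change curry _ = curry _
  rw [curry_uncurry, curry_map_comp, curry_uncurry]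

lemma curry_comp (h : cylinder.I.obj K ⟶ X) (q : X ⟶ Y) : curry (h ≫ q) = curry h ≫ pathMap q := by
  rw [pathMap, ← curry_map_comp, ← Category.assoc, ← uncurry_comp, Category.comp_id, uncurry_curry]

/-- The evaluation of a path at the end point `0`. -/
noncomputable def pathEv₀ (X : MarkedSSet.{u}) : path X ⟶ X :=
  cylinder.d₀.app (path X) ≫ uncurry (𝟙 (path X))

/-- The evaluation of a path at the end point `1`. -/
noncomputable def pathEv₁ (X : MarkedSSet.{u}) : path X ⟶ X :=
  cylinder.d₁.app (path X) ≫ uncurry (𝟙 (path X))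

lemma comp_pathEv₀ (g : K ⟶ path X) : g ≫ pathEv₀ X = cylinder.d₀.app K ≫ uncurry g := by
  have := cylinder.d₀.naturality g
  dsimp only [Functor.id_map] at this
  rw [pathEv₀, reassoc_of% this, ← uncurry_comp, Category.comp_id]

lemma comp_pathEv₁ (g : K ⟶ path X) : g ≫ pathEv₁ X = cylinder.d₁.app K ≫ uncurry g := by
  have := cylinder.d₁.naturality g
  dsimp only [Functor.id_map] at this
  rw [pathEv₁, reassoc_of% this, ← uncurry_comp, Category.comp_id]

lemma uncurry_comp_pathMap (g : K ⟶ path X) (q : X ⟶ Y) :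
    uncurry (g ≫ pathMap q) = uncurry g ≫ q := by
  apply curryEquiv.injective
  change curry _ = curry _
  rw [curry_uncurry, curry_comp, curry_uncurry]

lemma pathMap_pathEv₀ (q : X ⟶ Y) : pathMap q ≫ pathEv₀ Y = pathEv₀ X ≫ q := by
  rw [comp_pathEv₀, ← Category.id_comp (pathMap q), uncurry_comp_pathMap, pathEv₀, Category.assoc]

lemma pathMap_pathEv₁ (q : X ⟶ Y) : pathMap q ≫ pathEv₁ Y = pathEv₁ X ≫ q := by
  rw [comp_pathEv₁, ← Category.id_comp (pathMap q), uncurry_comp_pathMap, pathEv₁, Category.assoc]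

/-- The fibre product, where an edge is marked if both projections are. -/
noncomputable def fiberProduct {X Y S : MarkedSSet.{u}} (f : X ⟶ S) (g : Y ⟶ S) :
    MarkedSSet.{u} where
  toSSet := Limits.pullback f.hom g.hom
  marked := { e | (pullback.fst f.hom g.hom).app _ e ∈ X.marked ∧
    (pullback.snd f.hom g.hom).app _ e ∈ Y.marked }
  degenerate_mem x := ⟨map_degenerate_mem X _ x, map_degenerate_mem Y _ x⟩

lemma isPullback_fiberProduct {X Y S : MarkedSSet.{u}} (f : X ⟶ S) (g : Y ⟶ S) :
    IsPullback (⟨pullback.fst f.hom g.hom, fun _ he => he.1⟩ : fiberProduct f g ⟶ X)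
      (⟨pullback.snd f.hom g.hom, fun _ he => he.2⟩ : fiberProduct f g ⟶ Y) f g where
  w := hom_ext pullback.condition
  isLimit' := ⟨PullbackCone.IsLimit.mk _
    (fun s => ⟨pullback.lift s.fst.hom s.snd.hom (congrArg Hom.hom s.condition), fun e he => by
      have h₁ := ConcreteCategory.congr_hom (congr_app
        (pullback.lift_fst s.fst.hom s.snd.hom (congrArg Hom.hom s.condition)) _) e
      have h₂ := ConcreteCategory.congr_hom (congr_app
        (pullback.lift_snd s.fst.hom s.snd.hom (congrArg Hom.hom s.condition)) _) e
      exact ⟨(congrArg (· ∈ _) h₁).mpr (s.fst.map_marked e he),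
        (congrArg (· ∈ _) h₂).mpr (s.snd.map_marked e he)⟩⟩)
    (fun s => hom_ext (pullback.lift_fst _ _ _)) (fun s => hom_ext (pullback.lift_snd _ _ _))
    (fun s m h₁ h₂ => hom_ext (pullback.hom_ext
      ((congrArg Hom.hom h₁).trans (pullback.lift_fst _ _ _).symm)
      ((congrArg Hom.hom h₂).trans (pullback.lift_snd _ _ _).symm)))⟩

instance : HasPullbacks MarkedSSet.{u} := by
  have (X Y S : MarkedSSet.{u}) (f : X ⟶ S) (g : Y ⟶ S) : HasLimit (cospan f g) :=
    (isPullback_fiberProduct f g).hasPullback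
  exact hasPullbacks_of_hasLimit_cospan _

/-- The map `X^I ⟶ X ×_Y Y^I` given by the evaluation at `1`. -/
noncomputable def pathOne (q : X ⟶ Y) : path X ⟶ pullback q (pathEv₁ Y) :=
  pullback.lift (pathEv₁ X) (pathMap q) (pathMap_pathEv₁ q).symm

/-- By adjunction, lifting `∂₁ ⊠ i` against `q` becomes an ordinary lifting property of `i`, which
can be tested on generators. `hasLiftingProperty_pathBoundary_iff` plays the same role for `∂I ⊠ i`.
-/
lemma hasLiftingProperty_pathOne_iff (q : X ⟶ Y) (i : K ⟶ L) :
    HasLiftingProperty i (pathOne q) ↔ cylinder.LiftsOne q i := by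
  have e₁ : pathOne q ≫ pullback.fst _ _ = pathEv₁ X := pullback.lift_fst _ _ _
  have e₂ : pathOne q ≫ pullback.snd _ _ = pathMap q := pullback.lift_snd _ _ _
  constructor
  · intro h a w b h₁ h₂ h₃
    have sq : CommSq (curry a) i (pathOne q) (pullback.lift w (curry b) (by
        rw [h₃, comp_pathEv₁, uncurry_curry])) := ⟨by
      apply pullback.hom_ext
      · rw [Category.assoc, Category.assoc, e₁, pullback.lift_fst, comp_pathEv₁, uncurry_curry]
        exact h₁
      · rw [Category.assoc, Category.assoc, e₂, pullback.lift_snd, ← curry_comp, h₂,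
          curry_map_comp]⟩
    refine ⟨uncurry sq.lift, ?_, ?_, ?_⟩
    · rw [← uncurry_comp, sq.fac_left, uncurry_curry]
    · refine (comp_pathEv₁ _).symm.trans ?_
      rw [← e₁, ← Category.assoc, sq.fac_right, pullback.lift_fst]
    · rw [← uncurry_comp_pathMap, ← e₂, ← Category.assoc, sq.fac_right, pullback.lift_snd,
        uncurry_curry]
  · intro h
    refine ⟨fun {f g} sq => ?_⟩
    obtain ⟨l, hl₁, hl₂, hl₃⟩ := h (uncurry f) (g ≫ pullback.fst _ _) (uncurry (g ≫ pullback.snd _ _))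
      ((comp_pathEv₁ _).symm.trans (by rw [← e₁, ← Category.assoc, sq.w, Category.assoc]))
      (by rw [← uncurry_comp_pathMap, ← e₂, ← Category.assoc, sq.w, Category.assoc, uncurry_comp])
      (by
        refine Eq.trans ?_ (comp_pathEv₁ _)
        rw [Category.assoc, pullback.condition, Category.assoc])
    refine ⟨⟨⟨curry l, ?_, ?_⟩⟩⟩
    · rw [← curry_map_comp, hl₁, curry_uncurry]
    · apply pullback.hom_ext
      · rw [Category.assoc, e₁, comp_pathEv₁, uncurry_curry]
        exact hl₂
      · rw [Category.assoc, e₂, ← curry_comp, hl₃, curry_uncurry]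

/-- The map `X^I ⟶ X^{∂I} ×_{Y^{∂I}} Y^I`. -/
noncomputable def pathBoundary (q : X ⟶ Y) :
    path X ⟶ pullback q (pullback.snd q (pathEv₁ Y) ≫ pathEv₀ Y) :=
  pullback.lift (pathEv₀ X) (pathOne q) (by
    rw [pathOne, pullback.lift_snd_assoc, pathMap_pathEv₀])

lemma hasLiftingProperty_pathBoundary_iff (q : X ⟶ Y) (i : K ⟶ L) :
    HasLiftingProperty i (pathBoundary q) ↔ cylinder.LiftsBoundary q i := by
  have e₀ : pathBoundary q ≫ pullback.fst _ _ = pathEv₀ X := pullback.lift_fst _ _ _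
  have e₁ : pathBoundary q ≫ pullback.snd _ _ ≫ pullback.fst _ _ = pathEv₁ X := by
    rw [pathBoundary, pullback.lift_snd_assoc, pathOne, pullback.lift_fst]
  have e₂ : pathBoundary q ≫ pullback.snd _ _ ≫ pullback.snd _ _ = pathMap q := by
    rw [pathBoundary, pullback.lift_snd_assoc, pathOne, pullback.lift_snd]
  constructor
  · intro h a w₀ w₁ b h₀ h₁ h₂ h₃ h₄
    have sq : CommSq (curry a) i (pathBoundary q) (pullback.lift w₀ (pullback.lift w₁ (curry b) (by
        rw [h₄, comp_pathEv₁, uncurry_curry])) (by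
        rw [pullback.lift_snd_assoc, h₃, comp_pathEv₀, uncurry_curry])) := ⟨by
      apply pullback.hom_ext
      · rw [Category.assoc, Category.assoc, e₀, pullback.lift_fst, comp_pathEv₀, uncurry_curry]
        exact h₀
      · apply pullback.hom_ext
        · rw [Category.assoc, Category.assoc, e₁, Category.assoc, Category.assoc,
            pullback.lift_snd_assoc, pullback.lift_fst, comp_pathEv₁, uncurry_curry]
          exact h₁
        · rw [Category.assoc, Category.assoc, e₂, Category.assoc, Category.assoc,
            pullback.lift_snd_assoc, pullback.lift_snd, ← curry_comp, h₂, curry_map_comp]⟩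
    refine ⟨uncurry sq.lift, ?_, ?_, ?_, ?_⟩
    · rw [← uncurry_comp, sq.fac_left, uncurry_curry]
    · refine (comp_pathEv₀ _).symm.trans ?_
      rw [← e₀, ← Category.assoc, sq.fac_right, pullback.lift_fst]
    · refine (comp_pathEv₁ _).symm.trans ?_
      rw [← e₁, ← Category.assoc, sq.fac_right, pullback.lift_snd_assoc, pullback.lift_fst]
    · rw [← uncurry_comp_pathMap, ← e₂, ← Category.assoc, sq.fac_right, pullback.lift_snd_assoc,
        pullback.lift_snd, uncurry_curry]
  · intro h
    refine ⟨fun {f g} sq => ?_⟩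
    obtain ⟨l, hl₁, hl₀, hl₂, hl₃⟩ := h (uncurry f) (g ≫ pullback.fst _ _)
      (g ≫ pullback.snd _ _ ≫ pullback.fst _ _) (uncurry (g ≫ pullback.snd _ _ ≫ pullback.snd _ _))
      ((comp_pathEv₀ _).symm.trans (by rw [← e₀, ← Category.assoc, sq.w, Category.assoc]))
      ((comp_pathEv₁ _).symm.trans (by rw [← e₁, ← Category.assoc, sq.w, Category.assoc]))
      (by rw [← uncurry_comp_pathMap, ← e₂, ← Category.assoc, sq.w, Category.assoc, uncurry_comp])
      (by
        refine Eq.trans ?_ (comp_pathEv₀ _)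
        rw [Category.assoc, pullback.condition, Category.assoc, Category.assoc])
      (by
        refine Eq.trans ?_ (comp_pathEv₁ _)
        rw [Category.assoc, Category.assoc, pullback.condition, Category.assoc, Category.assoc])
    refine ⟨⟨⟨curry l, ?_, ?_⟩⟩⟩
    · rw [← curry_map_comp, hl₁, curry_uncurry]
    · apply pullback.hom_ext
      · rw [Category.assoc, e₀, comp_pathEv₀, uncurry_curry]
        exact hl₀
      · apply pullback.hom_ext
        · rw [Category.assoc, Category.assoc, e₁, comp_pathEv₁, uncurry_curry, Category.assoc]
          exact hl₂
        · rw [Category.assoc, Category.assoc, e₂, ← curry_comp, hl₃, curry_uncurry, Category.assoc]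

end MarkedSSet

/-!
### A class of right anodyne extensions of marked simplicial sets
-/

namespace SSet

/-- A compatible functional relation defines a map of simplicial sets. -/
lemma Subcomplex.exists_hom_of_rel {T X : SSet.{u}} (S : T.Subcomplex)
    (R : ∀ d, T.obj d → X.obj d → Prop) (hex : ∀ d, ∀ y ∈ S.obj d, ∃ x, R d y x)
    (huniq : ∀ d y x x', R d y x → R d y x' → x = x')
    (hnat : ∀ (d d' : SimplexCategoryᵒᵖ) (φ : d ⟶ d') (y : T.obj d) (x : X.obj d), R d y x →
      R d' (T.map φ y) (X.map φ x)) :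
    ∃ f : (S : SSet.{u}) ⟶ X, ∀ d y hy, R d y (f.app d ⟨y, hy⟩) := by
  choose f hf using hex
  exact ⟨{ app d := ↾ fun y => f d y.1 y.2
           naturality d d' φ := by
             ext y
             exact huniq _ _ _ _ (hf _ _ _) (hnat _ _ _ _ _ (hf d y.1 y.2)) },
    fun d y hy => hf d y hy⟩

end SSet

namespace MarkedSSet

/-- The maps `(∂Δ^n)^♭ ⟶ (Δ^n)^♭`. -/
def boundaryFlat (n : ℕ) : flat (∂Δ[n] : SSet.{u}) ⟶ flat Δ[n] := ofFlat ∂Δ[n].ι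

/-- The map `(Δ^1)^♭ ⟶ (Δ^1)^♯`. -/
def edgeFlatSharp : flat (Δ[1] : SSet.{u}) ⟶ sharp Δ[1] := ofFlat (𝟙 _)

lemma monos_boundaryFlat (n : ℕ) : monos (boundaryFlat.{u} n) :=
  inferInstanceAs (Mono (∂Δ[n].ι : (∂Δ[n] : SSet.{u}) ⟶ Δ[n]))

lemma monos_edgeFlatSharp : monos edgeFlatSharp.{u} :=
  inferInstanceAs (Mono (𝟙 (Δ[1] : SSet.{u})))

variable {X Y K L : MarkedSSet.{u}}

/-- The boundary inclusions make the underlying map of `r` lift against all monomorphisms. Lifting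
against `(Δ^1)^♭ ⟶ (Δ^1)^♯` says that `r` reflects marked edges, so any underlying lift preserves
markings. -/
lemma hasLiftingProperty_of_boundaryFlat {V W : MarkedSSet.{u}} {r : V ⟶ W}
    (h₁ : ∀ n, HasLiftingProperty (boundaryFlat.{u} n) r)
    (h₂ : HasLiftingProperty edgeFlatSharp.{u} r) {i : K ⟶ L} (hi : monos i) :
    HasLiftingProperty i r := by
  have hr : (MorphismProperty.monomorphisms SSet.{u}).rlp r.hom := by
    rw [SSet.rlp_monomorphisms]
    rintro _ _ _ ⟨n⟩
    refine ⟨fun {f g} sq => ?_⟩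
    have sq' : CommSq (ofFlat (X := V) f) (boundaryFlat n) r (ofFlat (X := W) g) := ⟨hom_ext sq.w⟩
    exact ⟨⟨⟨sq'.lift.hom, congrArg Hom.hom sq'.fac_left, congrArg Hom.hom sq'.fac_right⟩⟩⟩
  have hmem (e : V.toSSet _⦋1⦌) (he : r.hom.app _ e ∈ W.marked) : e ∈ V.marked := by
    have sq : CommSq (ofFlat (SSet.yonedaEquiv.symm e) : flat Δ[1] ⟶ V) edgeFlatSharp r
        (⟨SSet.yonedaEquiv.symm (r.hom.app _ e), fun ε _ => app_mem_marked_of_yonedaEquiv_mem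
          (by rwa [Equiv.apply_symm_apply]) ε⟩ : sharp Δ[1] ⟶ W) :=
      ⟨hom_ext (SSet.yonedaEquiv_symm_comp e r.hom)⟩
    have := sq.lift.map_marked (SSet.yonedaEquiv (𝟙 _)) (Set.mem_univ _)
    have h₃ : sq.lift.hom = SSet.yonedaEquiv.symm e := congrArg Hom.hom sq.fac_left
    rw [h₃] at this
    have h₄ : (SSet.yonedaEquiv.symm e).app _ (SSet.yonedaEquiv (𝟙 _)) = e :=
      Equiv.apply_symm_apply SSet.yonedaEquiv e
    exact (congrArg (· ∈ V.marked) h₄).mp this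
  refine ⟨fun {f g} sq => ?_⟩
  have := hr i.hom hi
  have sq' : CommSq f.hom i.hom r.hom g.hom := ⟨congrArg Hom.hom sq.w⟩
  refine ⟨⟨⟨⟨sq'.lift, fun e he => hmem _ ?_⟩, hom_ext sq'.fac_left, hom_ext sq'.fac_right⟩⟩⟩
  have h₃ := ConcreteCategory.congr_hom (congr_app sq'.fac_right _) e
  exact (congrArg (· ∈ W.marked) h₃).mpr (g.map_marked e he)

lemma liftsOne_of_monos {q : X ⟶ Y} (h₁ : ∀ n, cylinder.LiftsOne q (boundaryFlat.{u} n))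
    (h₂ : cylinder.LiftsOne q edgeFlatSharp.{u}) {i : K ⟶ L} (hi : monos i) :
    cylinder.LiftsOne q i := by
  simp only [← hasLiftingProperty_pathOne_iff] at h₁ h₂ ⊢
  exact hasLiftingProperty_of_boundaryFlat h₁ h₂ hi

/-- Exchanging the two coordinates of `I ⊗ I ⊗ K`. -/
noncomputable def cylinderSwap (K : MarkedSSet.{u}) :
    cylinder.I.obj (cylinder.I.obj K) ⟶ cylinder.I.obj (cylinder.I.obj K) where
  hom := lift (lift (fst _ _ ≫ fst _ _) (snd _ _)) (fst _ _ ≫ snd _ _)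
  map_marked _ he := ⟨⟨he.1.1, he.2⟩, he.1.2⟩

lemma cylinderSwap_swap (K : MarkedSSet.{u}) : cylinderSwap K ≫ cylinderSwap K = 𝟙 _ := rfl

lemma cylinderSwap_naturality (i : K ⟶ L) :
    cylinder.I.map (cylinder.I.map i) ≫ cylinderSwap L =
      cylinderSwap K ≫ cylinder.I.map (cylinder.I.map i) := rfl

lemma d₀_cylinderSwap (K : MarkedSSet.{u}) :
    cylinder.d₀.app (cylinder.I.obj K) ≫ cylinderSwap K = cylinder.I.map (cylinder.d₀.app K) := rfl

lemma d₁_cylinderSwap (K : MarkedSSet.{u}) :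
    cylinder.d₁.app (cylinder.I.obj K) ≫ cylinderSwap K = cylinder.I.map (cylinder.d₁.app K) := rfl

lemma map_d₀_cylinderSwap (K : MarkedSSet.{u}) :
    cylinder.I.map (cylinder.d₀.app K) ≫ cylinderSwap K = cylinder.d₀.app (cylinder.I.obj K) := rfl

lemma map_d₁_cylinderSwap (K : MarkedSSet.{u}) :
    cylinder.I.map (cylinder.d₁.app K) ≫ cylinderSwap K = cylinder.d₁.app (cylinder.I.obj K) := rfl


/-- Exchanging the coordinates of `I ⊗ I` identifies `∂I ⊠ (∂₁ ⊠ i)` with `∂₁ ⊠ (∂I ⊠ i)`, and `∂I ⊠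
i` is again a monomorphism. -/
lemma liftsBoundary_boxOne {q : X ⟶ Y} (hq : ∀ ⦃K L : MarkedSSet.{u}⦄ (i : K ⟶ L), monos i →
    cylinder.LiftsOne q i) {i : K ⟶ L} (hi : monos i) :
    cylinder.LiftsBoundary q (cylinder.boxOne i) := by
  intro a w₀ w₁ b h₀ h₁ h₂ h₃ h₄
  have e₁ : pushout.inl _ _ ≫ cylinder.boxOne i = cylinder.I.map i := pushout.inl_desc _ _ _
  have e₂ : pushout.inr _ _ ≫ cylinder.boxOne i = cylinder.d₁.app L := pushout.inr_desc _ _ _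
  have e₃ : pushout.inl _ _ ≫ cylinder.boxBoundary i = cylinder.I.map i := pushout.inl_desc _ _ _
  have e₄ : pushout.inr _ _ ≫ cylinder.boxBoundary i = cylinder.boundary L :=
    pushout.inr_desc _ _ _
  have e₅ (K : MarkedSSet.{u}) : coprod.inl ≫ cylinder.boundary K = cylinder.d₀.app K :=
    coprod.inl_desc _ _
  have e₆ (K : MarkedSSet.{u}) : coprod.inr ≫ cylinder.boundary K = cylinder.d₁.app K :=
    coprod.inr_desc _ _
  have n₀ {K L : MarkedSSet.{u}} (f : K ⟶ L) : f ≫ cylinder.d₀.app L =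
    cylinder.d₀.app K ≫ cylinder.I.map f := cylinder.d₀.naturality f
  have n₁ {K L : MarkedSSet.{u}} (f : K ⟶ L) : f ≫ cylinder.d₁.app L =
    cylinder.d₁.app K ≫ cylinder.I.map f := cylinder.d₁.naturality f
  -- A map out of `I ⊗` the pushout that is the source of `∂I ⊠ i` is glued after currying, so no
  -- preservation of pushouts by the cylinder is invoked. Here `a` enters with the coordinates
  -- exchanged, next to `w₀` and `w₁`.
  have hc : cylinder.boundary K ≫ curry (cylinderSwap K ≫ cylinder.I.map (pushout.inl _ _) ≫ a) =
      coprod.map i i ≫ coprod.desc (curry w₀) (curry w₁) := by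
    apply coprod.hom_ext
    · rw [reassoc_of% (e₅ K), coprod.inl_map_assoc, coprod.inl_desc]
      refine (curry_map_comp _ _).symm.trans (Eq.trans ?_ (curry_map_comp _ _))
      rw [← Category.assoc, map_d₀_cylinderSwap, ← Category.assoc, ← n₀, Category.assoc]
      refine congrArg curry ((congrArg _ h₀).trans ?_)
      rw [← Category.assoc, e₁]
    · rw [reassoc_of% (e₆ K), coprod.inr_map_assoc, coprod.inr_desc]
      refine (curry_map_comp _ _).symm.trans (Eq.trans ?_ (curry_map_comp _ _))
      rw [← Category.assoc, map_d₁_cylinderSwap, ← Category.assoc, ← n₁, Category.assoc]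
      refine congrArg curry ((congrArg _ h₁).trans ?_)
      rw [← Category.assoc, e₁]
  obtain ⟨g, hg⟩ : ∃ g, g = pushout.desc _ _ hc := ⟨_, rfl⟩
  have g₁ : pushout.inl _ _ ≫ g = _ := hg ▸ pushout.inl_desc _ _ _
  have g₂ : coprod.inl ≫ pushout.inr _ _ ≫ g = curry w₀ := by
    rw [hg, pushout.inr_desc, coprod.inl_desc]
  have g₃ : coprod.inr ≫ pushout.inr _ _ ≫ g = curry w₁ := by
    rw [hg, pushout.inr_desc, coprod.inr_desc]
  obtain ⟨l, hl₁, hl₂, hl₃⟩ := hq _ (monos_boxBoundary hi) (uncurry g)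
    (cylinder.I.map (pushout.inr _ _) ≫ a) (cylinderSwap L ≫ b) (by
      refine (comp_pathEv₁ g).symm.trans ?_
      apply pushout.hom_ext
      · rw [← Category.assoc, g₁, comp_pathEv₁, uncurry_curry, ← Category.assoc, ← Category.assoc,
          d₁_cylinderSwap, ← Functor.map_comp, pushout.condition, ← Category.assoc, e₃,
          Functor.map_comp, Category.assoc]
      · rw [reassoc_of% e₄]
        apply coprod.hom_ext
        · rw [← Category.assoc (pushout.inr _ _), ← Category.assoc, g₂, comp_pathEv₁,
            uncurry_curry, reassoc_of% (e₅ L), ← Category.assoc, ← n₀, ← e₂, Category.assoc]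
          exact (Category.assoc _ _ _).trans (congrArg _ h₀.symm)
        · rw [← Category.assoc (pushout.inr _ _), ← Category.assoc, g₃, comp_pathEv₁,
            uncurry_curry, reassoc_of% (e₆ L)]
          refine Eq.trans ?_ (Category.assoc _ _ _)
          refine Eq.trans ?_ (congrArg (· ≫ a) (n₁ _))
          refine Eq.trans ?_ (Category.assoc _ _ _).symm
          refine Eq.trans ?_ (congrArg (pushout.inr _ _ ≫ ·) h₁).symm
          exact (congrArg (· ≫ w₁) e₂).symm.trans (Category.assoc _ _ _)) (by
      apply curryEquiv.injective
      change curry _ = curry _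
      rw [curry_comp, curry_uncurry, curry_map_comp]
      apply pushout.hom_ext
      · rw [← Category.assoc, g₁, ← curry_comp, reassoc_of% e₃, ← curry_map_comp,
          Category.assoc, Category.assoc, h₂, ← Category.assoc (cylinder.I.map (pushout.inl _ _)),
          ← Functor.map_comp, e₁, ← Category.assoc, ← Category.assoc, cylinderSwap_naturality]
      · rw [reassoc_of% e₄]
        apply coprod.hom_ext
        · rw [← Category.assoc (pushout.inr _ _), ← Category.assoc, g₂, reassoc_of% (e₅ L),
            ← curry_comp, h₃]
          refine Eq.trans ?_ (curry_map_comp _ _)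
          rw [← Category.assoc, map_d₀_cylinderSwap]
        · rw [← Category.assoc (pushout.inr _ _), ← Category.assoc, g₃, reassoc_of% (e₆ L),
            ← curry_comp, h₄]
          refine Eq.trans ?_ (curry_map_comp _ _)
          rw [← Category.assoc, map_d₁_cylinderSwap]) (by
      rw [Category.assoc, h₂, ← Category.assoc, ← Functor.map_comp, e₂, ← Category.assoc,
        d₁_cylinderSwap])
  -- Exchanging the coordinates again turns `l` into a solution of the original problem.
  refine ⟨cylinderSwap L ≫ l, ?_, ?_, ?_, ?_⟩
  · apply curryEquiv.injective
    change curry _ = curry _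
    rw [curry_map_comp]
    apply pushout.hom_ext
    · have h₅ : cylinder.I.map (cylinder.I.map i) ≫ l =
          cylinderSwap K ≫ cylinder.I.map (pushout.inl _ _) ≫ a := by
        rw [← e₃, Functor.map_comp, Category.assoc, hl₁, ← uncurry_comp, g₁, uncurry_curry]
      rw [reassoc_of% e₁, ← curry_map_comp, ← curry_map_comp]
      refine congrArg curry ?_
      refine (Category.assoc _ _ _).symm.trans ?_
      refine (congrArg (· ≫ l) (cylinderSwap_naturality i)).trans ?_
      refine (Category.assoc _ _ _).trans ((congrArg _ h₅).trans ?_)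
      refine (Category.assoc _ _ _).symm.trans ?_
      exact (congrArg (· ≫ cylinder.I.map (pushout.inl _ _) ≫ a) (cylinderSwap_swap K)).trans
        (Category.id_comp _)
    · rw [reassoc_of% e₂]
      refine (curry_map_comp (cylinder.d₁.app L) (cylinderSwap L ≫ l)).symm.trans ?_
      rw [← Category.assoc, map_d₁_cylinderSwap]
      exact (congrArg (fun t => curry (K := L) t) hl₂).trans (curry_map_comp (pushout.inr _ _) a)
  · rw [← Category.assoc]
    refine (congrArg (· ≫ l) (d₀_cylinderSwap L)).trans ?_
    rw [← e₅, ← e₄, Functor.map_comp, Functor.map_comp, Category.assoc, Category.assoc, hl₁,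
      ← uncurry_comp, ← uncurry_comp, g₂, uncurry_curry]
  · rw [← Category.assoc]
    refine (congrArg (· ≫ l) (d₁_cylinderSwap L)).trans ?_
    rw [← e₆, ← e₄, Functor.map_comp, Functor.map_comp, Category.assoc, Category.assoc, hl₁,
      ← uncurry_comp, ← uncurry_comp, g₃, uncurry_curry]
  · rw [Category.assoc, hl₃, ← Category.assoc, cylinderSwap_swap, Category.id_comp]

end MarkedSSet

/-! ### Pushout products with the ends of the cylinder, and the generators of the anodyne class. -/

namespace SSet

lemma eq_const_of_mem_boundary {d : SimplexCategoryᵒᵖ} {T : SSet.{u}} (y : (T ⊗ Δ[1] : SSet.{u}).obj d)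
    (hy : y.2 ∈ (∂Δ[1] : (Δ[1] : SSet.{u}).Subcomplex).obj d) :
    (ι₀ : T ⟶ T ⊗ Δ[1]).app d y.1 = y ∨ (ι₁ : T ⟶ T ⊗ Δ[1]).app d y.1 = y := by
  obtain ⟨⟨d⟩⟩ := d
  obtain ⟨j, hj⟩ := (mem_boundary_iff_notMem_range y.2).1 hy
  simp only [Set.mem_range, not_exists] at hj
  obtain rfl | rfl : j = 1 ∨ j = 0 := by
    fin_cases j
    · exact .inr rfl
    · exact .inl rfl
  · refine .inl (Prod.ext rfl (stdSimplex.ext (n := 1) (d := d) _ _ fun i => ?_))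
    have := hj i
    change 0 = (y.2 : (Δ[1] : SSet.{u}) _⦋d⦌) i
    generalize (y.2 : (Δ[1] : SSet.{u}) _⦋d⦌) i = z at *
    change Fin 2 at z
    fin_cases z
    · rfl
    · exact absurd rfl this
  · refine .inr (Prod.ext rfl (stdSimplex.ext (n := 1) (d := d) _ _ fun i => ?_))
    have := hj i
    change 1 = (y.2 : (Δ[1] : SSet.{u}) _⦋d⦌) i
    generalize (y.2 : (Δ[1] : SSet.{u}) _⦋d⦌) i = z at *
    change Fin 2 at z
    fin_cases z
    · exact absurd rfl this
    · rfl

lemma ι₀_app_ne_ι₁_app {d : SimplexCategoryᵒᵖ} {T : SSet.{u}} (x y : T.obj d) :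
    (ι₀ : T ⟶ T ⊗ Δ[1]).app d x ≠ (ι₁ : T ⟶ T ⊗ Δ[1]).app d y := by
  intro h
  obtain ⟨⟨d⟩⟩ := d
  have h₂ := DFunLike.congr_fun (F := (Δ[1] : SSet.{u}) _⦋d⦌) (congrArg Prod.snd h) 0
  exact absurd h₂ (by change ¬ (0 : Fin 2) = 1; decide)

/-- Gluing of maps on `S ⊗ Δ[1]` and the two copies of `T` in `T ⊗ Δ[1]`. -/
lemma exists_hom_unionProd_boundary {T X : SSet.{u}} (S : T.Subcomplex)
    (a : (S : SSet.{u}) ⊗ Δ[1] ⟶ X) (w₀ w₁ : T ⟶ X) (h₀ : ι₀ ≫ a = S.ι ≫ w₀)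
    (h₁ : ι₁ ≫ a = S.ι ≫ w₁) :
    ∃ f : (S.unionProd ∂Δ[1] : SSet.{u}) ⟶ X,
      (∀ d (y : S.obj d) (ε : (Δ[1] : SSet.{u}).obj d) hy,
        f.app d ⟨(y.1, ε), hy⟩ = a.app d (y, ε)) ∧
      (∀ d (y : T.obj d) hy, f.app d ⟨(ι₀ : T ⟶ T ⊗ Δ[1]).app d y, hy⟩ = w₀.app d y) ∧
      ∀ d (y : T.obj d) hy, f.app d ⟨(ι₁ : T ⟶ T ⊗ Δ[1]).app d y, hy⟩ = w₁.app d y := by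
  let R : ∀ d, (T ⊗ Δ[1] : SSet.{u}).obj d → X.obj d → Prop := fun d y x =>
    (∃ h : y.1 ∈ S.obj d, x = a.app d (⟨y.1, h⟩, y.2)) ∨
      ((ι₀ : T ⟶ T ⊗ Δ[1]).app d y.1 = y ∧ x = w₀.app d y.1) ∨
      ((ι₁ : T ⟶ T ⊗ Δ[1]).app d y.1 = y ∧ x = w₁.app d y.1)
  have c₀ (d) (y : (T ⊗ Δ[1] : SSet.{u}).obj d) (h : y.1 ∈ S.obj d)
      (hy : (ι₀ : T ⟶ T ⊗ Δ[1]).app d y.1 = y) : a.app d (⟨y.1, h⟩, y.2) = w₀.app d y.1 := by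
    refine Eq.trans ?_ (ConcreteCategory.congr_hom (congr_app h₀ d) ⟨y.1, h⟩)
    have hy' : y.2 = _ := congrArg Prod.snd hy.symm
    exact congrArg (a.app d) (Prod.ext rfl hy')
  have c₁ (d) (y : (T ⊗ Δ[1] : SSet.{u}).obj d) (h : y.1 ∈ S.obj d)
      (hy : (ι₁ : T ⟶ T ⊗ Δ[1]).app d y.1 = y) : a.app d (⟨y.1, h⟩, y.2) = w₁.app d y.1 := by
    refine Eq.trans ?_ (ConcreteCategory.congr_hom (congr_app h₁ d) ⟨y.1, h⟩)
    have hy' : y.2 = _ := congrArg Prod.snd hy.symm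
    exact congrArg (a.app d) (Prod.ext rfl hy')
  have huniq : ∀ d y x x', R d y x → R d y x' → x = x' := by
    rintro d y x x' (⟨h, rfl⟩ | ⟨h, rfl⟩ | ⟨h, rfl⟩) (⟨h', rfl⟩ | ⟨h', rfl⟩ | ⟨h', rfl⟩)
    · rfl
    · exact c₀ d y h h'
    · exact c₁ d y h h'
    · exact (c₀ d y h' h).symm
    · rfl
    · exact absurd (h.trans h'.symm) (ι₀_app_ne_ι₁_app _ _)
    · exact (c₁ d y h' h).symm
    · exact absurd (h'.trans h.symm) (ι₀_app_ne_ι₁_app _ _)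
    · rfl
  obtain ⟨f, hf⟩ := (S.unionProd ∂Δ[1]).exists_hom_of_rel R (by
      intro d y hy
      obtain hy | hy := (Subcomplex.mem_unionProd_iff S ∂Δ[1] y).1 hy
      · obtain h | h := eq_const_of_mem_boundary y hy
        · exact ⟨_, .inr (.inl ⟨h, rfl⟩)⟩
        · exact ⟨_, .inr (.inr ⟨h, rfl⟩)⟩
      · exact ⟨_, .inl ⟨hy, rfl⟩⟩) huniq (by
      rintro d d' φ y x (⟨h, rfl⟩ | ⟨h, rfl⟩ | ⟨h, rfl⟩)
      · exact .inl ⟨S.map φ h, (ConcreteCategory.congr_hom (a.naturality φ)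
          ((⟨y.1, h⟩, y.2) : ((S : SSet.{u}) ⊗ Δ[1] : SSet.{u}).obj d)).symm⟩
      · exact .inr (.inl ⟨congrArg ((T ⊗ Δ[1] : SSet.{u}).map φ) h,
          (ConcreteCategory.congr_hom (w₀.naturality φ) y.1).symm⟩)
      · exact .inr (.inr ⟨congrArg ((T ⊗ Δ[1] : SSet.{u}).map φ) h,
          (ConcreteCategory.congr_hom (w₁.naturality φ) y.1).symm⟩))
  exact ⟨f, fun d y ε hy => huniq _ _ _ _ (hf _ _ _) (.inl ⟨y.2, rfl⟩),
    fun d y hy => huniq _ _ _ _ (hf _ _ _) (.inr (.inl ⟨rfl, rfl⟩)),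
    fun d y hy => huniq _ _ _ _ (hf _ _ _) (.inr (.inr ⟨rfl, rfl⟩))⟩

end SSet

namespace MarkedSSet

variable {X Y K L : MarkedSSet.{u}}

/-- On underlying simplicial sets this is the stability of inner anodyne maps under pushout products
with `∂Δ[1]`. -/
lemma liftsBoundary_horn {q : X ⟶ Y} (hq : SSet.InnerFibration q.hom) {n : ℕ} {k : Fin (n + 3)}
    (h0 : 0 < k) (hn : k < Fin.last (n + 2)) :
    cylinder.LiftsBoundary q (ofFlat (X := flat Δ[n + 2]) Λ[n + 2, k].ι) := by
  intro a w₀ w₁ b h₀ h₁ h₂ h₃ h₄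
  obtain ⟨f, hf, hf₀, hf₁⟩ := SSet.exists_hom_unionProd_boundary (X := X.toSSet) Λ[n + 2, k] a.hom
    w₀.hom w₁.hom (congrArg Hom.hom h₀) (congrArg Hom.hom h₁)
  have : HasLiftingProperty (SSet.Subcomplex.unionProd Λ[n + 2, k] ∂Δ[1]).ι q.hom :=
    SSet.innerAnodyneExtensions_unionProd_ι' Λ[n + 2, k] (∂Δ[1] : (Δ[1] : SSet.{u}).Subcomplex)
    (.horn_ι h0 hn) q.hom (by rwa [← SSet.innerFibration_iff])
  have sq : CommSq f (SSet.Subcomplex.unionProd Λ[n + 2, k] ∂Δ[1]).ι q.hom b.hom := ⟨by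
    ext d ⟨y, hy⟩
    obtain hy' | hy' := (SSet.Subcomplex.mem_unionProd_iff Λ[n + 2, k] ∂Δ[1] y).1 hy
    · obtain h | h := SSet.eq_const_of_mem_boundary y hy'
      · obtain ⟨z, rfl⟩ : ∃ z, y = (SSet.ι₀ : Δ[n + 2] ⟶ Δ[n + 2] ⊗ Δ[1]).app d z := ⟨_, h.symm⟩
        exact (congrArg (q.hom.app d) (hf₀ d z hy)).trans
          (ConcreteCategory.congr_hom (congr_app (congrArg Hom.hom h₃) d) z)
      · obtain ⟨z, rfl⟩ : ∃ z, y = (SSet.ι₁ : Δ[n + 2] ⟶ Δ[n + 2] ⊗ Δ[1]).app d z := ⟨_, h.symm⟩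
        exact (congrArg (q.hom.app d) (hf₁ d z hy)).trans
          (ConcreteCategory.congr_hom (congr_app (congrArg Hom.hom h₄) d) z)
    · exact (congrArg (q.hom.app d) (hf d ⟨y.1, hy'⟩ y.2 hy)).trans
        (ConcreteCategory.congr_hom (congr_app (congrArg Hom.hom h₂) d)
          ((⟨y.1, hy'⟩, y.2) : ((Λ[n + 2, k] : SSet.{u}) ⊗ Δ[1] : SSet.{u}).obj d))⟩
  have : sq.HasLift := this.sq_hasLift sq
  have hl {d} (y : (Δ[n + 2] ⊗ Δ[1] : SSet.{u}).obj d) (hy) : sq.lift.app d y = f.app d ⟨y, hy⟩ :=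
    ConcreteCategory.congr_hom (congr_app sq.fac_left d) ⟨y, hy⟩
  refine ⟨⟨sq.lift, ?_⟩, hom_ext ?_, hom_ext ?_, hom_ext ?_, hom_ext sq.fac_right⟩
  -- A marked edge of `I ⊗ (Δ^{n+2})^♭` lies over a vertex. All vertices are in the horn, so its
  -- image is prescribed by `a`.
  · rintro ⟨e, ε⟩ ⟨⟨x, rfl⟩, -⟩
    have hx : x ∈ (Λ[n + 2, k] : (Δ[n + 2] : SSet.{u}).Subcomplex).obj (op (.mk 0)) := by
      rw [SSet.horn_obj_zero]
      trivial
    have := a.map_marked ((Λ[n + 2, k] : SSet.{u}).σ 0 ⟨x, hx⟩, ε) ⟨⟨_, rfl⟩, trivial⟩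
    have h := (hl ((Δ[n + 2] : SSet.{u}).σ 0 x, ε) ((SSet.Subcomplex.mem_unionProd_iff _ _ _).2
      (.inr ((Λ[n + 2, k] : SSet.{u}).σ 0 ⟨x, hx⟩).2))).trans
      (hf _ ((Λ[n + 2, k] : SSet.{u}).σ 0 ⟨x, hx⟩) ε _)
    exact (congrArg (· ∈ X.marked) h).mpr this
  · ext d ⟨y, ε⟩
    exact (hl _ ((SSet.Subcomplex.mem_unionProd_iff _ _ _).2 (.inr y.2))).trans (hf d y ε _)
  · ext d y
    refine (hl _ ((SSet.Subcomplex.mem_unionProd_iff _ _ _).2 (.inl ?_))).trans (hf₀ d y _)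
    obtain ⟨⟨d⟩⟩ := d
    refine (SSet.mem_boundary_iff_notMem_range _).2 ⟨1, ?_⟩
    rintro ⟨i, hi⟩
    exact absurd hi (by change ¬ (0 : Fin 2) = 1; decide)
  · ext d y
    refine (hl _ ((SSet.Subcomplex.mem_unionProd_iff _ _ _).2 (.inl ?_))).trans (hf₁ d y _)
    obtain ⟨⟨d⟩⟩ := d
    refine (SSet.mem_boundary_iff_notMem_range _).2 ⟨0, ?_⟩
    rintro ⟨i, hi⟩
    exact absurd hi (by change ¬ (1 : Fin 2) = 0; decide)

/-- The underlying map is already given, and only markings are at stake. The edges at the end `1`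
are marked through `w₁`, and `∂₁ ⊠ edgeFlatSharp` spreads this over the cylinder on each edge of
`J`. -/
lemma liftsBoundary_coherentIso {q : X ⟶ Y} (hq : cylinder.LiftsOne q edgeFlatSharp.{u}) :
    cylinder.LiftsBoundary q (ofFlat (X := sharp SSet.coherentIso.{u}) (𝟙 SSet.coherentIso.{u})) := by
  intro a w₀ w₁ b h₀ h₁ h₂ h₃ h₄
  refine ⟨⟨a.hom, ?_⟩, rfl, ?_, ?_, ?_⟩
  · rintro ⟨j, ε⟩ -
    obtain ⟨l, hl, -, -⟩ := hq
      (cylinder.I.map (ofFlat (X := flat _) (SSet.yonedaEquiv.symm j)) ≫ a)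
      (sharpFunctor.map (SSet.yonedaEquiv.symm j) ≫ w₁)
      (cylinder.I.map (sharpFunctor.map (SSet.yonedaEquiv.symm j)) ≫ b) (by
        exact congrArg (fun t => ofFlat (X := flat _) (SSet.yonedaEquiv.symm j) ≫ t) h₁) (by
        exact congrArg
          (fun t => cylinder.I.map (ofFlat (X := flat _) (SSet.yonedaEquiv.symm j)) ≫ t) h₂) (by
        exact congrArg (fun t => sharpFunctor.map (SSet.yonedaEquiv.symm j) ≫ t) h₄)
    have := l.map_marked (SSet.yonedaEquiv (𝟙 _), ε) ⟨trivial, trivial⟩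
    have h := ConcreteCategory.congr_hom (congr_app (congrArg Hom.hom hl) _)
      ((SSet.yonedaEquiv (𝟙 _), ε) : (Δ[1] ⊗ Δ[1] : SSet.{u}) _⦋1⦌)
    refine (congrArg (· ∈ X.marked) (h.trans ?_)).mp this
    refine congrArg (a.hom.app _) (Prod.ext ?_ rfl)
    exact Equiv.apply_symm_apply SSet.yonedaEquiv j
  · have := congrArg Hom.hom h₀
    exact hom_ext this
  · have := congrArg Hom.hom h₁
    exact hom_ext this
  · have := congrArg Hom.hom h₂
    exact hom_ext this

/-- A set of generators for the marked right anodyne extensions. -/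
def anodyneGenerators : MorphismProperty MarkedSSet.{u} :=
  generators ⊔ MorphismProperty.ofHoms (fun n : ℕ => cylinder.boxOne (boundaryFlat.{u} n)) ⊔
    MorphismProperty.ofHoms (fun _ : Unit => cylinder.boxOne edgeFlatSharp.{u})

lemma isSmall_sup {C : Type*} [Category* C] (P Q : MorphismProperty C)
    [MorphismProperty.IsSmall.{v} P] [MorphismProperty.IsSmall.{v} Q] :
    MorphismProperty.IsSmall.{v} (P ⊔ Q) := by
  rw [sup_eq_iSup]
  have (b : Bool) : MorphismProperty.IsSmall.{v} (bif b then P else Q) := by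
    cases b <;> assumption
  infer_instance

instance : MorphismProperty.IsSmall.{u} flatInnerHorns.{u} := by
  have : flatInnerHorns.{u} = MorphismProperty.ofHoms
      (fun i : Σ n : ℕ, { k : Fin (n + 3) // 0 < k ∧ k < Fin.last (n + 2) } =>
        ofFlat (X := flat Δ[i.1 + 2]) Λ[i.1 + 2, i.2.1].ι) := by
    refine le_antisymm ?_ ?_
    · rintro _ _ _ ⟨k, h0, hn⟩
      exact ⟨(⟨_, ⟨k, h0, hn⟩⟩ : Σ n : ℕ, { k : Fin (n + 3) // 0 < k ∧ k < Fin.last (n + 2) })⟩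
    · rintro _ _ _ ⟨i⟩
      exact ⟨i.2.1, i.2.2.1, i.2.2.2⟩
  rw [this]
  exact MorphismProperty.isSmall_ofHoms ..

instance : MorphismProperty.IsSmall.{u} flatSharpIso.{u} := by
  have : flatSharpIso.{u} = MorphismProperty.ofHoms (fun _ : Unit =>
      ofFlat (X := sharp SSet.coherentIso.{u}) (𝟙 SSet.coherentIso.{u})) := by
    refine le_antisymm ?_ ?_
    · rintro _ _ _ ⟨⟩
      exact ⟨()⟩
    · rintro _ _ _ ⟨⟩
      exact ⟨⟩
  rw [this]
  exact MorphismProperty.isSmall_ofHoms ..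

instance : MorphismProperty.IsSmall.{u} anodyneGenerators.{u} := by
  have : MorphismProperty.IsSmall.{u} generators.{u} := isSmall_sup _ _
  have : MorphismProperty.IsSmall.{u} (MorphismProperty.ofHoms
    (fun n : ℕ => cylinder.boxOne (boundaryFlat.{u} n))) := MorphismProperty.isSmall_ofHoms ..
  have : MorphismProperty.IsSmall.{u} (MorphismProperty.ofHoms
    (fun _ : Unit => cylinder.boxOne edgeFlatSharp.{u})) := MorphismProperty.isSmall_ofHoms ..
  have : MorphismProperty.IsSmall.{u} (generators.{u} ⊔
    MorphismProperty.ofHoms (fun n : ℕ => cylinder.boxOne (boundaryFlat.{u} n))) := isSmall_sup _ _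
  exact isSmall_sup _ _

lemma anodyneGenerators_le_monos : anodyneGenerators.{u} ≤ monos := by
  refine sup_le (sup_le (sup_le ?_ ?_) ?_) ?_
  · rintro _ _ _ ⟨k, h0, hn⟩
    exact inferInstanceAs (Mono Λ[_, k].ι)
  · rintro _ _ _ ⟨⟩
    exact inferInstanceAs (Mono (𝟙 SSet.coherentIso.{u}))
  · rintro _ _ _ ⟨n⟩
    exact monos_boxOne (monos_boundaryFlat n)
  · rintro _ _ _ ⟨⟩
    exact monos_boxOne monos_edgeFlatSharp

lemma innerFibration_hom_iff (q : X ⟶ Y) :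
    SSet.InnerFibration q.hom ↔ ∀ ⦃n : ℕ⦄ (k : Fin (n + 3)), 0 < k → k < Fin.last (n + 2) →
      HasLiftingProperty (ofFlat (X := flat Δ[n + 2]) Λ[n + 2, k].ι) q := by
  rw [SSet.innerFibration_iff]
  constructor
  · intro h n k h0 hn
    have := h _ (SSet.horn_ι_mem_innerHornInclusions h0 hn)
    refine ⟨fun {f g} sq => ?_⟩
    have sq' : CommSq f.hom Λ[n + 2, k].ι q.hom g.hom := ⟨congrArg Hom.hom sq.w⟩
    have : sq'.HasLift := this.sq_hasLift sq'
    exact ⟨⟨⟨ofFlat sq'.lift, hom_ext sq'.fac_left, hom_ext sq'.fac_right⟩⟩⟩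
  · intro h _ _ _ ⟨k, h0, hn⟩
    have := h k h0 hn
    refine ⟨fun {f g} sq => ?_⟩
    have sq' : CommSq (ofFlat (X := X) f) (ofFlat (X := flat Δ[_]) Λ[_, k].ι) q (ofFlat (X := Y) g) :=
      ⟨hom_ext sq.w⟩
    exact ⟨⟨⟨sq'.lift.hom, congrArg Hom.hom sq'.fac_left, congrArg Hom.hom sq'.fac_right⟩⟩⟩

lemma rlp_anodyneGenerators_iff (q : X ⟶ Y) :
    anodyneGenerators.rlp q ↔ SSet.InnerFibration q.hom ∧
      HasLiftingProperty (ofFlat (X := sharp SSet.coherentIso.{u}) (𝟙 SSet.coherentIso.{u})) q ∧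
      (∀ n, cylinder.LiftsOne q (boundaryFlat n)) ∧ cylinder.LiftsOne q edgeFlatSharp := by
  simp only [innerFibration_hom_iff, ← FunctorialCylinder.hasLiftingProperty_boxOne_iff]
  constructor
  · intro h
    exact ⟨fun n k h0 hn => h _ (.inl (.inl (.inl ⟨k, h0, hn⟩))), h _ (.inl (.inl (.inr ⟨⟩))),
      fun n => h _ (.inl (.inr ⟨n⟩)), h _ (.inr ⟨()⟩)⟩
  · rintro ⟨h₁, h₂, h₃, h₄⟩ _ _ _ (((hg | hg) | hg) | hg) <;> cases hg
    · exact h₁ _ ‹_› ‹_›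
    · exact h₂
    · exact h₃ _
    · exact h₄

/-- If `p` lifts against monomorphisms, then by the adjunction `p^♯` lifts against the generators.
So the underlying map of an element of the saturation lifts against every such `p`, and is a
monomorphism. -/
lemma llp_rlp_anodyneGenerators_le_monos : anodyneGenerators.{u}.rlp.llp ≤ monos := by
  intro K L f hf
  change MorphismProperty.monomorphisms SSet.{u} f.hom
  rw [← SSet.llp_rlp_monomorphisms]
  intro S T p hp
  refine (forgetAdjunction.hasLiftingProperty_iff f p).2 (hf _ ?_)
  intro K' L' g hg
  exact (forgetAdjunction.hasLiftingProperty_iff g p).1 (hp _ (anodyneGenerators_le_monos _ hg))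

lemma liftsOne_of_rlp_anodyneGenerators {q : X ⟶ Y} (hq : anodyneGenerators.rlp q) {i : K ⟶ L}
    (hi : monos i) : cylinder.LiftsOne q i := by
  obtain ⟨-, -, h₁, h₂⟩ := (rlp_anodyneGenerators_iff q).1 hq
  exact liftsOne_of_monos h₁ h₂ hi

/-- This is the dual form of stability under `∂I ⊠ -`: by adjunction it suffices to treat `∂I ⊠ i`
for generators `i`. -/
lemma rlp_anodyneGenerators_pathBoundary {q : X ⟶ Y} (hq : anodyneGenerators.rlp q) :
    anodyneGenerators.rlp (pathBoundary q) := by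
  have h := (rlp_anodyneGenerators_iff q).1 hq
  rintro _ _ _ (((hg | hg) | hg) | hg) <;> cases hg <;> rw [hasLiftingProperty_pathBoundary_iff]
  · exact liftsBoundary_horn h.1 ‹_› ‹_›
  · exact liftsBoundary_coherentIso h.2.2.2
  · exact liftsBoundary_boxOne (fun _ _ _ hi => liftsOne_of_rlp_anodyneGenerators hq hi)
      (monos_boundaryFlat _)
  · exact liftsBoundary_boxOne (fun _ _ _ hi => liftsOne_of_rlp_anodyneGenerators hq hi)
      monos_edgeFlatSharp

lemma isRightAnodyneClass_llp_rlp_anodyneGenerators :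
    cylinder.IsRightAnodyneClass monos anodyneGenerators.{u}.rlp.llp where
  le_cof := llp_rlp_anodyneGenerators_le_monos
  exists_generators := ⟨_, inferInstance, anodyneGenerators_le_monos, rfl⟩
  boxOne_mem K L i hi X Y q hq := by
    rw [FunctorialCylinder.hasLiftingProperty_boxOne_iff]
    exact liftsOne_of_rlp_anodyneGenerators hq hi
  boxBoundary_mem K L i hi X Y q hq := by
    rw [FunctorialCylinder.hasLiftingProperty_boxBoundary_iff,
      ← hasLiftingProperty_pathBoundary_iff]
    exact hi _ (rlp_anodyneGenerators_pathBoundary hq)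

lemma markedRightAnodyne_le : markedRightAnodyne.{u} ≤ anodyneGenerators.rlp.llp :=
  fun _ _ _ hf => hf _ isRightAnodyneClass_llp_rlp_anodyneGenerators
    (le_trans (le_sup_left.trans le_sup_left) (MorphismProperty.le_llp_rlp _))

lemma markedRightAnodyne_le_monos : markedRightAnodyne.{u} ≤ monos :=
  markedRightAnodyne_le.trans llp_rlp_anodyneGenerators_le_monos

lemma anodyneGenerators_le_markedRightAnodyne : anodyneGenerators.{u} ≤ markedRightAnodyne := by
  refine sup_le (sup_le ?_ ?_) ?_
  · exact fun _ _ _ hf W _ hW' => hW' _ hf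
  · rintro _ _ _ ⟨n⟩ W hW -
    exact hW.boxOne_mem _ (monos_boundaryFlat n)
  · rintro _ _ _ ⟨⟩ W hW -
    exact hW.boxOne_mem _ monos_edgeFlatSharp

/-- The marked right fibrations are characterized by the lifting property with respect to
`anodyneGenerators`. -/
lemma rlp_markedRightAnodyne : markedRightAnodyne.{u}.rlp = anodyneGenerators.rlp := by
  refine le_antisymm (MorphismProperty.antitone_rlp anodyneGenerators_le_markedRightAnodyne) ?_
  rw [← MorphismProperty.le_llp_iff_le_rlp]
  exact markedRightAnodyne_le

lemma liftsOne_of_rlp {q : X ⟶ Y} (hq : markedRightAnodyne.rlp q) {i : K ⟶ L}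
    (hi : monos i) : cylinder.LiftsOne q i := by
  rw [rlp_markedRightAnodyne] at hq
  exact liftsOne_of_rlp_anodyneGenerators hq hi

lemma liftsBoundary_of_rlp {q : X ⟶ Y} (hq : markedRightAnodyne.rlp q) {i : K ⟶ L}
    (hi : markedRightAnodyne i) : cylinder.LiftsBoundary q i := by
  rw [rlp_markedRightAnodyne] at hq
  rw [← hasLiftingProperty_pathBoundary_iff]
  exact markedRightAnodyne_le _ hi _ (rlp_anodyneGenerators_pathBoundary hq)

end MarkedSSet

/-!
### Cartesian fibrations are marked right fibrations
-/

namespace SSet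

/-- Gluing of maps on `S ⊗ Δ[1]` and `T ⊗ {1}`. -/
lemma exists_hom_union_one {T X : SSet.{u}} (S : T.Subcomplex) (U : (T ⊗ Δ[1] : SSet.{u}).Subcomplex)
    (hU : ∀ d, ∀ y ∈ U.obj d, y.1 ∈ S.obj d ∨ (ι₁ : T ⟶ T ⊗ Δ[1]).app d y.1 = y)
    (a : (S : SSet.{u}) ⊗ Δ[1] ⟶ X) (w : T ⟶ X) (h₁ : ι₁ ≫ a = S.ι ≫ w) :
    ∃ f : (U : SSet.{u}) ⟶ X,
      (∀ d (y : S.obj d) (ε : (Δ[1] : SSet.{u}).obj d) hy,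
        f.app d ⟨(y.1, ε), hy⟩ = a.app d (y, ε)) ∧
      ∀ d (y : T.obj d) hy, f.app d ⟨(ι₁ : T ⟶ T ⊗ Δ[1]).app d y, hy⟩ = w.app d y := by
  let R : ∀ d, (T ⊗ Δ[1] : SSet.{u}).obj d → X.obj d → Prop := fun d y x =>
    (∃ h : y.1 ∈ S.obj d, x = a.app d (⟨y.1, h⟩, y.2)) ∨
      ((ι₁ : T ⟶ T ⊗ Δ[1]).app d y.1 = y ∧ x = w.app d y.1)
  have c₁ (d) (y : (T ⊗ Δ[1] : SSet.{u}).obj d) (h : y.1 ∈ S.obj d)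
      (hy : (ι₁ : T ⟶ T ⊗ Δ[1]).app d y.1 = y) : a.app d (⟨y.1, h⟩, y.2) = w.app d y.1 := by
    refine Eq.trans ?_ (ConcreteCategory.congr_hom (congr_app h₁ d) ⟨y.1, h⟩)
    have hy' : y.2 = _ := congrArg Prod.snd hy.symm
    exact congrArg (a.app d) (Prod.ext rfl hy')
  have huniq : ∀ d y x x', R d y x → R d y x' → x = x' := by
    rintro d y x x' (⟨h, rfl⟩ | ⟨h, rfl⟩) (⟨h', rfl⟩ | ⟨h', rfl⟩)
    · rfl
    · exact c₁ d y h h'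
    · exact (c₁ d y h' h).symm
    · rfl
  obtain ⟨f, hf⟩ := U.exists_hom_of_rel R (by
      intro d y hy
      obtain hy | hy := hU d y hy
      · exact ⟨_, .inl ⟨hy, rfl⟩⟩
      · exact ⟨_, .inr ⟨hy, rfl⟩⟩) huniq (by
      rintro d d' φ y x (⟨h, rfl⟩ | ⟨h, rfl⟩)
      · exact .inl ⟨S.map φ h, (ConcreteCategory.congr_hom (a.naturality φ)
          ((⟨y.1, h⟩, y.2) : ((S : SSet.{u}) ⊗ Δ[1] : SSet.{u}).obj d)).symm⟩
      · exact .inr ⟨congrArg ((T ⊗ Δ[1] : SSet.{u}).map φ) h,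
          (ConcreteCategory.congr_hom (w.naturality φ) y.1).symm⟩)
  exact ⟨f, fun d y ε hy => huniq _ _ _ _ (hf _ _ _) (.inl ⟨y.2, rfl⟩),
    fun d y hy => huniq _ _ _ _ (hf _ _ _) (.inr ⟨rfl, rfl⟩)⟩

lemma edge_cases (e : (Δ[1] : SSet.{u}) _⦋1⦌) :
    e = stdSimplex.edge 1 0 1 (by decide) ∨
      ∃ j : Fin 2, e = (Δ[1] : SSet.{u}).σ 0 (stdSimplex.const 1 j _) := by
  have h := stdSimplex.monotone_apply e (Fin.zero_le 1)
  have key : ∀ a b : Fin 2, a ≤ b → (a = 0 ∧ b = 1) ∨ a = b := by decide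
  obtain ⟨h₀, h₁⟩ | h := key (e 0) (e 1) h
  · refine .inl (stdSimplex.ext (n := 1) (d := 1) _ _ fun i => ?_)
    fin_cases i
    · exact h₀
    · exact h₁
  · refine .inr ⟨e 0, stdSimplex.ext (n := 1) (d := 1) _ _ fun i => ?_⟩
    fin_cases i
    · rfl
    · exact h.symm

/-- The isomorphism `Δ[1] ⟶ Δ[0] ⊗ Δ[1]`. -/
noncomputable def pointProd : (Δ[1] : SSet.{u}) ⟶ Δ[0] ⊗ Δ[1] :=
  lift (const (stdSimplex.const 0 0 _)) (𝟙 _)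

lemma δ_zero_pointProd : stdSimplex.δ 0 ≫ pointProd.{u} = ι₁ := by
  apply CartesianMonoidalCategory.hom_ext
  · ext
  · ext d y
    obtain ⟨⟨d⟩⟩ := d
    refine stdSimplex.ext (n := 1) (d := d) _ _ fun i => ?_
    change (0 : Fin 2).succAbove ((y : (Δ[0] : SSet.{u}) _⦋d⦌) i) = 1
    exact congrArg (Fin.succAbove (0 : Fin 2)) (Subsingleton.elim (α := Fin 1) _ 0)

lemma snd_pointProd : snd _ _ ≫ pointProd.{u} = 𝟙 _ := by
  apply CartesianMonoidalCategory.hom_ext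
  · ext
  · rfl

lemma ι₁_snd_point : (ι₁ : Δ[0] ⟶ Δ[0] ⊗ Δ[1]) ≫ snd _ _ = stdSimplex.δ.{u} 0 := by
  rw [← δ_zero_pointProd]
  rfl

end SSet

namespace MarkedSSet

variable {X A : SSet.{u}} {p : X ⟶ A}

/-- The map `X^♮ ⟶ A^♯`. -/
abbrev naturalMap (h : ∀ x : X _⦋0⦌, SSet.IsCartesianEdge p (X.σ 0 x)) :
    natural p h ⟶ sharp A := toSharp p

/-- `∂Δ^0` is empty, so this is the existence of Cartesian lifts with given target. -/
lemma liftsOne_naturalMap_boundaryFlat_zero (hp : SSet.IsCartesianFibration p)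
    (h : ∀ x : X _⦋0⦌, SSet.IsCartesianEdge p (X.σ 0 x)) :
    cylinder.LiftsOne (naturalMap h) (boundaryFlat 0) := by
  intro a w b h₁ h₂ h₃
  have h₃' : w.hom ≫ p = SSet.ι₁ ≫ b.hom := congrArg Hom.hom h₃
  obtain ⟨f, hf, hfp, hfc⟩ := hp.exists_hom_lift w.hom (SSet.pointProd ≫ b.hom)
    ((Category.assoc _ _ _).symm.trans ((congrArg (· ≫ b.hom) SSet.δ_zero_pointProd).trans h₃'.symm))
  refine ⟨⟨snd Δ[0] Δ[1] ≫ f, fun e _ =>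
    app_mem_marked_of_yonedaEquiv_mem (X := natural p h) hfc e.2⟩,
    hom_ext ?_, hom_ext ?_, hom_ext ?_⟩
  · ext d ⟨y, ε⟩
    have hy : y.1 ∈ (⊥ : (Δ[0] : SSet.{u}).Subcomplex).obj d := SSet.boundary_zero ▸ y.2
    exact hy.elim
  · exact (congrArg (· ≫ f) SSet.ι₁_snd_point).trans hf
  · change (snd Δ[0] Δ[1] ≫ f) ≫ p = b.hom
    rw [Category.assoc, hfp]
    exact congrArg (· ≫ b.hom) SSet.snd_pointProd

/-- The source of `∂₁ ⊠ (∂Δ^{n+1} ⟶ Δ^{n+1})` is stage `0` of the prism filtration. The one outer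
horn is filled because its last edge lies over a degenerate edge of the boundary, and so is sent by
`a` to a Cartesian edge. -/
lemma liftsOne_naturalMap_boundaryFlat_succ (hp : SSet.IsCartesianFibration p)
    (h : ∀ x : X _⦋0⦌, SSet.IsCartesianEdge p (X.σ 0 x))
    (n : ℕ) : cylinder.LiftsOne (naturalMap h) (boundaryFlat (n + 1)) := by
  intro a w b h₁ h₂ h₃
  obtain ⟨f, hf, hf₁⟩ := SSet.exists_hom_union_one (X := X) ∂Δ[n + 1]
    (SSet.prismFiltration (n + 1) 0) (by
      rintro ⟨⟨d⟩⟩ ⟨y, ε⟩ hy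
      obtain ⟨k, hk⟩ | hy | ⟨j, hj, -⟩ := (SSet.mem_prismFiltration_iff y ε).1 hy
      · refine .inl ((SSet.mem_boundary_iff_notMem_range _).2 ⟨k, ?_⟩)
        rintro ⟨i, hi⟩
        exact hk i hi
      · exact .inr (Prod.ext rfl
          (SSet.stdSimplex.ext (n := 1) (d := d) _ _ fun i => (hy i).symm))
      · omega) a.hom w.hom (congrArg Hom.hom h₁)
  have hv (x : (Δ[n + 1] : SSet.{u}) _⦋0⦌) :
      x ∈ (∂Δ[n + 1] : (Δ[n + 1] : SSet.{u}).Subcomplex).obj (op ⦋0⦌) := by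
    rw [SSet.boundary_obj_eq_univ 0 (n + 1)]
    trivial
  have hmem {d} (y : (∂Δ[n + 1] : SSet.{u}).obj d) (ε : (Δ[1] : SSet.{u}).obj d) :
      (y.1, ε) ∈ (SSet.prismFiltration (n + 1) 0).obj d := by
    obtain ⟨⟨d⟩⟩ := d
    obtain ⟨k, hk⟩ := (SSet.mem_boundary_iff_notMem_range y.1).1 y.2
    exact (SSet.mem_prismFiltration_iff _ _).2 (.inl ⟨k, fun i hi => hk ⟨i, hi⟩⟩)
  obtain ⟨_, key⟩ := SSet.cartesianExtension_prism.{u} n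
  obtain ⟨l, hl, hlp⟩ := key p hp.innerFibration b.hom f (by
    ext d ⟨y, hy⟩
    obtain ⟨⟨d⟩⟩ := d
    obtain ⟨y, ε⟩ := y
    obtain ⟨k, hk⟩ | hy' | ⟨j, hj, -⟩ := (SSet.mem_prismFiltration_iff y ε).1 hy
    · have hy' : y ∈ (∂Δ[n + 1] : (Δ[n + 1] : SSet.{u}).Subcomplex).obj (op ⦋d⦌) := by
        refine (SSet.mem_boundary_iff_notMem_range _).2 ⟨k, ?_⟩
        rintro ⟨i, hi⟩
        exact hk i hi
      exact (congrArg (p.app _) (hf _ ⟨y, hy'⟩ ε hy)).trans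
        (ConcreteCategory.congr_hom (congr_app (congrArg Hom.hom h₂) _)
          ((⟨y, hy'⟩, ε) : ((∂Δ[n + 1] : SSet.{u}) ⊗ Δ[1] : SSet.{u}) _⦋d⦌))
    · obtain rfl : ε = ((SSet.ι₁ : Δ[n + 1] ⟶ Δ[n + 1] ⊗ Δ[1]).app _ y).2 :=
        SSet.stdSimplex.ext (n := 1) (d := d) _ _ fun i => hy' i
      exact (congrArg (p.app _) (hf₁ _ y hy)).trans
        (ConcreteCategory.congr_hom (congr_app (congrArg Hom.hom h₃) _) y)
    · omega) (by
    rintro _ he rfl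
    let x : (∂Δ[n + 1] : SSet.{u}) _⦋0⦌ := ⟨SSet.stdSimplex.const (n + 1) (Fin.last _) _, hv _⟩
    have := a.map_marked ((∂Δ[n + 1] : SSet.{u}).σ 0 x, SSet.stdSimplex.edge 1 0 1 (by decide))
      ⟨⟨_, rfl⟩, trivial⟩
    exact (congrArg (SSet.IsCartesianEdge p) (hf _ ((∂Δ[n + 1] : SSet.{u}).σ 0 x)
      (SSet.stdSimplex.edge 1 0 1 (by decide)) he)).mpr this)
  have hl' {d} (y : (Δ[n + 1] ⊗ Δ[1] : SSet.{u}).obj d) (hy) :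
      l.app d ⟨y, trivial⟩ = f.app d ⟨y, hy⟩ :=
    ConcreteCategory.congr_hom (congr_app hl d) ⟨y, hy⟩
  refine ⟨⟨(SSet.Subcomplex.topIso _).inv ≫ l, ?_⟩, hom_ext ?_, hom_ext ?_, hom_ext ?_⟩
  -- A marked edge of the cylinder lies over a vertex, hence over the boundary, where `l` agrees
  -- with `a`.
  · rintro ⟨e, ε⟩ ⟨⟨x, rfl⟩, -⟩
    have := a.map_marked ((∂Δ[n + 1] : SSet.{u}).σ 0 ⟨x, hv x⟩, ε) ⟨⟨_, rfl⟩, trivial⟩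
    have h := (hl' ((Δ[n + 1] : SSet.{u}).σ 0 x, ε) (hmem ((∂Δ[n + 1] : SSet.{u}).σ 0 ⟨x, hv x⟩) ε)).trans
      (hf _ ((∂Δ[n + 1] : SSet.{u}).σ 0 ⟨x, hv x⟩) ε _)
    exact (congrArg (SSet.IsCartesianEdge p) h).mpr this
  · ext d ⟨y, ε⟩
    exact (hl' _ (hmem y ε)).trans (hf d y ε _)
  · ext d y
    refine (hl' _ ?_).trans (hf₁ d y _)
    obtain ⟨⟨d⟩⟩ := d
    exact (SSet.mem_prismFiltration_iff _ _).2 (.inr (.inl fun i => rfl))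
  · ext d y
    exact ConcreteCategory.congr_hom (congr_app hlp d) ⟨y, trivial⟩

/-- In the square given by `a`, the vertical sides and the side at the end `1` are Cartesian. The
diagonal is then Cartesian by composition, and the side at the end `0` by cancellation. -/
lemma liftsOne_naturalMap_edgeFlatSharp (hp : SSet.IsCartesianFibration p)
    (h : ∀ x : X _⦋0⦌, SSet.IsCartesianEdge p (X.σ 0 x)) :
    cylinder.LiftsOne (naturalMap h) edgeFlatSharp := by
  intro a w b h₁ h₂ h₃
  have hv (j : Fin 2) (ε : (Δ[1] : SSet.{u}) _⦋1⦌) : SSet.IsCartesianEdge p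
      (a.hom.app _ ((Δ[1] : SSet.{u}).σ 0 (SSet.stdSimplex.const 1 j _), ε)) :=
    a.map_marked _ ⟨⟨_, rfl⟩, trivial⟩
  have ht (e : (Δ[1] : SSet.{u}) _⦋1⦌) : SSet.IsCartesianEdge p
      (a.hom.app _ (e, (Δ[1] : SSet.{u}).σ 0 (SSet.stdSimplex.const 1 1 _))) := by
    have h' := w.map_marked e trivial
    have h₁' := ConcreteCategory.congr_hom (congr_app (congrArg Hom.hom h₁) (op ⦋1⦌)) e
    exact (congrArg (SSet.IsCartesianEdge p) h₁').mpr h'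
  have he (f : Fin 3 →o Fin 2) (i j : Fin 3) (hij) (s : (Δ[1] : SSet.{u}) _⦋1⦌) (h0 : f i = s 0)
      (h1 : f j = s 1) : (SSet.simplexMap f).app _ (SSet.stdSimplex.edge 2 i j hij) = s := by
    refine SSet.stdSimplex.ext (n := 1) (d := 1) _ _ fun k => ?_
    fin_cases k
    · exact h0
    · exact h1
  have he₂ (f g : Fin 3 →o Fin 2) (i j : Fin 3) (hij) (s s' : (Δ[1] : SSet.{u}) _⦋1⦌)
      (h0 : f i = s 0) (h1 : f j = s 1) (h0' : g i = s' 0) (h1' : g j = s' 1) :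
      SSet.IsCartesianEdge p ((lift (SSet.simplexMap f) (SSet.simplexMap g) ≫ a.hom).app _
        (SSet.stdSimplex.edge 2 i j hij)) ↔ SSet.IsCartesianEdge p (a.hom.app _ (s, s')) := by
    have h₄ : (lift (SSet.simplexMap f) (SSet.simplexMap g) ≫ a.hom).app _
        (SSet.stdSimplex.edge 2 i j hij) = a.hom.app _ (s, s') :=
      congrArg (a.hom.app _) (Prod.ext (he f i j hij s h0 h1) (he g i j hij s' h0' h1'))
    exact iff_of_eq (congrArg (SSet.IsCartesianEdge p) h₄)
  have hdiag : SSet.IsCartesianEdge p (a.hom.app _ (SSet.stdSimplex.edge 1 0 1 (by decide),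
      SSet.stdSimplex.edge 1 0 1 (by decide))) := by
    let f : Fin 3 →o Fin 2 := ⟨![0, 0, 1], by decide⟩
    let g : Fin 3 →o Fin 2 := ⟨![0, 1, 1], by decide⟩
    refine (he₂ f g 0 2 (by decide) _ _ rfl rfl rfl rfl).1 ?_
    refine hp.isCartesianEdge_comp _ ?_ ?_
    · exact (he₂ f g 0 1 (by decide) ((Δ[1] : SSet.{u}).σ 0 (SSet.stdSimplex.const 1 0 _))
        (SSet.stdSimplex.edge 1 0 1 (by decide)) rfl rfl rfl rfl).2 (hv 0 _)
    · exact (he₂ f g 1 2 (by decide) (SSet.stdSimplex.edge 1 0 1 (by decide))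
        ((Δ[1] : SSet.{u}).σ 0 (SSet.stdSimplex.const 1 1 _)) rfl rfl rfl rfl).2 (ht _)
  have hbot : SSet.IsCartesianEdge p (a.hom.app _ (SSet.stdSimplex.edge 1 0 1 (by decide),
      (Δ[1] : SSet.{u}).σ 0 (SSet.stdSimplex.const 1 0 _))) := by
    let f : Fin 3 →o Fin 2 := ⟨![0, 1, 1], by decide⟩
    let g : Fin 3 →o Fin 2 := ⟨![0, 0, 1], by decide⟩
    refine (he₂ f g 0 1 (by decide) _ _ rfl rfl rfl rfl).1 ?_
    refine hp.isCartesianEdge_cancel _ ?_ ?_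
    · exact (he₂ f g 0 2 (by decide) (SSet.stdSimplex.edge 1 0 1 (by decide))
        (SSet.stdSimplex.edge 1 0 1 (by decide)) rfl rfl rfl rfl).2 hdiag
    · exact (he₂ f g 1 2 (by decide) ((Δ[1] : SSet.{u}).σ 0 (SSet.stdSimplex.const 1 1 _))
        (SSet.stdSimplex.edge 1 0 1 (by decide)) rfl rfl rfl rfl).2 (hv 1 _)
  refine ⟨⟨a.hom, ?_⟩, rfl, ?_, ?_⟩
  · rintro ⟨e, ε⟩ -
    change SSet.IsCartesianEdge p (a.hom.app _ (e, ε))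
    obtain rfl | ⟨j, rfl⟩ := SSet.edge_cases e
    · obtain rfl | ⟨j, rfl⟩ := SSet.edge_cases ε
      · exact hdiag
      · fin_cases j
        · exact hbot
        · exact ht _
    · exact hv _ _
  · have := congrArg Hom.hom h₁
    exact hom_ext this
  · have := congrArg Hom.hom h₂
    exact hom_ext this

/-- If `p : X ⟶ A` is a Cartesian fibration, then `X^♮ ⟶ A^♯` is a marked right fibration. -/
lemma rlp_naturalMap (hp : SSet.IsCartesianFibration p)
    (h : ∀ x : X _⦋0⦌, SSet.IsCartesianEdge p (X.σ 0 x)) :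
    markedRightAnodyne.rlp (naturalMap h) := by
  rw [rlp_markedRightAnodyne, rlp_anodyneGenerators_iff]
  refine ⟨hp.innerFibration, ⟨fun {f g} sq => ?_⟩, ?_, liftsOne_naturalMap_edgeFlatSharp hp h⟩
  · exact ⟨⟨⟨⟨f.hom, fun e _ => hp.isCartesianEdge_of_coherentIso f.hom e⟩, rfl,
      hom_ext (congrArg Hom.hom sq.w :)⟩⟩⟩
  · rintro (_ | n)
    · exact liftsOne_naturalMap_boundaryFlat_zero hp h
    · exact liftsOne_naturalMap_boundaryFlat_succ hp h n

end MarkedSSet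

/-!
### Marked right fibrations are Cartesian fibrations
-/

namespace SSet

/-- The map `[m + 2] × [1] ⟶ [m + 2]` which sends `(m + 1, 1)` to `m + 2`, and `(j, t)` to `j`
otherwise. -/
def hornShiftFun (m : ℕ) : Fin (m + 3) × Fin 2 →o Fin (m + 3) where
  toFun s := if s.1.val = m + 1 ∧ s.2.val = 1 then Fin.last (m + 2) else s.1
  monotone' := by
    rintro ⟨j, t⟩ ⟨j', t'⟩ ⟨h, h'⟩
    have h := Fin.le_def.1 h
    have h' := Fin.le_def.1 h'
    have := j.isLt
    have := t'.isLt
    dsimp only at h h' ⊢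
    rw [Fin.le_def]
    split_ifs <;> (try simp only [Fin.val_last]) <;> omega

/-- The homotopy `Δ[m + 2] ⊗ Δ[1] ⟶ Δ[m + 2]` given by `hornShiftFun`. -/
noncomputable def hornShift (m : ℕ) : (Δ[m + 2] ⊗ Δ[1] : SSet.{u}) ⟶ Δ[m + 2] where
  app d := ↾ fun s => stdSimplex.objMk ((hornShiftFun m).comp
    ((stdSimplex.asOrderHom s.1).prod (stdSimplex.asOrderHom s.2)))

lemma hornShift_app_apply {m d : ℕ} (y : (Δ[m + 2] : SSet.{u}) _⦋d⦌) (ε : (Δ[1] : SSet.{u}) _⦋d⦌)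
    (i : Fin (d + 1)) : ((hornShift m).app (op ⦋d⦌) (y, ε) : (Δ[m + 2] : SSet.{u}) _⦋d⦌) i =
      if (y i).val = m + 1 ∧ (ε i).val = 1 then Fin.last (m + 2) else y i := rfl

lemma ι₀_hornShift (m : ℕ) : ι₀ ≫ hornShift.{u} m = 𝟙 _ := by
  ext d y
  obtain ⟨⟨d⟩⟩ := d
  refine stdSimplex.ext (n := m + 2) (d := d) _ _ fun i => ?_
  refine (hornShift_app_apply y _ i).trans (if_neg ?_)
  rintro ⟨-, h⟩
  exact absurd h (by change ¬ (0 : ℕ) = 1; decide)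

lemma hornShift_app_mem_horn {m : ℕ} {d : SimplexCategoryᵒᵖ} (y : (Δ[m + 2] : SSet.{u}).obj d)
    (hy : y ∈ (Λ[m + 2, Fin.last (m + 2)] : (Δ[m + 2] : SSet.{u}).Subcomplex).obj d)
    (ε : (Δ[1] : SSet.{u}).obj d) : (hornShift m).app d (y, ε) ∈
      (Λ[m + 2, Fin.last (m + 2)] : (Δ[m + 2] : SSet.{u}).Subcomplex).obj d := by
  obtain ⟨⟨d⟩⟩ := d
  obtain ⟨k, hk, hy⟩ := (mem_horn_iff_notMem_range (d := d) _ _).1 hy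
  refine (mem_horn_iff_notMem_range (d := d) _ _).2 ⟨k, hk, ?_⟩
  rintro ⟨i, hi⟩
  have hi := (hornShift_app_apply y ε i).symm.trans hi
  split_ifs at hi
  · exact hk hi.symm
  · exact hy ⟨i, hi⟩

lemma ι₁_hornShift_app_mem_horn {m : ℕ} {d : SimplexCategoryᵒᵖ} (y : (Δ[m + 2] : SSet.{u}).obj d) :
    (ι₁ ≫ hornShift m).app d y ∈
      (Λ[m + 2, Fin.last (m + 2)] : (Δ[m + 2] : SSet.{u}).Subcomplex).obj d := by
  obtain ⟨⟨d⟩⟩ := d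
  refine (mem_horn_iff_notMem_range (d := d) _ _).2 ⟨⟨m + 1, by omega⟩, ?_, ?_⟩
  · simp [Fin.ext_iff]
  rintro ⟨i, hi⟩
  have hi := (hornShift_app_apply y _ i).symm.trans hi
  split_ifs at hi with h
  · simp [Fin.ext_iff] at hi
  · exact h ⟨congrArg Fin.val hi, rfl⟩

/-- The restriction of `hornShift m` to the horn. -/
noncomputable def hornShiftRestrict (m : ℕ) :
    (Λ[m + 2, Fin.last (m + 2)] : SSet.{u}) ⊗ Δ[1] ⟶ (Λ[m + 2, Fin.last (m + 2)] : SSet.{u}) :=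
  Subcomplex.lift (Λ[m + 2, Fin.last (m + 2)].ι ▷ Δ[1] ≫ hornShift m) (by
    rintro d _ ⟨s, rfl⟩
    exact hornShift_app_mem_horn _ s.1.2 _)

/-- The end of `hornShift m`, as a map to the horn. -/
noncomputable def hornShiftOne (m : ℕ) : Δ[m + 2] ⟶ (Λ[m + 2, Fin.last (m + 2)] : SSet.{u}) :=
  Subcomplex.lift (ι₁ ≫ hornShift m) (by
    rintro d _ ⟨y, rfl⟩
    exact ι₁_hornShift_app_mem_horn y)

lemma hornShiftRestrict_ι (m : ℕ) : hornShiftRestrict.{u} m ≫ Λ[m + 2, Fin.last (m + 2)].ι =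
    Λ[m + 2, Fin.last (m + 2)].ι ▷ Δ[1] ≫ hornShift m := rfl

lemma ι₁_hornShiftRestrict (m : ℕ) : ι₁ ≫ hornShiftRestrict.{u} m =
    Λ[m + 2, Fin.last (m + 2)].ι ≫ hornShiftOne m := rfl

lemma ι₀_hornShiftRestrict (m : ℕ) : ι₀ ≫ hornShiftRestrict.{u} m = 𝟙 _ := by
  rw [← cancel_mono Λ[m + 2, Fin.last (m + 2)].ι, Category.assoc, hornShiftRestrict_ι]
  exact (congrArg (Λ[m + 2, Fin.last (m + 2)].ι ≫ ·) (ι₀_hornShift m))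

/-- The homotopy moves a single vertex, `m + 1`, and moves it along the last edge. So it preserves
markings once that edge is marked. -/
lemma hornShiftRestrict_app_degenerate {m : ℕ} (x : (Λ[m + 2, Fin.last (m + 2)] : SSet.{u}) _⦋0⦌)
    (ε : (Δ[1] : SSet.{u}) _⦋1⦌) :
    (hornShiftRestrict m).app _ ((Λ[m + 2, Fin.last (m + 2)] : SSet.{u}).σ 0 x, ε) = hornLastEdge m ∨
      ∃ z, (hornShiftRestrict m).app _ ((Λ[m + 2, Fin.last (m + 2)] : SSet.{u}).σ 0 x, ε) =
        (Λ[m + 2, Fin.last (m + 2)] : SSet.{u}).σ 0 z := by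
  obtain rfl | ⟨j, rfl⟩ := edge_cases ε
  · by_cases hx : ((x.1 : (Δ[m + 2] : SSet.{u}) _⦋0⦌) 0).val = m + 1
    · refine .inl (Subtype.ext (stdSimplex.ext (n := m + 2) (d := 1) _ _ fun i => ?_))
      refine (hornShift_app_apply _ _ i).trans ?_
      fin_cases i
      · refine (if_neg (fun h => absurd h.2 (by change ¬ (0 : ℕ) = 1; decide))).trans ?_
        exact Fin.ext hx
      · exact if_pos ⟨hx, rfl⟩
    · refine .inr ⟨x, Subtype.ext (stdSimplex.ext (n := m + 2) (d := 1) _ _ fun i => ?_)⟩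
      refine (hornShift_app_apply _ _ i).trans (if_neg (fun h => hx ?_))
      fin_cases i
      · exact h.1
      · exact h.1
  · exact .inr ⟨_, σ_naturality_apply (hornShiftRestrict m) 0 ((x, stdSimplex.const 1 j _) :
      ((Λ[m + 2, Fin.last (m + 2)] : SSet.{u}) ⊗ Δ[1] : SSet.{u}) _⦋0⦌)⟩

lemma yonedaEquiv_symm_app_const_one {X : SSet.{u}} (e : X _⦋1⦌) {T : SSet.{u}}
    {d : SimplexCategoryᵒᵖ} (z : T.obj d) :
    (yonedaEquiv.symm e).app d (stdSimplex.const 1 1 d) =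
      (const (X.δ 0 e) : T ⟶ X).app d z := by
  have h₁ : (yonedaEquiv.symm e).app (op ⦋0⦌) (stdSimplex.const 1 1 _) = X.δ 0 e := by
    have h : stdSimplex.objEquiv (stdSimplex.const.{u} 1 1 (op ⦋0⦌)) = SimplexCategory.δ 0 := by
      ext i
      fin_cases i
      rfl
    exact congrArg (fun φ => X.map (Quiver.Hom.op φ) e) h
  have h₂ := ConcreteCategory.congr_hom ((yonedaEquiv.symm e).naturality (d.unop.const ⦋0⦌ 0).op)
    (stdSimplex.const 1 1 (op ⦋0⦌))
  refine Eq.trans ?_ (h₂.trans (congrArg (X.map (d.unop.const ⦋0⦌ 0).op) h₁))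
  rfl

end SSet

namespace MarkedSSet

variable {A : SSet.{u}} {Y : MarkedSSet.{u}} {q : Y ⟶ sharp A}

lemma innerFibration_of_rlp (hq : markedRightAnodyne.rlp q) : SSet.InnerFibration q.hom := by
  rw [rlp_markedRightAnodyne, rlp_anodyneGenerators_iff] at hq
  exact hq.1

lemma hasLiftingProperty_coherentIso_of_rlp (hq : markedRightAnodyne.rlp q) :
    HasLiftingProperty (ofFlat (X := sharp SSet.coherentIso.{u}) (𝟙 SSet.coherentIso.{u})) q := by
  rw [rlp_markedRightAnodyne, rlp_anodyneGenerators_iff] at hq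
  exact hq.2.1

lemma exists_marked_lift_of_rlp (hq : markedRightAnodyne.rlp q) (y : Y.toSSet _⦋0⦌) (g : A _⦋1⦌)
    (hg : A.δ 0 g = q.hom.app _ y) :
    ∃ f ∈ Y.marked, Y.toSSet.δ 0 f = y ∧ q.hom.app _ f = g := by
  have hempty {d} (x : (∂Δ[0] : SSet.{u}).obj d) : False := by
    have hx : x.1 ∈ (⊥ : (Δ[0] : SSet.{u}).Subcomplex).obj d := SSet.boundary_zero ▸ x.2
    exact hx.elim
  obtain ⟨l, -, hl₁, hl₂⟩ := liftsOne_of_rlp hq (monos_boundaryFlat 0)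
    ⟨{ app d := ↾ fun x => (hempty x.1).elim, naturality d d' φ := by ext x; exact (hempty x.1).elim },
      fun e _ => (hempty e.1).elim⟩
    (ofFlat (SSet.yonedaEquiv.symm y)) (toSharp (snd Δ[0] Δ[1] ≫ SSet.yonedaEquiv.symm g))
    (hom_ext (by ext d x; exact (hempty x).elim)) (hom_ext (by ext d x; exact (hempty x.1).elim))
    (hom_ext (by
      change SSet.yonedaEquiv.symm y ≫ q.hom = SSet.ι₁ ≫ snd Δ[0] Δ[1] ≫ SSet.yonedaEquiv.symm g
      refine Eq.trans ?_ (congrArg (· ≫ SSet.yonedaEquiv.symm g) SSet.ι₁_snd_point).symm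
      apply SSet.yonedaEquiv.injective
      rw [SSet.yonedaEquiv_comp, Equiv.apply_symm_apply, ← hg]
      exact ((SSet.stdSimplex.yonedaEquiv_δ_comp _ _).trans (by rw [Equiv.apply_symm_apply])).symm))
  have hl₁ : SSet.ι₁ ≫ l.hom = SSet.yonedaEquiv.symm y := congrArg Hom.hom hl₁
  have hl₂ : l.hom ≫ q.hom = snd Δ[0] Δ[1] ≫ SSet.yonedaEquiv.symm g := congrArg Hom.hom hl₂
  refine ⟨SSet.yonedaEquiv (SSet.pointProd ≫ l.hom), ?_, ?_, ?_⟩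
  · refine l.map_marked _ ⟨⟨SSet.stdSimplex.const 0 0 _, ?_⟩, trivial⟩
    exact SSet.stdSimplex.ext (n := 0) (d := 1) _ _ fun i => Subsingleton.elim (α := Fin 1) _ _
  · refine (SSet.stdSimplex.yonedaEquiv_δ_comp _ _).symm.trans ?_
    refine (congrArg SSet.yonedaEquiv ((congrArg (· ≫ l.hom) SSet.δ_zero_pointProd).trans hl₁)).trans ?_
    exact Equiv.apply_symm_apply _ _
  · refine (SSet.yonedaEquiv_comp _ _).symm.trans ?_
    refine (congrArg SSet.yonedaEquiv (congrArg (SSet.pointProd ≫ ·) hl₂)).trans ?_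
    exact Equiv.apply_symm_apply SSet.yonedaEquiv g

/-- After `hornShift` the horn problem becomes a `∂₁ ⊠` problem: the end `1` factors through the
horn, so it is already filled by `a`, and the track of each vertex is degenerate or the marked edge
`e`. The end `0` of the lifted homotopy fills the original horn. -/
lemma isCartesianEdge_of_mem_marked (hq : markedRightAnodyne.rlp q) {e : Y.toSSet _⦋1⦌}
    (he : e ∈ Y.marked) : SSet.IsCartesianEdge q.hom e := by
  intro m a b hab hae
  have hi : monos (ofFlat (X := flat Δ[m + 2]) Λ[m + 2, Fin.last (m + 2)].ι) :=
    inferInstanceAs (Mono Λ[m + 2, Fin.last (m + 2)].ι)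
  obtain ⟨l, hl₁, -, hl₂⟩ := liftsOne_of_rlp hq hi
    ⟨SSet.hornShiftRestrict m ≫ a, by
      rintro ⟨_, ε⟩ ⟨⟨x, rfl⟩, -⟩
      obtain h | ⟨z, h⟩ := SSet.hornShiftRestrict_app_degenerate x ε
      · exact (congrArg (· ∈ Y.marked) ((congrArg (a.app _) h).trans hae)).mpr he
      · exact (congrArg (· ∈ Y.marked) (congrArg (a.app _) h)).mpr (map_degenerate_mem Y a z)⟩
    (ofFlat (SSet.hornShiftOne m ≫ a)) (toSharp (SSet.hornShift m ≫ b))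
    (hom_ext (congrArg (· ≫ a) (SSet.ι₁_hornShiftRestrict m)))
    (hom_ext (congrArg (SSet.hornShiftRestrict m ≫ ·) hab))
    (hom_ext (congrArg (SSet.hornShiftOne m ≫ ·) hab))
  have hl₁ : Λ[m + 2, Fin.last (m + 2)].ι ▷ Δ[1] ≫ l.hom = SSet.hornShiftRestrict m ≫ a :=
    congrArg Hom.hom hl₁
  have hl₂ : l.hom ≫ q.hom = SSet.hornShift m ≫ b := congrArg Hom.hom hl₂
  refine ⟨SSet.ι₀ ≫ l.hom, ?_, ?_⟩
  · refine (congrArg (SSet.ι₀ ≫ ·) hl₁).trans ?_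
    exact (congrArg (· ≫ a) (SSet.ι₀_hornShiftRestrict m)).trans (Category.id_comp _)
  · refine (congrArg (SSet.ι₀ ≫ ·) hl₂).trans ?_
    exact (congrArg (· ≫ b) (SSet.ι₀_hornShift m)).trans (Category.id_comp _)

lemma isCartesianFibration_of_rlp (hq : markedRightAnodyne.rlp q) :
    SSet.IsCartesianFibration q.hom where
  innerFibration := innerFibration_of_rlp hq
  exists_lift y g hg := by
    obtain ⟨f, hf, hfy, hfg⟩ := exists_marked_lift_of_rlp hq y g hg
    exact ⟨f, hfy, hfg, isCartesianEdge_of_mem_marked hq hf⟩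

end MarkedSSet

/-!
### The Cartesian edges of a marked right fibration are marked
-/

namespace SSet

namespace coherentIso

/-- The constant endomorphisms of `coherentIso`. -/
noncomputable abbrev constHom (x : coherentIso.{u} _⦋0⦌) : coherentIso.{u} ⟶ coherentIso.{u} := const x

lemma constHom_x₀_ne_x₁ {d : SimplexCategoryᵒᵖ} (k : coherentIso.{u}.obj d) :
    (constHom x₀).app d k ≠ (constHom x₁).app d k := by
  intro h
  have h₁ := congrArg (fun z : coherentIso.{u}.obj d => z.obj 0) h
  exact absurd (congrArg (fun z : WalkingIso.{u} => z.as.down) h₁) (by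
    change ¬ (false = true)
    decide)

/-- The subcomplex of `coherentIso` given by the two vertices. -/
noncomputable def vertices : coherentIso.{u}.Subcomplex where
  obj d := Set.ofPred (fun k => (constHom x₀).app d k = k ∨ (constHom x₁).app d k = k)
  map {d d'} φ k hk := by
    obtain hk | hk := hk
    · refine .inl (((ConcreteCategory.congr_hom ((constHom x₀).naturality φ) k)).trans ?_)
      exact congrArg (coherentIso.{u}.map φ) hk
    · refine .inr (((ConcreteCategory.congr_hom ((constHom x₁).naturality φ) k)).trans ?_)
      exact congrArg (coherentIso.{u}.map φ) hk

lemma constHom_x₀_mem_vertices {d : SimplexCategoryᵒᵖ} (k : coherentIso.{u}.obj d) :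
    (constHom x₀).app d k ∈ vertices.obj d := .inl rfl

lemma constHom_x₁_mem_vertices {d : SimplexCategoryᵒᵖ} (k : coherentIso.{u}.obj d) :
    (constHom x₁).app d k ∈ vertices.obj d := .inr rfl

/-- Maps on `vertices ⊗ T` are given by pairs of maps on `T`. -/
lemma exists_hom_vertices {T X : SSet.{u}} (e f : T ⟶ X) :
    ∃ a : (vertices : SSet.{u}) ⊗ T ⟶ X,
      (∀ d (k : vertices.obj d) (t : T.obj d), (constHom x₀).app d k.1 = k.1 →
        a.app d (k, t) = e.app d t) ∧
      ∀ d (k : vertices.obj d) (t : T.obj d), (constHom x₁).app d k.1 = k.1 →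
        a.app d (k, t) = f.app d t := by
  let R : ∀ d, ((vertices : SSet.{u}) ⊗ T).obj d → X.obj d → Prop := fun d z x =>
    ((constHom x₀).app d z.1.1 = z.1.1 ∧ x = e.app d z.2) ∨
      ((constHom x₁).app d z.1.1 = z.1.1 ∧ x = f.app d z.2)
  have huniq : ∀ d y x x', R d y x → R d y x' → x = x' := by
    rintro d y x x' (⟨h, rfl⟩ | ⟨h, rfl⟩) (⟨h', rfl⟩ | ⟨h', rfl⟩)
    · rfl
    · exact absurd (h.trans h'.symm) (constHom_x₀_ne_x₁ _)
    · exact absurd (h'.trans h.symm) (constHom_x₀_ne_x₁ _)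
    · rfl
  obtain ⟨g, hg⟩ := (⊤ : ((vertices : SSet.{u}) ⊗ T).Subcomplex).exists_hom_of_rel R (by
      rintro d ⟨⟨k, hk⟩, t⟩ -
      obtain hk | hk := hk
      · exact ⟨_, .inl ⟨hk, rfl⟩⟩
      · exact ⟨_, .inr ⟨hk, rfl⟩⟩) huniq (by
      rintro d d' φ y x (⟨h, rfl⟩ | ⟨h, rfl⟩)
      · exact .inl ⟨congrArg (coherentIso.{u}.map φ) h,
          (ConcreteCategory.congr_hom (e.naturality φ) y.2).symm⟩
      · exact .inr ⟨congrArg (coherentIso.{u}.map φ) h,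
          (ConcreteCategory.congr_hom (f.naturality φ) y.2).symm⟩)
  refine ⟨(Subcomplex.topIso _).inv ≫ g, fun d k t hk => ?_, fun d k t hk => ?_⟩
  · exact huniq d (k, t) _ _ (hg d (k, t) trivial) (.inl ⟨hk, rfl⟩)
  · exact huniq d (k, t) _ _ (hg d (k, t) trivial) (.inr ⟨hk, rfl⟩)

/-- The edge of `coherentIso` from `x₀` to `x₁`. -/
noncomputable def edgeHom : Δ[1] ⟶ coherentIso.{u} := yonedaEquiv.symm hom.edge

lemma edgeHom_app_const_zero {d : SimplexCategoryᵒᵖ} (k : coherentIso.{u}.obj d) :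
    edgeHom.app d (stdSimplex.const 1 0 d) = (constHom x₀).app d k := by
  obtain ⟨⟨d⟩⟩ := d
  apply Codiscrete.equivFun.injective
  rfl

lemma edgeHom_app_const_one {d : SimplexCategoryᵒᵖ} (k : coherentIso.{u}.obj d) :
    edgeHom.app d (stdSimplex.const 1 1 d) = (constHom x₁).app d k := by
  obtain ⟨⟨d⟩⟩ := d
  apply Codiscrete.equivFun.injective
  rfl

end coherentIso

end SSet

namespace MarkedSSet

open SSet.coherentIso

variable {A : SSet.{u}} {Y : MarkedSSet.{u}} {q : Y ⟶ sharp A}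

/-- Two Cartesian edges with the same target and the same image are related by a homotopy
parametrized by `coherentIso`. -/
lemma exists_coherentIso_homotopy {X : SSet.{u}} {p : X ⟶ A} (hp : SSet.IsCartesianFibration p)
    {e f : X _⦋1⦌} (he : SSet.IsCartesianEdge p e) (hf : SSet.IsCartesianEdge p f)
    (hef : X.δ 0 f = X.δ 0 e) (hpef : p.app _ f = p.app _ e) :
    ∃ L : SSet.coherentIso.{u} ⊗ Δ[1] ⟶ X,
      (∀ d (k : SSet.coherentIso.{u}.obj d) t, L.app d ((constHom x₀).app d k, t) =
        (SSet.yonedaEquiv.symm e).app d t) ∧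
      (∀ d (k : SSet.coherentIso.{u}.obj d) t, L.app d ((constHom x₁).app d k, t) =
        (SSet.yonedaEquiv.symm f).app d t) ∧
      (SSet.ι₁ ≫ L = SSet.const (X.δ 0 e)) ∧
      L ≫ p = snd _ _ ≫ SSet.yonedaEquiv.symm e ≫ p := by
  have h := hp.isCartesianEdge_degenerate
  obtain ⟨a, ha₀, ha₁⟩ := exists_hom_vertices (SSet.yonedaEquiv.symm e) (SSet.yonedaEquiv.symm f)
  have hpa : SSet.yonedaEquiv.symm f ≫ p = SSet.yonedaEquiv.symm e ≫ p := by
    rw [SSet.yonedaEquiv_symm_comp, SSet.yonedaEquiv_symm_comp, hpef]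
  have hi : monos (ofFlat (X := flat SSet.coherentIso.{u}) vertices.ι) :=
    inferInstanceAs (Mono vertices.ι)
  -- The natural marking is used here, so both edges may serve on the vertices of `J`; the target is
  -- held constant. The monomorphism `vertices ⟶ J` extends them to `I ⊗ J^♭`.
  obtain ⟨l, hl₁, hl₂, hl₃⟩ := liftsOne_of_rlp (rlp_naturalMap hp h) hi
    ⟨a, by
      rintro ⟨k, ε⟩ -
      obtain hk' | hk' := k.2
      · have := app_mem_marked_of_yonedaEquiv_mem (X := natural p h) (f := SSet.yonedaEquiv.symm e)
          ((congrArg (SSet.IsCartesianEdge p) (Equiv.apply_symm_apply SSet.yonedaEquiv e)).mpr he) ε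
        exact (congrArg (SSet.IsCartesianEdge p) (ha₀ _ k ε hk')).mpr this
      · have := app_mem_marked_of_yonedaEquiv_mem (X := natural p h) (f := SSet.yonedaEquiv.symm f)
          ((congrArg (SSet.IsCartesianEdge p) (Equiv.apply_symm_apply SSet.yonedaEquiv f)).mpr hf) ε
        exact (congrArg (SSet.IsCartesianEdge p) (ha₁ _ k ε hk')).mpr this⟩
    (ofFlat (SSet.const (X.δ 0 e))) (toSharp (snd _ _ ≫ SSet.yonedaEquiv.symm e ≫ p))
    (hom_ext (by
      ext d k
      obtain hk' | hk' := k.2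
      · exact (ha₀ _ k _ hk').trans (SSet.yonedaEquiv_symm_app_const_one e _)
      · exact (ha₁ _ k _ hk').trans
          ((SSet.yonedaEquiv_symm_app_const_one f k.1).trans (by rw [hef]; rfl))))
    (hom_ext (by
      ext d ⟨k, t⟩
      obtain hk' | hk' := k.2
      · exact congrArg (p.app d) (ha₀ _ k t hk')
      · exact (congrArg (p.app d) (ha₁ _ k t hk')).trans
          (ConcreteCategory.congr_hom (congr_app hpa d) t)))
    (hom_ext (by
      ext d k
      exact congrArg (p.app d) (SSet.yonedaEquiv_symm_app_const_one e k).symm))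
  refine ⟨l.hom, fun d k t => ?_, fun d k t => ?_, congrArg Hom.hom hl₂, congrArg Hom.hom hl₃⟩
  · have := ConcreteCategory.congr_hom (congr_app (congrArg Hom.hom hl₁) d)
      ((⟨(constHom x₀).app d k, constHom_x₀_mem_vertices k⟩, t) :
        ((vertices : SSet.{u}) ⊗ Δ[1]).obj d)
    exact this.trans (ha₀ _ _ t rfl)
  · have := ConcreteCategory.congr_hom (congr_app (congrArg Hom.hom hl₁) d)
      ((⟨(constHom x₁).app d k, constHom_x₁_mem_vertices k⟩, t) :
        ((vertices : SSet.{u}) ⊗ Δ[1]).obj d)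
    exact this.trans (ha₁ _ _ t rfl)

lemma mem_marked_of_isCartesianEdge (hq : markedRightAnodyne.rlp q) {e : Y.toSSet _⦋1⦌}
    (he : SSet.IsCartesianEdge q.hom e) : e ∈ Y.marked := by
  obtain ⟨f, hf, hfe, hfq⟩ := exists_marked_lift_of_rlp hq (Y.toSSet.δ 0 e) (q.hom.app _ e)
    (SSet.δ_naturality_apply q.hom 0 e).symm
  obtain ⟨L, hL₀, hL₁, hL₂, hL₃⟩ := exists_coherentIso_homotopy (isCartesianFibration_of_rlp hq) he
    (isCartesianEdge_of_mem_marked hq hf) hfe hfq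
  -- The sources of the edges form a map `J^♭ ⟶ Y`, which extends to `J^♯`.
  have hiso (j : SSet.coherentIso.{u} _⦋1⦌) : L.app _ (SSet.ι₀.app _ j) ∈ Y.marked := by
    have := hasLiftingProperty_coherentIso_of_rlp hq
    have sq : CommSq (ofFlat (X := Y) (SSet.ι₀ ≫ L))
        (ofFlat (X := sharp SSet.coherentIso.{u}) (𝟙 SSet.coherentIso.{u})) q
        (toSharp (SSet.ι₀ ≫ L ≫ q.hom)) := ⟨rfl⟩
    have h₁ : sq.lift.hom = SSet.ι₀ ≫ L := congrArg Hom.hom sq.fac_left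
    have h₂ := sq.lift.map_marked j trivial
    rw [h₁] at h₂
    exact h₂
  -- In this square the second coordinate runs along `J`, from `e` at `0` to `f` at `1`. The
  -- vertical sides are an edge of `J` over the source, marked by `hiso`, and a degenerate edge over
  -- the target. Since `f` is marked, lifting against `∂₁ ⊠ edgeFlatSharp` marks `e` too.
  let S : (Δ[1] ⊗ Δ[1] : SSet.{u}) ⟶ Y.toSSet := lift (snd _ _ ≫ edgeHom) (fst _ _) ≫ L
  obtain ⟨l, hl, -, -⟩ := liftsOne_of_rlp hq monos_edgeFlatSharp
    ⟨S, by
      rintro ⟨_, s⟩ ⟨⟨t, rfl⟩, -⟩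
      obtain ⟨j, rfl⟩ : ∃ j : Fin 2, t = SSet.stdSimplex.const 1 j _ :=
        ⟨(t : (Δ[1] : SSet.{u}) _⦋0⦌) 0, SSet.stdSimplex.ext (n := 1) (d := 0) _ _ fun i => by
          fin_cases i
          rfl⟩
      fin_cases j
      · exact hiso (edgeHom.app _ s)
      · have h₁ := ConcreteCategory.congr_hom (congr_app hL₂ (op ⦋1⦌)) (edgeHom.app _ s)
        exact (congrArg (· ∈ Y.marked) h₁).mpr (map_degenerate_mem Y
          (SSet.const (Y.toSSet.δ 0 e) : Δ[0] ⟶ _) (SSet.stdSimplex.const 0 0 _))⟩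
    ⟨SSet.yonedaEquiv.symm f, fun e _ =>
      app_mem_marked_of_yonedaEquiv_mem (by rwa [Equiv.apply_symm_apply]) e⟩
    (toSharp (S ≫ q.hom))
    (hom_ext (by
      ext d t
      have h₁ := hL₁ d (edgeHom.app d t) t
      rw [← edgeHom_app_const_one] at h₁
      exact h₁)) rfl
    (hom_ext (by
      ext d t
      have h₁ := hL₁ d (edgeHom.app d t) t
      rw [← edgeHom_app_const_one] at h₁
      exact congrArg (q.hom.app d) h₁.symm))
  have h₁ := l.map_marked (SSet.yonedaEquiv (𝟙 _), SSet.stdSimplex.const 1 0 _) ⟨trivial, trivial⟩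
  have h₂ := ConcreteCategory.congr_hom (congr_app (congrArg Hom.hom hl) (op ⦋1⦌))
    ((SSet.yonedaEquiv (𝟙 _), SSet.stdSimplex.const 1 0 _) : (Δ[1] ⊗ Δ[1] : SSet.{u}) _⦋1⦌)
  have h₃ := hL₀ (op ⦋1⦌) (edgeHom.app _ (SSet.yonedaEquiv (𝟙 _))) (SSet.yonedaEquiv (𝟙 _))
  rw [← edgeHom_app_const_zero] at h₃
  have h₄ := (h₂.trans h₃).trans (Equiv.apply_symm_apply SSet.yonedaEquiv e)
  exact (congrArg (· ∈ Y.marked) h₄).mp h₁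

end MarkedSSet

/-!
### The fibrant objects of the Cartesian model structure
-/

lemma CategoryTheory.hasLiftingProperty_terminal_from_iff {C : Type u} [Category.{v} C]
    [HasTerminal C] {K L : C} (i : K ⟶ L) (W : C) :
    HasLiftingProperty i (terminal.from W) ↔ ∀ f : K ⟶ W, ∃ g, i ≫ g = f := by
  constructor
  · intro h f
    have sq : CommSq f i (terminal.from W) (terminal.from L) := ⟨Subsingleton.elim _ _⟩
    exact ⟨sq.lift, sq.fac_left⟩
  · intro h
    refine ⟨fun {f g} sq => ?_⟩
    obtain ⟨l, hl⟩ := h f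
    exact ⟨⟨⟨l, hl, Subsingleton.elim _ _⟩⟩⟩

namespace MarkedSSet

variable {B : MarkedSSet.{u}}

lemma isRightFibrant_over_iff (W : Over B) :
    FunctorialCylinder.IsRightFibrant (markedRightAnodyne.over (X := B)) W ↔
      markedRightAnodyne.rlp W.hom := by
  constructor
  · intro h K L i hi
    refine ⟨fun {f g} sq => ?_⟩
    let i' : Over.mk (i ≫ g) ⟶ Over.mk g := Over.homMk i
    obtain ⟨l, hl⟩ := (hasLiftingProperty_terminal_from_iff i' W).1 (h i' hi) (Over.homMk f sq.w)
    exact ⟨⟨⟨l.left, congrArg CommaMorphism.left hl, Over.w l⟩⟩⟩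
  · intro h K L i hi
    rw [hasLiftingProperty_terminal_from_iff]
    intro f
    have := h i.left hi
    have sq : CommSq f.left i.left W.hom L.hom := ⟨(Over.w f).trans (Over.w i).symm⟩
    exact ⟨Over.homMk sq.lift sq.fac_right, Over.OverMorphism.ext sq.fac_left⟩

section

variable {K L W : Over B}

lemma homotopyRel_slice_iff (f g : K ⟶ W) : (cylinder.slice B).HomotopyRel f g ↔
    ∃ h : cylinder.I.obj K.left ⟶ W.left, cylinder.d₀.app K.left ≫ h = f.left ∧
      cylinder.d₁.app K.left ≫ h = g.left ∧ h ≫ W.hom = cylinder.σ.app K.left ≫ K.hom := by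
  constructor
  · rintro ⟨h, rfl, rfl⟩
    exact ⟨h.left, rfl, rfl, Over.w h⟩
  · rintro ⟨h, h₀, h₁, hw⟩
    exact ⟨Over.homMk h hw, Over.OverMorphism.ext h₀, Over.OverMorphism.ext h₁⟩

lemma homotopyRel_slice_refl (f : K ⟶ W) : (cylinder.slice B).HomotopyRel f f := by
  rw [homotopyRel_slice_iff]
  exact ⟨cylinder.σ.app _ ≫ f.left, rfl, rfl, congrArg (cylinder.σ.app K.left ≫ ·) (Over.w f)⟩

/-- Homotopies can be lifted along marked right anodyne extensions. -/
lemma homotopyRel_slice_of_comp (hW : markedRightAnodyne.rlp W.hom) {i : K ⟶ L}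
    (hi : markedRightAnodyne i.left) {g g' : L ⟶ W}
    (h : (cylinder.slice B).HomotopyRel (i ≫ g) (i ≫ g')) :
    (cylinder.slice B).HomotopyRel g g' := by
  rw [homotopyRel_slice_iff] at h ⊢
  obtain ⟨h, h₀, h₁, hw⟩ := h
  obtain ⟨l, -, hl₀, hl₁, hl₂⟩ := liftsBoundary_of_rlp hW hi h g.left g'.left
    (cylinder.σ.app L.left ≫ L.hom) h₀ h₁
    (hw.trans (congrArg (cylinder.σ.app K.left ≫ ·) (Over.w i).symm)) (Over.w g) (Over.w g')
  exact ⟨l, hl₀, hl₁, hl₂⟩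

/-- Homotopies to fibrant objects can be inverted. -/
lemma homotopyRel_slice_symm (hW : markedRightAnodyne.rlp W.hom) {f g : K ⟶ W}
    (h : (cylinder.slice B).HomotopyRel f g) : (cylinder.slice B).HomotopyRel g f := by
  rw [homotopyRel_slice_iff] at h ⊢
  obtain ⟨h, h₀, h₁, hw⟩ := h
  have e₅ : coprod.inl ≫ cylinder.boundary K.left = cylinder.d₀.app K.left := coprod.inl_desc _ _
  have e₆ : coprod.inr ≫ cylinder.boundary K.left = cylinder.d₁.app K.left := coprod.inr_desc _ _
  let c : cylinder.I.obj K.left ⟶ W.left := cylinder.σ.app K.left ≫ g.left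
  have hc₀ : cylinder.d₀.app K.left ≫ c = g.left := rfl
  have hc₁ : cylinder.d₁.app K.left ≫ c = g.left := rfl
  have hcW : c ≫ W.hom = cylinder.σ.app K.left ≫ K.hom :=
    congrArg (cylinder.σ.app K.left ≫ ·) (Over.w g)
  have s₀ : cylinder.I.map (cylinder.d₀.app K.left) ≫ cylinder.σ.app (cylinder.I.obj K.left) ≫
      cylinder.σ.app K.left ≫ K.hom = cylinder.σ.app K.left ≫ K.hom := rfl
  have s₁ : cylinder.I.map (cylinder.d₁.app K.left) ≫ cylinder.σ.app (cylinder.I.obj K.left) ≫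
      cylinder.σ.app K.left ≫ K.hom = cylinder.σ.app K.left ≫ K.hom := rfl
  -- Lift along `∂₁ ⊠ (∂I ⊗ K ⟶ I ⊗ K)`: one side of the square is constant at `g`, the other is
  -- `h`, and the end `1` is constant at `g`. The remaining end goes from `g` to `f`.
  obtain ⟨a, ha₀, ha₁⟩ : ∃ a, cylinder.I.map coprod.inl ≫ a = c ∧
      cylinder.I.map coprod.inr ≫ a = h :=
    ⟨uncurry (coprod.desc (curry c) (curry h)),
      by rw [← uncurry_comp, coprod.inl_desc, uncurry_curry],
      by rw [← uncurry_comp, coprod.inr_desc, uncurry_curry]⟩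
  have n₁ {K L : MarkedSSet.{u}} (f : K ⟶ L) : f ≫ cylinder.d₁.app L =
    cylinder.d₁.app K ≫ cylinder.I.map f := cylinder.d₁.naturality f
  obtain ⟨l, hl₁, -, hl₂⟩ := liftsOne_of_rlp hW (monos_boundary K.left) a c
    (cylinder.σ.app (cylinder.I.obj K.left) ≫ cylinder.σ.app K.left ≫ K.hom) (by
      apply coprod.hom_ext
      · rw [reassoc_of% e₅, reassoc_of% (n₁ (coprod.inl (X := K.left) (Y := K.left))), ha₀]
        exact hc₁.trans hc₀.symm
      · rw [reassoc_of% e₆, reassoc_of% (n₁ (coprod.inr (X := K.left) (Y := K.left))), ha₁]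
        exact h₁.trans hc₁.symm) (by
      apply curryEquiv.injective
      change curry _ = curry _
      apply coprod.hom_ext
      · rw [← curry_map_comp, ← curry_map_comp, ← Category.assoc, ha₀, ← Category.assoc,
          ← Functor.map_comp, e₅, hcW, s₀]
      · rw [← curry_map_comp, ← curry_map_comp, ← Category.assoc, ha₁, ← Category.assoc,
          ← Functor.map_comp, e₆, hw, s₁]) hcW
  refine ⟨cylinder.d₀.app (cylinder.I.obj K.left) ≫ l, ?_, ?_,
    congrArg (cylinder.d₀.app (cylinder.I.obj K.left) ≫ ·) hl₂⟩
  · have : cylinder.I.map (cylinder.d₀.app K.left) ≫ l = c := by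
      rw [← e₅, Functor.map_comp, Category.assoc, hl₁, ha₀]
    exact (congrArg (cylinder.d₀.app K.left ≫ ·) this).trans hc₀
  · have : cylinder.I.map (cylinder.d₁.app K.left) ≫ l = h := by
      rw [← e₆, Functor.map_comp, Category.assoc, hl₁, ha₁]
    have n₀ : cylinder.d₁.app K.left ≫ cylinder.d₀.app (cylinder.I.obj K.left) =
      cylinder.d₀.app K.left ≫ cylinder.I.map (cylinder.d₁.app K.left) :=
        cylinder.d₀.naturality (cylinder.d₁.app K.left)
    refine (Category.assoc _ _ _).symm.trans ((congrArg (· ≫ l) n₀).trans ?_)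
    exact (Category.assoc _ _ _).trans ((congrArg (cylinder.d₀.app K.left ≫ ·) this).trans h₀)

/-- If the end of a homotopy to a fibrant object extends along a monomorphism, then so does
its start. -/
lemma exists_extension_of_homotopyRel (hW : markedRightAnodyne.rlp W.hom) {i : K ⟶ L}
    (hi : monos i.left) {f f' : K ⟶ W} (h : (cylinder.slice B).HomotopyRel f f')
    (hf' : ∃ g, i ≫ g = f') : ∃ g, i ≫ g = f := by
  rw [homotopyRel_slice_iff] at h
  obtain ⟨h, h₀, h₁, hw⟩ := h
  obtain ⟨g, rfl⟩ := hf'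
  obtain ⟨l, hl₁, -, hl₂⟩ := liftsOne_of_rlp hW hi h g.left (cylinder.σ.app L.left ≫ L.hom) h₁
    (hw.trans (congrArg (cylinder.σ.app K.left ≫ ·) (Over.w i).symm)) (Over.w g)
  refine ⟨Over.homMk (cylinder.d₀.app L.left ≫ l) (congrArg (cylinder.d₀.app L.left ≫ ·) hl₂),
    Over.OverMorphism.ext ?_⟩
  exact (congrArg (cylinder.d₀.app K.left ≫ ·) hl₁).trans h₀

/-- Homotopy extension moves an extension from the end `1` to the end `0` only; symmetry of
homotopies supplies the other direction. -/
lemma exists_extension_iff_of_eqvGen (hW : markedRightAnodyne.rlp W.hom) {i : K ⟶ L}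
    (hi : monos i.left) {f f' : K ⟶ W}
    (h : Relation.EqvGen (cylinder.slice B).HomotopyRel f f') :
    (∃ g, i ≫ g = f) ↔ ∃ g, i ≫ g = f' := by
  induction h with
  | rel f f' h =>
    exact ⟨exists_extension_of_homotopyRel hW hi (homotopyRel_slice_symm hW h),
      exists_extension_of_homotopyRel hW hi h⟩
  | refl f => exact Iff.rfl
  | symm f f' _ ih => exact ih.symm
  | trans f f' f'' _ _ ih ih' => exact ih.trans ih'

lemma quot_mk_eq_of_eqvGen (hW : markedRightAnodyne.rlp W.hom) {i : K ⟶ L}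
    (hi : markedRightAnodyne i.left) {f f' : K ⟶ W}
    (h : Relation.EqvGen (cylinder.slice B).HomotopyRel f f') {g g' : L ⟶ W} (hg : i ≫ g = f)
    (hg' : i ≫ g' = f') :
    Quot.mk (cylinder.slice B).HomotopyRel g = Quot.mk (cylinder.slice B).HomotopyRel g' := by
  induction h generalizing g g' with
  | rel f f' h =>
    subst hg hg'
    exact Quot.sound (homotopyRel_slice_of_comp hW hi h)
  | refl f =>
    subst hg
    exact Quot.sound (homotopyRel_slice_of_comp hW hi (hg' ▸ homotopyRel_slice_refl _))
  | symm f f' _ ih => exact (ih hg' hg).symm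
  | trans f f' f'' _ _ ih ih' =>
    -- The intermediate map also extends to `L`, since `W` is right fibrant.
    obtain ⟨g'', hg''⟩ := (hasLiftingProperty_terminal_from_iff i W).1
      ((isRightFibrant_over_iff W).2 hW i hi) f'
    exact (ih hg hg'').trans (ih' hg'' hg')

end

lemma over_markedRightAnodyne_le : markedRightAnodyne.over (X := B) ≤
    monos.over (X := B) ⊓ (cylinder.slice B).weakEquivalences (markedRightAnodyne.over (X := B)) := by
  intro K L i hi
  refine ⟨markedRightAnodyne_le_monos _ hi, fun W hW => ?_⟩
  rw [isRightFibrant_over_iff] at hW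
  constructor
  · rintro ⟨g⟩ ⟨g'⟩ h
    exact quot_mk_eq_of_eqvGen hW hi (Quot.eqvGen_exact h) rfl rfl
  · rintro ⟨f⟩
    obtain ⟨g, hg⟩ := (hasLiftingProperty_terminal_from_iff i W).1
      ((isRightFibrant_over_iff W).2 hW i hi) f
    exact ⟨Quot.mk _ g, congrArg (Quot.mk _) hg⟩

/-- The fibrant objects of the Cartesian model structure are the marked right fibrations. -/
lemma isCartesianFibrant_iff (Y : Over B) :
    IsCartesianFibrant Y ↔ markedRightAnodyne.rlp Y.hom := by
  constructor
  · intro h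
    rw [← isRightFibrant_over_iff]
    exact MorphismProperty.antitone_rlp over_markedRightAnodyne_le _ h
  · intro h K L i hi
    rw [hasLiftingProperty_terminal_from_iff]
    intro f
    -- Surjectivity on homotopy classes extends `f` up to homotopy; the restriction of `v` extends
    -- strictly, hence so does `f`.
    obtain ⟨⟨v⟩, hv⟩ := (hi.2 Y ((isRightFibrant_over_iff Y).2 h)).2 (Quot.mk _ f)
    exact (exists_extension_iff_of_eqvGen h hi.1 (Quot.eqvGen_exact hv)).1 ⟨v, rfl⟩

lemma rlp_hom_of_isCartesianFibration {A : SSet.{u}} {Y : MarkedSSet.{u}} {q : Y ⟶ sharp A}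
    (hq : SSet.IsCartesianFibration q.hom)
    (hY : ∀ e, e ∈ Y.marked ↔ SSet.IsCartesianEdge q.hom e) : markedRightAnodyne.rlp q := by
  intro K L i hi
  have := rlp_naturalMap hq hq.isCartesianEdge_degenerate i hi
  refine ⟨fun {f g} sq => ?_⟩
  have sq' : CommSq (⟨f.hom, fun e he => (hY _).1 (f.map_marked e he)⟩ : K ⟶ natural _ _) i
    (naturalMap hq.isCartesianEdge_degenerate) g := ⟨hom_ext (congrArg Hom.hom sq.w :)⟩
  have : sq'.HasLift := this.sq_hasLift sq'
  exact ⟨⟨⟨⟨sq'.lift.hom, fun e he => (hY _).2 (sq'.lift.map_marked e he)⟩,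
    hom_ext (congrArg Hom.hom sq'.fac_left :), hom_ext (congrArg Hom.hom sq'.fac_right :)⟩⟩⟩

end MarkedSSet

theorem mainTheorem8 (A : SSet.{u}) :
    (∀ (X : SSet.{u}) (p : X ⟶ A), SSet.InnerFibration p →
      (SSet.IsCartesianFibration p ↔
        ∃ h : ∀ x : X _⦋0⦌, SSet.IsCartesianEdge p (X.σ 0 x),
          MarkedSSet.markedRightFibrations
            (MarkedSSet.toSharp p : MarkedSSet.natural p h ⟶ MarkedSSet.sharp A))) ∧
    (∀ Y : Over (MarkedSSet.sharp A),
      MarkedSSet.IsCartesianFibrant Y ↔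
        SSet.IsCartesianFibration Y.hom.hom ∧
          ∀ e : Y.left.toSSet _⦋1⦌,
            e ∈ Y.left.marked ↔ SSet.IsCartesianEdge Y.hom.hom e) := by
  refine ⟨fun X p _ => ⟨fun hp => ⟨hp.isCartesianEdge_degenerate, ?_⟩, ?_⟩, fun Y => ?_⟩
  · exact MarkedSSet.rlp_naturalMap hp _
  · rintro ⟨h, hp⟩
    exact MarkedSSet.isCartesianFibration_of_rlp hp
  · rw [MarkedSSet.isCartesianFibrant_iff]
    constructor
    · intro h
      exact ⟨MarkedSSet.isCartesianFibration_of_rlp h, fun e =>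
        ⟨MarkedSSet.isCartesianEdge_of_mem_marked h, MarkedSSet.mem_marked_of_isCartesianEdge h⟩⟩
    · rintro ⟨h, hY⟩
      exact MarkedSSet.rlp_hom_of_isCartesianFibration h hY
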